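/- Let $n\ge 2$, let $J_n$ be the $n\times n$ matrix with $(J_n)_{i,i+1}=1$ and all other entries $0$, and $e_n=(0,\dots,0,1)^T$. Write $s(x)=x/\max(1,|x|)$ and $\lfloor x\rceil^a=|x|^a\,\mathrm{sign}(x)$. **$S$-functions.** $\sigma:\mathbb R\to\mathbb R$ is an $S$-function with constants $a_1,a_2,b_1,b_2>0$, $a_1\le a_2$, $\frac{a_1}{b_1}\le\frac{a_2}{b_2}$, if it is locally Lipschitz, $a_1x\,s(x/b_1)\le x\sigma(x)\le a_2x\,s(x/b_2)$ for all $x$, the limits $\sigma_{\pm\infty}=\lim_{x\to\pm\infty}\sigma(x)$ exist with $\sigma_{-\infty}=-\sigma_{+\infty}$, and $|\sigma(|x|)-\sigma_{+\infty}|\le C_\sigma/(1+|x|)$ for all $x$ and some $C_\sigma>0$. **The functions $\omega_i$, $V_n$.** Let $p_i=1-\frac{i-1}{n}$, $\beta_i=\frac{n-1+i}{n-i}$ $(0\le i\le n-1)$ and $\alpha=\frac{2(n-1)}{2n-1}$. For $l_1,\dots,l_n>0$ put $v_0=0$ and, for $1\le i\le n$, $\omega_i=\lfloor x_i\rceil^{\beta_{i-1}}-\lfloor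 v_{i-1}\rceil^{\beta_{i-1}}$, $v_i=-l_i\lfloor\omega_i\rceil^{p_{i+1}/(p_i\beta_{i-1})}$, and $$V_n(x)=\sum_{i=1}^n\Big(\frac{|x_i|^{\beta_{i-1}+1}-|v_{i-1}|^{\beta_{i-1}+1}}{\beta_{i-1}+1}-\lfloor v_{i-1}\rceil^{\beta_{i-1}}(x_i-v_{i-1})\Big).$$ The gains $l_1,\dots,l_n>0$ are called admissible if there is $c>0$ such that, for all $x\ne0$ and $u\in\mathbb R$, $$\nabla V_n(x)\cdot(J_nx+e_nu)\le -c\,V_n(x)^\alpha+\omega_n(x)\big(u+l_n\,\mathrm{sign}(\omega_n(x))\big).$$ **The feedback.** For admissible gains and an $S$-function $\sigma$ as above, let $K\in\mathbb R^n$ and $P$ symmetric positive definite satisfy $$\Big(J_n-\rho\tfrac{l_n}{\sigma_{+\infty}}e_nK^T\Big)^TP+P\Big(J_n-\rho\tfrac{l_n}{\sigma_{+\infty}}e_nK^T\Big)\le -\mathrm{Id}_n\quad\text{for all }\rho\in\Big[\frac{a_1}{b_1},\frac{a_2}{b_2}\Big].\tag{1}$$ Put $V_0(x)=(x^TPx)^{1/2}$,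 $W=\min(V_0,V_n^\alpha)$ and, for $A,k>0$, $\omega(x)=\omega_n(x)$ if $V_0(x)>A$ and $\omega(x)=K^Tx/k$ if $V_0(x)\le A$. A trajectory of $$\dot x=J_nx-\frac{l_n}{\sigma_{+\infty}}e_n\,\sigma(k\omega(x)+d)\tag{2}$$ is a locally absolutely continuous $x:[0,\infty)\to\mathbb R^n$ satisfying (2) for almost every $t$. $L_p$-norms are taken on $\mathbb R_+=[0,\infty)$, and $\mathcal K_\infty$ is the set of continuous strictly increasing $\gamma:\mathbb R_+\to\mathbb R_+$ with $\gamma(0)=0$ and $\gamma(s)\to\infty$ as $s\to\infty$. **Proposition.** Admissible gains exist. Let $l_1,\dots,l_n$ be any admissible gains and $\sigma$ any $S$-function with constants $a_1,a_2,b_1,b_2$. Then pairs $(K,P)$ satisfying (1) exist and, for every such pair and every $A>0$ with $\max_{V_0(x)\le A}|K^Tx|\le\min(1,b_1,b_2)$, there is $k_0>0$ such that for every $k\ge k_0$: * the feedback $k\omega$ is $L_p$-stabilizing for every $p\in[1,\infty]$: there is $\gamma_p\in\mathcal K_\infty$ such that, for every $d\in L_p(\mathbb R_+)$, $\|x\|_p\le\gamma_p(\|d\|_p)$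 for every trajectory of (2) with $x(0)=0$ if $p<\infty$, and $\limsup_{t\to\infty}\|x(t)\|\le\gamma_\infty(\|d\|_\infty)$ for every trajectory of (2) if $p=\infty$; * there is $C_\infty>0$ such that, for every $d\in L_\infty(\mathbb R_+)$ and every trajectory $x$ of (2), $\limsup_{t\to\infty}W(x(t))\le C_\infty\|d\|_\infty$; * for every $p\in[1,\infty)$ there is $C_p>0$ such that, for every $d\in L_p(\mathbb R_+)$ and every trajectory $x$ of (2) with $x(0)=0$, $\|W(x(\cdot))\|_p\le C_p\|d\|_p$ and $x(t)\to0$ as $t\to\infty$. -/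

import Mathlib

open MeasureTheory Filter Topology
open scoped ENNReal NNReal Matrix

noncomputable section

namespace IntegratorChain

/-! States are `x : Fin n → ℝ`. Indices of the recursive construction are `1`-based natural
numbers, as in `x = (x₁, …, xₙ)`; the gains are `l 1, …, l n` (other values of `l` are unused). -/

/-- The `i`-th coordinate `xᵢ`, `1 ≤ i ≤ n` (and `0` for other `i`, which are never used). -/
def coord {n : ℕ} (x : Fin n → ℝ) (i : ℕ) : ℝ :=
  if h : 1 ≤ i ∧ i ≤ n then x ⟨i - 1, by omega⟩ else 0

/-- The Jordan block `Jₙ`. -/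
def J (n : ℕ) : Matrix (Fin n) (Fin n) ℝ :=
  Matrix.of fun i j => if (i : ℕ) + 1 = (j : ℕ) then 1 else 0

/-- The last vector `eₙ` of the canonical basis. -/
def e (n : ℕ) : Fin n → ℝ := fun i => if (i : ℕ) + 1 = n then 1 else 0

/-- The standard saturation `s(x) = x / max(1, |x|)`. -/
def sat (x : ℝ) : ℝ := x / max 1 |x|

/-- The signed power `⌊x⌉ᵃ = |x|ᵃ sign x`. -/
def spow (x a : ℝ) : ℝ := |x| ^ a * Real.sign x

/-- `σ` is an `S`-function with sector constants `a₁, a₂, b₁, b₂` and limit `σinf` at `+∞`. -/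
structure IsSFunction (σ : ℝ → ℝ) (a₁ a₂ b₁ b₂ σinf : ℝ) : Prop where
  locallyLipschitz : LocallyLipschitz σ
  a₁_pos : 0 < a₁
  a₂_pos : 0 < a₂
  b₁_pos : 0 < b₁
  b₂_pos : 0 < b₂
  a_le : a₁ ≤ a₂
  ratio_le : a₁ / b₁ ≤ a₂ / b₂
  lower : ∀ x, a₁ * x * sat (x / b₁) ≤ x * σ x
  upper : ∀ x, x * σ x ≤ a₂ * x * sat (x / b₂)
  tendsto_atTop : Tendsto σ atTop (𝓝 σinf)
  tendsto_atBot : Tendsto σ atBot (𝓝 (-σinf))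
  rate : ∃ C > 0, ∀ x, |σ |x| - σinf| ≤ C / (1 + |x|)

/-- `pᵢ = 1 - (i - 1) / n`. -/
def pExp (n i : ℕ) : ℝ := 1 - ((i : ℝ) - 1) / n

/-- `βᵢ = (n - 1 + i) / (n - i)`; for `i = 0` this is `(n - 1) / n = p₂`. -/
def beta (n i : ℕ) : ℝ := ((n : ℝ) - 1 + i) / ((n : ℝ) - i)

/-- `v₀ = 0` and `vᵢ = -lᵢ ⌊ωᵢ⌉ ^ (pᵢ₊₁ / (pᵢ βᵢ₋₁))`, where
`ωᵢ = ⌊xᵢ⌉ ^ βᵢ₋₁ - ⌊vᵢ₋₁⌉ ^ βᵢ₋₁`. -/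
def v {n : ℕ} (l : ℕ → ℝ) (x : Fin n → ℝ) : ℕ → ℝ
  | 0 => 0
  | i + 1 =>
    -l (i + 1) *
      spow (spow (coord x (i + 1)) (beta n i) - spow (v l x i) (beta n i))
        (pExp n (i + 2) / (pExp n (i + 1) * beta n i))

/-- `ωᵢ = ⌊xᵢ⌉ ^ βᵢ₋₁ - ⌊vᵢ₋₁⌉ ^ βᵢ₋₁`, for `1 ≤ i ≤ n`. -/
def omega {n : ℕ} (l : ℕ → ℝ) (i : ℕ) (x : Fin n → ℝ) : ℝ :=
  spow (coord x i) (beta n (i - 1)) - spow (v l x (i - 1)) (beta n (i - 1))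

/-- `Wᵢ = ∫ s in vᵢ₋₁..xᵢ, (⌊s⌉ ^ βᵢ₋₁ - ⌊vᵢ₋₁⌉ ^ βᵢ₋₁)`, in closed form. -/
def Wpart {n : ℕ} (l : ℕ → ℝ) (i : ℕ) (x : Fin n → ℝ) : ℝ :=
  (|coord x i| ^ (beta n (i - 1) + 1) - |v l x (i - 1)| ^ (beta n (i - 1) + 1))
      / (beta n (i - 1) + 1)
    - spow (v l x (i - 1)) (beta n (i - 1)) * (coord x i - v l x (i - 1))

/-- The homogeneous Lyapunov function `Vₙ = ∑ᵢ Wᵢ`. -/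
def Vn {n : ℕ} (l : ℕ → ℝ) (x : Fin n → ℝ) : ℝ := ∑ i ∈ Finset.Icc 1 n, Wpart l i x

/-- `α = 2 (n - 1) / (2 n - 1)`. -/
def alpha (n : ℕ) : ℝ := 2 * ((n : ℝ) - 1) / (2 * (n : ℝ) - 1)

/-- Admissible gains: `l₁, …, lₙ > 0` such that, for some `c > 0`, the derivative of `Vₙ` along
`ẋ = Jₙ x + eₙ u` is at most `-c Vₙ ^ α + ωₙ (u + lₙ sign ωₙ)` at every `x ≠ 0`, for every `u`. -/
def AdmissibleGains (n : ℕ) (l : ℕ → ℝ) : Prop :=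
  (∀ i, 1 ≤ i → i ≤ n → 0 < l i) ∧
  ∃ c > 0, ∀ x : Fin n → ℝ, x ≠ 0 → ∀ u : ℝ,
    fderiv ℝ (Vn l) x (J n *ᵥ x + u • e n) ≤
      -c * Vn l x ^ alpha n + omega l n x * (u + l n * Real.sign (omega l n x))

/-- `P` is symmetric positive definite and, for all `ρ ∈ [r₁, r₂]`,
`(Jₙ - ρ g eₙ Kᵀ)ᵀ P + P (Jₙ - ρ g eₙ Kᵀ) ≤ -Id`. -/
def IsRobustPair {n : ℕ} (g r₁ r₂ : ℝ) (K : Fin n → ℝ) (P : Matrix (Fin n) (Fin n) ℝ) : Prop :=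
  P.PosDef ∧ ∀ ρ ∈ Set.Icc r₁ r₂,
    (-1 - ((J n - (ρ * g) • Matrix.vecMulVec (e n) K)ᵀ * P
      + P * (J n - (ρ * g) • Matrix.vecMulVec (e n) K))).PosSemidef

/-- `V₀(x) = (xᵀ P x) ^ (1/2)`. -/
def V0 {n : ℕ} (P : Matrix (Fin n) (Fin n) ℝ) (x : Fin n → ℝ) : ℝ := √(x ⬝ᵥ P *ᵥ x)

open Classical in
/-- The feedback `ω`: `ωₙ(x)` where `V₀(x) > A`, and `ω₀(x) / k = Kᵀ x / k` where `V₀(x) ≤ A`. -/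
def feedback {n : ℕ} (l : ℕ → ℝ) (K : Fin n → ℝ) (P : Matrix (Fin n) (Fin n) ℝ) (A k : ℝ)
    (x : Fin n → ℝ) : ℝ :=
  if A < V0 P x then omega l n x else (K ⬝ᵥ x) / k

/-- `W = min(V₀, Vₙ ^ α)`. -/
def W {n : ℕ} (l : ℕ → ℝ) (P : Matrix (Fin n) (Fin n) ℝ) (x : Fin n → ℝ) : ℝ :=
  min (V0 P x) (Vn l x ^ alpha n)

/-- Lebesgue measure on `ℝ₊`. -/
def volPos : Measure ℝ := volume.restrict (Set.Ici 0)

/-- `x` is a trajectory on `ℝ₊` of `ẋ = Jₙ x + g eₙ σ(κ(x) + d)`: it is locally absolutely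
continuous and satisfies the equation at almost every time. -/
def IsTrajectory {n : ℕ} (g : ℝ) (σ : ℝ → ℝ) (κ : (Fin n → ℝ) → ℝ) (d : ℝ → ℝ)
    (x : ℝ → Fin n → ℝ) : Prop :=
  (∀ T > 0, AbsolutelyContinuousOnInterval x 0 T) ∧
  ∀ᵐ t ∂volPos, HasDerivAt x (J n *ᵥ x t + (g * σ (κ (x t) + d t)) • e n) t

/-- Functions of class `𝒦_∞`. -/
def IsKInfty (γ : ℝ≥0 → ℝ≥0) : Prop :=
  Continuous γ ∧ StrictMono γ ∧ γ 0 = 0 ∧ Tendsto γ atTop atTop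

/-- The Euclidean norm on `Fin n → ℝ`. -/
def euclNorm {n : ℕ} (x : Fin n → ℝ) : ℝ := ‖WithLp.toLp 2 x‖

/-- `κ` is an `L_p`-stabilizing feedback for `ẋ = Jₙ x + g eₙ σ(u)`. -/
def IsLpStabilizing {n : ℕ} (g : ℝ) (σ : ℝ → ℝ) (κ : (Fin n → ℝ) → ℝ) (p : ℝ≥0∞) : Prop :=
  ∃ γ : ℝ≥0 → ℝ≥0, IsKInfty γ ∧
    ∀ d : ℝ → ℝ, MemLp d p volPos → ∀ x : ℝ → Fin n → ℝ, IsTrajectory g σ κ d x →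
      (p ≠ ∞ → x 0 = 0 →
        eLpNorm (fun t => euclNorm (x t)) p volPos ≤ γ (eLpNorm d p volPos).toNNReal) ∧
      (p = ∞ →
        limsup (fun t => ENNReal.ofReal (euclNorm (x t))) atTop
          ≤ γ (eLpNorm d p volPos).toNNReal)

end IntegratorChain

end

namespace IntegratorChain

/-! ### Absolutely continuous functions and scalar differential inequalities -/

/-! The proof rests on one locally Lipschitz function, U = Vₙ + λ min(V₀, A), and on the scalar
inequality dU/dt ≤ -c θ(U) + C|d| for almost every t, where θ(u) = min(u, u^α)
(`exists_isDissipative`).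

Where V₀ > A, the second summand is constant and admissibility applies with u = -(lₙ/σ∞) σ(kωₙ + d).
Saturation almost cancels lₙ sign ωₙ, with an error made of a small multiple of |ωₙ| and terms of
order (1 + |d|)/k. By homogeneity |ωₙ| ≤ L Vₙ^α, and Vₙ is bounded below in this region, so for k
large only the |d| term is not absorbed (`exists_outer_decay`). Where V₀ ≤ A, the feedback is Kᵀx,
which lies in the linear sector of σ. Then (1) makes V₀ decay (`exists_inner_decay`), Vₙ grows at
most like V₀ + |d|, and a large λ compensates. The jump of the feedback across V₀ = A costs nothing:
U is absolutely continuous along trajectories, and at almost every time the inequality of the regime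
in force holds (`deriv_min_V0`). None of λ, c, C depends on k.

Both ‖x‖ and W are at most a constant times θ(U) (`exists_le_rate_storage`), so everything follows
from the scalar inequality, with linear gains γ_p. For p = ∞, θ(U) ends up below (C/c)‖d‖_∞ + ε. For
p < ∞, multiplying by θ(U)^(p-1) and integrating bounds ‖θ(U)‖_p. Convergence holds because ∫₀^U
θ^(p-1) is small at some late time and can later grow only by a multiple of the tail of ∫|d|^p.

Admissible gains are chosen one after the other (`exists_gains`). For the weights pᵢ the chain has
degree -1/n and Vₙ has degree 2 - 1/n, so the derivative of Vₙ has degree 2 - 2/n, that of Vₙ^α. The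
part of it already fixed is negative where ωᵢ₊₁ = 0, by the previous step; elsewhere a large lᵢ₊₁
dominates, by compactness of a homogeneous sphere (`IsHom.exists_add_lt`). The vᵢ may fail to be
differentiable, but Vₙ is a C¹ function of the xᵢ and of φᵢ = ⌊vᵢ⌉^βᵢ, which are C¹.

The pair (K, P) comes from an explicit Gramian S with JS + SJᵀ = eeᵀ - S: taking K along S⁻¹e and P
along S⁻¹ gives a feedback of infinite gain margin, so one pair serves every ρ ≥ a₁/b₁. -/

lemma comp_absolutelyContinuousOnInterval_of_locallyLipschitz {X Y : Type*}
    [SeminormedAddCommGroup X] [PseudoMetricSpace Y] {f : X → Y} (hf : LocallyLipschitz f)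
    {x : ℝ → X} {a b : ℝ}
    (hx : AbsolutelyContinuousOnInterval x a b) :
    AbsolutelyContinuousOnInterval (f ∘ x) a b := by
  have hc : IsCompact (x '' Set.uIcc a b) := isCompact_uIcc.image_of_continuousOn hx.continuousOn
  obtain ⟨K, hK⟩ := LocallyLipschitzOn.exists_lipschitzOnWith_of_compact hc hf.locallyLipschitzOn
  rw [absolutelyContinuousOnInterval_iff] at hx ⊢
  intro ε hε
  obtain ⟨δ, hδ, h⟩ := hx (ε / (K + 1)) (by positivity)
  refine ⟨δ, hδ, fun E hE hlt => ?_⟩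
  have h1 := h E hE hlt
  have hmem : ∀ i ∈ Finset.range E.1, (E.2 i).1 ∈ Set.uIcc a b ∧ (E.2 i).2 ∈ Set.uIcc a b := by
    intro i hi
    exact hE.1 i hi
  calc ∑ i ∈ Finset.range E.1, dist ((f ∘ x) (E.2 i).1) ((f ∘ x) (E.2 i).2)
      ≤ ∑ i ∈ Finset.range E.1, (K + 1) * dist (x (E.2 i).1) (x (E.2 i).2) := by
        refine Finset.sum_le_sum fun i hi => ?_
        have := hK.dist_le_mul _ (Set.mem_image_of_mem x (hmem i hi).1) _
          (Set.mem_image_of_mem x (hmem i hi).2)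
        refine this.trans ?_
        gcongr
        linarith
    _ = (K + 1) * ∑ i ∈ Finset.range E.1, dist (x (E.2 i).1) (x (E.2 i).2) := by
        rw [Finset.mul_sum]
    _ < (K + 1) * (ε / (K + 1)) := by gcongr
    _ = ε := by field_simp

lemma ae_volPos_iff {p : ℝ → Prop} : (∀ᵐ t ∂volPos, p t) ↔ ∀ᵐ t, 0 ≤ t → p t := by
  rw [volPos, ae_restrict_iff' measurableSet_Ici]; rfl

/-- Local absolute continuity on `[0, ∞)` restricts to every `[s, t]` with `0 ≤ s ≤ t`. -/
lemma absolutelyContinuousOnInterval_of_forall {X : Type*} [PseudoMetricSpace X] {y : ℝ → X}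
    (hy : ∀ T > 0, AbsolutelyContinuousOnInterval y 0 T) {s t : ℝ} (hs : 0 ≤ s) (hst : s ≤ t) :
    AbsolutelyContinuousOnInterval y s t := by
  refine (hy (t + 1) (by linarith)).mono ?_
  rw [Set.uIcc_of_le hst, Set.uIcc_of_le (by linarith)]
  exact Set.Icc_subset_Icc hs (by linarith)

lemma continuousOn_Ici_of_forall {X : Type*} [SeminormedAddCommGroup X] {y : ℝ → X}
    (hy : ∀ T > 0, AbsolutelyContinuousOnInterval y 0 T) : ContinuousOn y (Set.Ici 0) := by
  intro t ht
  have h := (hy (t + 1) (by linarith [Set.mem_Ici.1 ht])).continuousOn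
  rw [Set.uIcc_of_le (by linarith [Set.mem_Ici.1 ht])] at h
  refine (h t ⟨ht, by linarith⟩).mono_of_mem_nhdsWithin ?_
  rw [← Set.Ici_inter_Iic]
  exact inter_mem self_mem_nhdsWithin (mem_nhdsWithin_of_mem_nhds (Iic_mem_nhds (by linarith)))

lemma sub_le_integral_of_deriv_le {y g : ℝ → ℝ}
    (hy : ∀ T > 0, AbsolutelyContinuousOnInterval y 0 T) {s t : ℝ} (hs : 0 ≤ s) (hst : s ≤ t)
    (hg : IntervalIntegrable g volume s t)
    (h : ∀ᵐ u, u ∈ Set.Ioo s t → deriv y u ≤ g u) : y t - y s ≤ ∫ u in s..t, g u := by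
  have hac := absolutelyContinuousOnInterval_of_forall hy hs hst
  rw [← hac.integral_deriv_eq_sub]
  refine intervalIntegral.integral_mono_ae_restrict hst hac.intervalIntegrable_deriv hg ?_
  rw [← Measure.restrict_congr_set (Ioo_ae_eq_Icc (μ := volume))]
  rw [EventuallyLE, ae_restrict_iff' measurableSet_Ioo]
  exact h

/-- If `y ≥ 0` decreases at a uniform rate outside a closed lower set `p`, then it eventually stays
in `p`. -/
lemma eventually_le_of_deriv_le_neg {y : ℝ → ℝ}
    (hy : ∀ T > 0, AbsolutelyContinuousOnInterval y 0 T) (hpos : ∀ t, 0 ≤ t → 0 ≤ y t)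
    {p : ℝ → Prop} {ε : ℝ} (hε : 0 < ε) (hp : IsClosed {r | p r}) (hmono : ∀ a b, a ≤ b → p b → p a)
    (h : ∀ᵐ t, 0 ≤ t → ¬ p (y t) → deriv y t ≤ -ε) : ∀ᶠ t in atTop, p (y t) := by
  have hdec : ∀ s t, 0 ≤ s → s ≤ t → (∀ u ∈ Set.Ioo s t, ¬ p (y u)) → y t - y s ≤ -ε * (t - s) := by
    intro s t hs hst hu
    have := sub_le_integral_of_deriv_le hy hs hst (g := fun _ => -ε) (by simp) (by
      filter_upwards [h] with u hu' hus using hu' (hs.trans hus.1.le) (hu u hus))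
    simpa [mul_comm] using this
  -- If `p` never held, `y` would have dropped to at most `-ε` at time `y 0 / ε + 1`.
  obtain ⟨t₁, ht₁, hpt₁⟩ : ∃ t, 0 ≤ t ∧ p (y t) := by
    by_contra! hcon
    have ht : 0 ≤ y 0 / ε + 1 := by have := hpos 0 le_rfl; positivity
    have h1 := hdec 0 (y 0 / ε + 1) le_rfl ht (fun u hu => hcon u hu.1.le)
    have h2 := hpos _ ht
    have h3 : ε * (y 0 / ε) = y 0 := by field_simp
    nlinarith
  filter_upwards [eventually_ge_atTop t₁] with t ht
  by_contra hnp
  set S := {u | u ∈ Set.Icc t₁ t ∧ p (y u)} with hS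
  have hcont : ContinuousOn y (Set.Icc t₁ t) :=
    (continuousOn_Ici_of_forall hy).mono fun u hu => ht₁.trans hu.1
  have hSc : IsClosed S := hcont.preimage_isClosed_of_isClosed isClosed_Icc hp
  have hSne : S.Nonempty := ⟨t₁, ⟨le_rfl, ht⟩, hpt₁⟩
  have hSb : BddAbove S := ⟨t, fun u hu => hu.1.2⟩
  -- The last time up to `t` at which `p` holds. After it `y` decreases, so `p` passes on to `t`.
  have hm : sSup S ∈ S := hSc.csSup_mem hSne hSb
  have hsle : sSup S ≤ t := hm.1.2
  have hs0 : 0 ≤ sSup S := ht₁.trans hm.1.1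
  have := hdec (sSup S) t hs0 hsle (fun u hu hpu =>
    absurd (le_csSup hSb (show u ∈ S from ⟨⟨hm.1.1.trans hu.1.le, hu.2.le⟩, hpu⟩)) (not_le.2 hu.1))
  exact hnp (hmono _ _ (by nlinarith) hm.2)

/-- A storage function `y` with dissipation rate `θ(y)` and supply rate `|d|`. -/
structure IsDissipative (θ : ℝ → ℝ) (c C : ℝ) (d y : ℝ → ℝ) : Prop where
  ac : ∀ T > 0, AbsolutelyContinuousOnInterval y 0 T
  nonneg : ∀ t, 0 ≤ t → 0 ≤ y t
  deriv_le : ∀ᵐ t, 0 ≤ t → deriv y t ≤ -c * θ (y t) + C * |d t|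

/-- A dissipation rate: continuous, monotone, and positive exactly on `(0, ∞)`. -/
structure IsRate (θ : ℝ → ℝ) : Prop where
  continuous : Continuous θ
  mono : ∀ a b, 0 ≤ a → a ≤ b → θ a ≤ θ b
  zero : θ 0 = 0
  pos : ∀ a, 0 < a → 0 < θ a

lemma IsRate.nonneg {θ : ℝ → ℝ} (hθ : IsRate θ) {a : ℝ} (ha : 0 ≤ a) : 0 ≤ θ a := by
  rw [← hθ.zero]; exact hθ.mono 0 a le_rfl ha

/-- As long as θ(y) exceeds (C/c) D + ε, dissipation beats supply by c ε. -/
lemma IsDissipative.eventually_le {θ d y : ℝ → ℝ} {c C : ℝ} (h : IsDissipative θ c C d y)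
    (hθ : IsRate θ) (hc : 0 < c) (hC : 0 < C) {D ε : ℝ} (hε : 0 < ε)
    (hd : ∀ᵐ t, 0 ≤ t → |d t| ≤ D) : ∀ᶠ t in atTop, θ (y t) ≤ C / c * D + ε := by
  have key := eventually_le_of_deriv_le_neg h.ac h.nonneg
    -- A rate is monotone only on the half-line; the cut-off makes the condition a lower set of ℝ.
    (p := fun r => θ (max r 0) ≤ C / c * D + ε) (ε := c * ε) (by positivity)
    (isClosed_le (hθ.continuous.comp (by fun_prop)) continuous_const)
    (fun a b hab hb => (hθ.mono _ _ (le_max_right _ _) (max_le_max_right 0 hab)).trans hb) (by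
      filter_upwards [h.deriv_le, hd] with t h1 h2 ht hp
      rw [max_eq_left (h.nonneg t ht)] at hp
      have h3 := h1 ht
      have h4 := h2 ht
      push Not at hp
      have h5 : c * (C / c * D + ε) = C * D + c * ε := by field_simp
      nlinarith)
  filter_upwards [key, eventually_ge_atTop 0] with t ht h0
  rwa [max_eq_left (h.nonneg t h0)] at ht

/-- The weighted power `∫₀ᵘ θ ^ (p - 1)` used to test the dissipation inequality in `L_p`. -/
noncomputable def powerStorage (θ : ℝ → ℝ) (p : ℝ) (u : ℝ) : ℝ := ∫ r in (0 : ℝ)..u, |θ r| ^ (p - 1)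

lemma powerStorage_hasDerivAt {θ : ℝ → ℝ} (hθ : IsRate θ) {p : ℝ} (hp : 1 ≤ p) (u : ℝ) :
    HasDerivAt (powerStorage θ p) (|θ u| ^ (p - 1)) u := by
  have hc : Continuous fun r => |θ r| ^ (p - 1) :=
    (hθ.continuous.abs).rpow_const fun _ => Or.inr (by linarith)
  exact intervalIntegral.integral_hasDerivAt_right (hc.intervalIntegrable _ _)
    hc.aestronglyMeasurable.stronglyMeasurableAtFilter hc.continuousAt

lemma powerStorage_contDiff {θ : ℝ → ℝ} (hθ : IsRate θ) {p : ℝ} (hp : 1 ≤ p) :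
    ContDiff ℝ 1 (powerStorage θ p) := by
  rw [contDiff_one_iff_deriv]
  refine ⟨fun u => (powerStorage_hasDerivAt hθ hp u).differentiableAt, ?_⟩
  have : deriv (powerStorage θ p) = fun r => |θ r| ^ (p - 1) :=
    funext fun u => (powerStorage_hasDerivAt hθ hp u).deriv
  rw [this]
  exact (hθ.continuous.abs).rpow_const fun _ => Or.inr (by linarith)

lemma powerStorage_nonneg {θ : ℝ → ℝ} {p u : ℝ} (hu : 0 ≤ u) : 0 ≤ powerStorage θ p u :=
  intervalIntegral.integral_nonneg hu fun _ _ => by positivity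

lemma powerStorage_strictMonoOn {θ : ℝ → ℝ} (hθ : IsRate θ) {p : ℝ} (hp : 1 ≤ p) :
    StrictMonoOn (powerStorage θ p) (Set.Ici 0) := by
  refine strictMonoOn_of_deriv_pos (convex_Ici 0) (powerStorage_contDiff hθ hp).continuous.continuousOn
    fun u hu => ?_
  rw [interior_Ici] at hu
  rw [(powerStorage_hasDerivAt hθ hp u).deriv]
  have := hθ.pos u hu
  positivity

/-- Either C b is absorbed by half of c a, or a ≤ (2C/c) b and the whole left side is controlled by
b^p. -/
lemma mul_rpow_le_add {a b c C p : ℝ} (ha : 0 ≤ a) (hb : 0 ≤ b) (hc : 0 < c) (hC : 0 < C)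
    (hp : 1 ≤ p) :
    a ^ (p - 1) * (-c * a + C * b) ≤ -(c / 2) * a ^ p + C * (2 * C / c) ^ (p - 1) * b ^ p := by
  have hsplit : ∀ x : ℝ, 0 ≤ x → x ^ p = x ^ (p - 1) * x := by
    intro x hx
    rcases hx.eq_or_lt with rfl | hx
    · rw [Real.zero_rpow (by linarith)]; simp
    · rw [← Real.rpow_add_one hx.ne']; ring_nf
  rw [hsplit a ha, hsplit b hb]
  have hA : 0 ≤ a ^ (p - 1) := by positivity
  have hB : 0 ≤ b ^ (p - 1) := by positivity
  have hD : 0 ≤ (2 * C / c) ^ (p - 1) := by positivity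
  by_cases h : C * b ≤ c / 2 * a
  · have h1 : a ^ (p - 1) * (-c * a + C * b) ≤ a ^ (p - 1) * (-c * a + c / 2 * a) := by gcongr
    have h2 : 0 ≤ C * (2 * C / c) ^ (p - 1) * (b ^ (p - 1) * b) := by positivity
    nlinarith
  · push Not at h
    have h1 : a ≤ 2 * C / c * b := by
      rw [div_mul_eq_mul_div, le_div_iff₀ hc]; linarith
    have h2 : a ^ (p - 1) ≤ (2 * C / c) ^ (p - 1) * b ^ (p - 1) := by
      rw [← Real.mul_rpow (by positivity) hb]
      exact Real.rpow_le_rpow ha h1 (by linarith)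
    have h3 : a ^ (p - 1) * (C * b) ≤ (2 * C / c) ^ (p - 1) * b ^ (p - 1) * (C * b) := by gcongr
    have h4 : 0 ≤ a ^ (p - 1) * (c * a) := by positivity
    nlinarith

/-- The dissipation inequality is multiplied by θ(y)^(p-1), which turns its left side into the
derivative of `powerStorage θ p ∘ y`; half of the dissipation pays for the supply. -/
lemma IsDissipative.powerStorage_sub_le {θ d y : ℝ → ℝ} {c C : ℝ} (h : IsDissipative θ c C d y)
    (hθ : IsRate θ) (hc : 0 < c) (hC : 0 < C) {p : ℝ} (hp : 1 ≤ p)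
    (hd : IntegrableOn (fun t => |d t| ^ p) (Set.Ici 0)) {s t : ℝ} (hs : 0 ≤ s) (hst : s ≤ t) :
    powerStorage θ p (y t) - powerStorage θ p (y s) ≤
      -(c / 2) * (∫ u in s..t, θ (y u) ^ p)
        + C * (2 * C / c) ^ (p - 1) * ∫ u in s..t, |d u| ^ p := by
  have hac : ∀ T > 0, AbsolutelyContinuousOnInterval (powerStorage θ p ∘ y) 0 T := fun T hT =>
    comp_absolutelyContinuousOnInterval_of_locallyLipschitz
      (powerStorage_contDiff hθ hp).locallyLipschitz (h.ac T hT)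
  have hycont : ContinuousOn y (Set.uIcc s t) := by
    rw [Set.uIcc_of_le hst]
    exact (continuousOn_Ici_of_forall h.ac).mono fun u hu => hs.trans hu.1
  have hi1 : IntervalIntegrable (fun u => θ (y u) ^ p) volume s t :=
    ((hθ.continuous.comp_continuousOn hycont).rpow_const fun _ _ =>
      Or.inr (by linarith)).intervalIntegrable
  have hi2 : IntervalIntegrable (fun u => |d u| ^ p) volume s t := by
    rw [intervalIntegrable_iff_integrableOn_Icc_of_le hst]
    exact hd.mono_set fun u hu => hs.trans hu.1
  have := sub_le_integral_of_deriv_le hac hs hst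
    (g := fun u => -(c / 2) * θ (y u) ^ p + C * (2 * C / c) ^ (p - 1) * |d u| ^ p)
    ((hi1.const_mul _).add (hi2.const_mul _)) (by
      filter_upwards [h.deriv_le, (h.ac (t + 1) (by linarith)).ae_differentiableAt]
        with u h1 h2 hu
      have hu0 : 0 ≤ u := hs.trans hu.1.le
      have hdy : DifferentiableAt ℝ y u := h2 (by
        rw [Set.uIcc_of_le (by linarith)]; exact ⟨hu0, by linarith [hu.2]⟩)
      have hder : HasDerivAt (powerStorage θ p ∘ y) (|θ (y u)| ^ (p - 1) * deriv y u) u :=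
        (powerStorage_hasDerivAt hθ hp (y u)).comp u hdy.hasDerivAt
      rw [hder.deriv]
      have hnn : 0 ≤ θ (y u) := hθ.nonneg (h.nonneg u hu0)
      rw [abs_of_nonneg hnn]
      refine le_trans ?_ (mul_rpow_le_add hnn (abs_nonneg (d u)) hc hC hp)
      exact mul_le_mul_of_nonneg_left (h1 hu0) (by positivity))
  rw [intervalIntegral.integral_add (hi1.const_mul _) (hi2.const_mul _),
    intervalIntegral.integral_const_mul, intervalIntegral.integral_const_mul] at this
  exact this

/-- The initial storage vanishes and the final one is nonnegative, so the bound on [0, T] is uniform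
in T. -/
lemma IsDissipative.integrableOn_and_integral_le {θ d y : ℝ → ℝ} {c C : ℝ}
    (h : IsDissipative θ c C d y)
    (hθ : IsRate θ) (hc : 0 < c) (hC : 0 < C) {p : ℝ} (hp : 1 ≤ p)
    (hd : IntegrableOn (fun t => |d t| ^ p) (Set.Ici 0)) (h0 : y 0 = 0) :
    IntegrableOn (fun t => θ (y t) ^ p) (Set.Ici 0) ∧
    ∫ t in Set.Ici 0, θ (y t) ^ p ≤
      2 / c * (C * (2 * C / c) ^ (p - 1)) * ∫ t in Set.Ici 0, |d t| ^ p := by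
  have hcont : ContinuousOn (fun u => θ (y u) ^ p) (Set.Ici 0) :=
    (hθ.continuous.comp_continuousOn (continuousOn_Ici_of_forall h.ac)).rpow_const fun _ _ =>
      Or.inr (by linarith)
  have hbound : ∀ T, 0 ≤ T → ∫ u in (0 : ℝ)..T, θ (y u) ^ p ≤
      2 / c * (C * (2 * C / c) ^ (p - 1)) * ∫ t in Set.Ici 0, |d t| ^ p := by
    intro T hT
    have h1 := h.powerStorage_sub_le hθ hc hC hp hd le_rfl hT
    have h2 : powerStorage θ p (y 0) = 0 := by simp [h0, powerStorage]
    have h3 : 0 ≤ powerStorage θ p (y T) := powerStorage_nonneg (h.nonneg T hT)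
    have h4 : ∫ u in (0 : ℝ)..T, |d u| ^ p ≤ ∫ t in Set.Ici 0, |d t| ^ p := by
      rw [intervalIntegral.integral_of_le hT]
      refine setIntegral_mono_set hd (ae_of_all _ fun _ => by positivity) ?_
      exact LE.le.eventuallyLE fun u hu => hu.1.le
    have h5 : 0 ≤ C * (2 * C / c) ^ (p - 1) := by positivity
    have h6 := mul_le_mul_of_nonneg_left h4 h5
    rw [mul_assoc (2 / c), div_mul_eq_mul_div, le_div_iff₀ hc]
    nlinarith
  have hnn : ∀ t, 0 ≤ t → 0 ≤ θ (y t) ^ p := fun t ht =>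
    Real.rpow_nonneg (hθ.nonneg (h.nonneg t ht)) p
  have hInt : IntegrableOn (fun t => θ (y t) ^ p) (Set.Ioi 0) := by
    refine integrableOn_Ioi_of_intervalIntegral_norm_bounded
      (2 / c * (C * (2 * C / c) ^ (p - 1)) * ∫ t in Set.Ici 0, |d t| ^ p) 0 (b := fun t : ℝ => t)
      (l := atTop) (fun i => ?_) tendsto_id ?_
    · rcases le_total i 0 with hi | hi
      · simp [Set.Ioc_eq_empty_of_le hi]
      · exact ((hcont.mono Set.Icc_subset_Ici_self).integrableOn_Icc).mono_set
          Set.Ioc_subset_Icc_self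
    · filter_upwards [eventually_ge_atTop 0] with T hT
      refine le_of_eq_of_le ?_ (hbound T hT)
      refine intervalIntegral.integral_congr fun u hu => ?_
      rw [Set.uIcc_of_le hT] at hu
      exact Real.norm_of_nonneg (hnn u hu.1)
  refine ⟨(integrableOn_Ici_iff_integrableOn_Ioi (by finiteness)).2 hInt, ?_⟩
  rw [integral_Ici_eq_integral_Ioi]
  refine le_of_tendsto (intervalIntegral_tendsto_integral_Ioi 0 hInt tendsto_id) ?_
  filter_upwards [eventually_ge_atTop 0] with T hT using hbound T hT

/-- Integrability of θ(y)^p makes y small at arbitrarily late times; from such a time on, the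
storage can increase only by a multiple of the tail of ∫|d|^p. -/
lemma IsDissipative.tendsto_zero {θ d y : ℝ → ℝ} {c C : ℝ} (h : IsDissipative θ c C d y)
    (hθ : IsRate θ) (hc : 0 < c) (hC : 0 < C) {p : ℝ} (hp : 1 ≤ p)
    (hd : IntegrableOn (fun t => |d t| ^ p) (Set.Ici 0)) (h0 : y 0 = 0) :
    Tendsto y atTop (𝓝 0) := by
  obtain ⟨hInt, -⟩ := h.integrableOn_and_integral_le hθ hc hC hp hd h0
  set Q := C * (2 * C / c) ^ (p - 1) with hQ
  have hQ0 : 0 < Q := by positivity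
  -- along a sequence of times the dissipation rate is arbitrarily small
  have hfreq : ∀ η > 0, ∀ T, 0 ≤ T → ∃ s ≥ T, y s < η := by
    intro η hη T hT
    by_contra! hcon
    have hη' : 0 < θ η ^ p := Real.rpow_pos_of_pos (hθ.pos η hη) p
    have h1 : IntegrableOn (fun _ : ℝ => θ η ^ p) (Set.Ici T) := by
      refine Integrable.mono (hInt.mono_set (Set.Ici_subset_Ici.2 hT))
        aestronglyMeasurable_const ?_
      rw [ae_restrict_iff' measurableSet_Ici]
      refine ae_of_all _ fun s hs => ?_
      have h2 : θ η ≤ θ (y s) := hθ.mono _ _ hη.le (hcon s hs)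
      rw [Real.norm_of_nonneg hη'.le, Real.norm_of_nonneg
        (Real.rpow_nonneg ((hθ.pos η hη).le.trans h2) p)]
      exact Real.rpow_le_rpow (hθ.pos η hη).le h2 (by linarith)
    rw [integrableOn_const_iff] at h1
    rcases h1 with h1 | h1
    · exact hη'.ne' (by simpa using h1)
    · simp at h1
  have htail : Tendsto (fun T => ∫ t in Set.Ioi T, |d t| ^ p) atTop (𝓝 0) := by
    have hd' : IntegrableOn (fun t => |d t| ^ p) (Set.Ioi 0) := hd.mono_set Set.Ioi_subset_Ici_self
    have h1 := (intervalIntegral_tendsto_integral_Ioi 0 hd' tendsto_id).const_sub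
      (∫ t in Set.Ioi 0, |d t| ^ p)
    rw [sub_self] at h1
    refine h1.congr' ?_
    filter_upwards [eventually_ge_atTop 0] with T hT
    have h2 := intervalIntegral.integral_interval_add_Ioi (μ := volume)
      (f := fun t => |d t| ^ p) (a := 0) (b := T) hd' (hd'.mono_set (Set.Ioi_subset_Ioi hT))
    simp only [id]
    linarith
  rw [Metric.tendsto_atTop]
  intro η hη
  have hΘ : 0 < powerStorage θ p η := by
    have := powerStorage_strictMonoOn hθ hp (Set.self_mem_Ici) (Set.mem_Ici.2 hη.le) hη
    simpa [powerStorage] using this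
  obtain ⟨η', hη', hsmall⟩ : ∃ η' > 0, powerStorage θ p η' < powerStorage θ p η / 2 := by
    have hc0 : Tendsto (powerStorage θ p) (𝓝[>] 0) (𝓝 0) := by
      have := (powerStorage_contDiff hθ hp).continuous.tendsto 0
      simp only [powerStorage, intervalIntegral.integral_same] at this
      exact this.mono_left nhdsWithin_le_nhds
    obtain ⟨η', h1, h2⟩ := ((hc0.eventually (gt_mem_nhds (half_pos hΘ))).and
      self_mem_nhdsWithin).exists
    exact ⟨η', h2, h1⟩
  obtain ⟨T, hT⟩ := ((htail.eventually (gt_mem_nhds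
    (show 0 < powerStorage θ p η / (2 * Q) by positivity))).and (eventually_ge_atTop 0)).exists
  -- At `s` the storage is below half of its value at level η, and the supply after `s` adds less
  -- than the other half.
  obtain ⟨s, hs, hys⟩ := hfreq η' hη' T hT.2
  have hs0 : 0 ≤ s := hT.2.trans hs
  refine ⟨s, fun t hst => ?_⟩
  have ht0 : 0 ≤ t := hs0.trans hst
  rw [Real.dist_eq, sub_zero, abs_of_nonneg (h.nonneg t ht0)]
  have h1 := h.powerStorage_sub_le hθ hc hC hp hd hs0 hst
  have h2 : 0 ≤ ∫ u in s..t, θ (y u) ^ p := intervalIntegral.integral_nonneg hst fun u hu =>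
    Real.rpow_nonneg (hθ.nonneg (h.nonneg u (hs0.trans hu.1))) p
  have h3 : ∫ u in s..t, |d u| ^ p ≤ ∫ u in Set.Ioi T, |d u| ^ p := by
    rw [intervalIntegral.integral_of_le hst]
    refine setIntegral_mono_set (hd.mono_set fun u hu => hT.2.trans (le_of_lt hu))
      (ae_of_all _ fun _ => by positivity) ?_
    exact LE.le.eventuallyLE fun u hu => hs.trans_lt hu.1
  have h4 : Q * ∫ u in s..t, |d u| ^ p < powerStorage θ p η / 2 := by
    calc Q * ∫ u in s..t, |d u| ^ p ≤ Q * ∫ u in Set.Ioi T, |d u| ^ p := by gcongr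
      _ < Q * (powerStorage θ p η / (2 * Q)) := by gcongr; exact hT.1
      _ = powerStorage θ p η / 2 := by field_simp
  have h5 : powerStorage θ p (y s) < powerStorage θ p η' :=
    powerStorage_strictMonoOn hθ hp (h.nonneg s hs0) (Set.mem_Ici.2 (le_of_lt hη')) hys
  refine (powerStorage_strictMonoOn hθ hp).lt_iff_lt (h.nonneg t ht0) (Set.mem_Ici.2 hη.le) |>.1 ?_
  have h6 : 0 ≤ c / 2 * ∫ u in s..t, θ (y u) ^ p := by positivity
  linarith

/-! ### Signed powers -/

@[simp] lemma spow_zero (a : ℝ) : spow 0 a = 0 := by simp [spow]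

lemma spow_of_pos {x : ℝ} (hx : 0 < x) (a : ℝ) : spow x a = x ^ a := by
  simp [spow, Real.sign_of_pos hx, abs_of_pos hx]

lemma spow_neg (x a : ℝ) : spow (-x) a = -spow x a := by
  simp [spow, Real.sign_neg]

lemma spow_of_neg {x : ℝ} (hx : x < 0) (a : ℝ) : spow x a = -(-x) ^ a := by
  rw [← neg_neg x, spow_neg, spow_of_pos (by linarith)]; simp

lemma spow_mul (x y a : ℝ) : spow (x * y) a = spow x a * spow y a := by
  have hsign : Real.sign (x * y) = Real.sign x * Real.sign y := by
    rcases lt_trichotomy x 0 with hx | rfl | hx <;> rcases lt_trichotomy y 0 with hy | rfl | hy <;>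
      simp [Real.sign_of_pos, Real.sign_of_neg, mul_pos_of_neg_of_neg, mul_neg_of_neg_of_pos,
        mul_neg_of_pos_of_neg, *]
  simp only [spow, abs_mul, Real.mul_rpow (abs_nonneg x) (abs_nonneg y), hsign]
  ring

lemma spow_spow (x a b : ℝ) : spow (spow x a) b = spow x (a * b) := by
  rcases lt_trichotomy x 0 with hx | rfl | hx
  · have h : 0 < (-x) ^ a := Real.rpow_pos_of_pos (by linarith) a
    rw [spow_of_neg hx, spow_neg, spow_of_pos h, spow_of_neg hx, Real.rpow_mul (by linarith)]
  · simp
  · have h : 0 < x ^ a := Real.rpow_pos_of_pos hx a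
    rw [spow_of_pos hx, spow_of_pos h, spow_of_pos hx, Real.rpow_mul hx.le]

lemma spow_one (x : ℝ) : spow x 1 = x := by
  rcases lt_trichotomy x 0 with hx | rfl | hx
  · rw [spow_of_neg hx, Real.rpow_one, neg_neg]
  · simp
  · rw [spow_of_pos hx, Real.rpow_one]

lemma abs_spow {a : ℝ} (ha : a ≠ 0) (x : ℝ) : |spow x a| = |x| ^ a := by
  rcases lt_trichotomy x 0 with hx | rfl | hx
  · rw [spow_of_neg hx, abs_neg, abs_of_neg hx, abs_of_nonneg (Real.rpow_nonneg (by linarith) a)]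
  · simp [Real.zero_rpow ha]
  · rw [spow_of_pos hx, abs_of_pos hx, abs_of_nonneg (Real.rpow_nonneg hx.le a)]

lemma spow_mul_self {a : ℝ} (ha : 0 ≤ a) (x : ℝ) : spow x a * x = |x| ^ (a + 1) := by
  rcases lt_trichotomy x 0 with hx | rfl | hx
  · rw [spow_of_neg hx, abs_of_neg hx, Real.rpow_add_one (by linarith)]; ring
  · simp [Real.zero_rpow (show a + 1 ≠ 0 by linarith)]
  · rw [spow_of_pos hx, abs_of_pos hx, Real.rpow_add_one hx.ne']

lemma spow_inv_cancel {a : ℝ} (ha : a ≠ 0) (x : ℝ) : spow (spow x a) (1 / a) = x := by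
  rw [spow_spow, mul_one_div_cancel ha, spow_one]

lemma spow_injective {a : ℝ} (ha : a ≠ 0) : Function.Injective fun x => spow x a := fun x y h => by
  have h' : spow x a = spow y a := h
  rw [← spow_inv_cancel ha x, h', spow_inv_cancel ha]

lemma spow_pos_mul {r : ℝ} (hr : 0 < r) (x a : ℝ) : spow (r * x) a = r ^ a * spow x a := by
  rw [spow_mul, spow_of_pos hr]

/-- This form avoids `Real.sign`, so continuity and monotonicity reduce to powers of nonnegative
numbers. -/
lemma spow_eq_max {a : ℝ} (ha : 0 < a) (x : ℝ) :
    spow x a = (max x 0) ^ a - (max (-x) 0) ^ a := by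
  rcases lt_trichotomy x 0 with hx | rfl | hx
  · rw [spow_of_neg hx, max_eq_right hx.le, max_eq_left (by linarith), Real.zero_rpow ha.ne']; ring
  · simp
  · rw [spow_of_pos hx, max_eq_left hx.le, max_eq_right (by linarith), Real.zero_rpow ha.ne']; ring

lemma continuous_spow {a : ℝ} (ha : 0 < a) : Continuous fun x => spow x a := by
  simp only [spow_eq_max ha]
  exact ((continuous_id.max continuous_const).rpow_const fun _ => Or.inr ha.le).sub
    ((continuous_neg.max continuous_const).rpow_const fun _ => Or.inr ha.le)

lemma strictMono_spow {a : ℝ} (ha : 0 < a) : StrictMono fun x => spow x a := by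
  have hmono : Monotone fun x => spow x a := by
    intro x y hxy
    simp only [spow_eq_max ha]
    have h1 : max x 0 ^ a ≤ max y 0 ^ a :=
      Real.rpow_le_rpow (le_max_right _ _) (max_le_max_right 0 hxy) ha.le
    have h2 : max (-y) 0 ^ a ≤ max (-x) 0 ^ a :=
      Real.rpow_le_rpow (le_max_right _ _) (max_le_max_right 0 (by linarith)) ha.le
    linarith
  exact hmono.strictMono_of_injective (spow_injective ha.ne')

lemma hasDerivAt_spow {a : ℝ} (ha : 1 < a) (x : ℝ) :
    HasDerivAt (fun x => spow x a) (a * |x| ^ (a - 1)) x := by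
  rcases lt_trichotomy x 0 with hx | rfl | hx
  · have h1 : HasDerivAt (fun x : ℝ => -(-x) ^ a) (a * |x| ^ (a - 1)) x := by
      have := ((Real.hasDerivAt_rpow_const (x := -x) (p := a) (Or.inl (by linarith))).comp x
        (hasDerivAt_neg x)).neg
      refine this.congr_deriv ?_
      rw [abs_of_neg hx]; ring
    exact h1.congr_of_eventuallyEq
      ((eventually_lt_nhds hx).mono fun y hy => spow_of_neg hy a)
  -- At the origin the difference quotient is |y|^(a-1), which tends to 0.
  · rw [abs_zero, Real.zero_rpow (by linarith), mul_zero, hasDerivAt_iff_tendsto_slope]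
    have h1 : Tendsto (fun y : ℝ => |y| ^ (a - 1)) (𝓝[≠] 0) (𝓝 0) := by
      have : Continuous fun y : ℝ => |y| ^ (a - 1) :=
        continuous_abs.rpow_const fun _ => Or.inr (by linarith)
      have h2 := this.tendsto 0
      rw [abs_zero, Real.zero_rpow (by linarith)] at h2
      exact h2.mono_left nhdsWithin_le_nhds
    refine h1.congr' ?_
    filter_upwards [self_mem_nhdsWithin] with y hy
    have hy' : y ≠ 0 := hy
    rw [slope_def_field, spow_zero, sub_zero, sub_zero, eq_div_iff hy']
    have h3 : spow y a * y = |y| ^ (a + 1) := spow_mul_self (by linarith) y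
    have h4 : |y| ^ (a + 1) = |y| ^ (a - 1) * (y * y) := by
      rw [show a + 1 = (a - 1) + 2 by ring, Real.rpow_add (abs_pos.2 hy'), Real.rpow_two, sq_abs,
        sq]
    rw [h4, ← mul_assoc] at h3
    exact (mul_right_cancel₀ hy' h3).symm
  · have h1 := Real.hasDerivAt_rpow_const (x := x) (p := a) (Or.inl hx.ne')
    rw [abs_of_pos hx]
    exact h1.congr_of_eventuallyEq ((eventually_gt_nhds hx).mono fun y hy => spow_of_pos hy a)

lemma contDiff_spow {a : ℝ} (ha : 1 < a) : ContDiff ℝ 1 fun x => spow x a := by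
  rw [contDiff_one_iff_deriv]
  refine ⟨fun x => (hasDerivAt_spow ha x).differentiableAt, ?_⟩
  rw [show deriv (fun x => spow x a) = fun x => a * |x| ^ (a - 1) from
    funext fun x => (hasDerivAt_spow ha x).deriv]
  exact continuous_const.mul (continuous_abs.rpow_const fun _ => Or.inr (by linarith))

lemma hasDerivAt_abs_rpow_spow {a : ℝ} (ha : 0 < a) (x : ℝ) :
    HasDerivAt (fun x : ℝ => |x| ^ (a + 1)) ((a + 1) * spow x a) x := by
  convert hasDerivAt_abs_rpow x (p := a + 1) (by linarith) using 1
  rcases lt_trichotomy x 0 with hx | rfl | hx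
  · rw [spow_of_neg hx, abs_of_neg hx, show a + 1 - 2 = a - 1 by ring,
      Real.rpow_sub_one (by linarith)]
    have := hx.ne
    field_simp
  · simp
  · rw [spow_of_pos hx, abs_of_pos hx, show a + 1 - 2 = a - 1 by ring,
      Real.rpow_sub_one hx.ne']
    field_simp

lemma contDiff_abs_rpow {a : ℝ} (ha : 1 < a) : ContDiff ℝ 1 fun x : ℝ => |x| ^ a := by
  rw [contDiff_one_iff_deriv]
  obtain ⟨b, rfl⟩ : ∃ b, a = b + 1 := ⟨a - 1, by ring⟩
  have hb : 0 < b := by linarith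
  refine ⟨fun x => (hasDerivAt_abs_rpow_spow hb x).differentiableAt, ?_⟩
  rw [show deriv (fun x : ℝ => |x| ^ (b + 1)) = fun x => (b + 1) * spow x b from
    funext fun x => (hasDerivAt_abs_rpow_spow hb x).deriv]
  exact continuous_const.mul (continuous_spow hb)

/-- `∫ s in v..x, (⌊s⌉ ^ b - ⌊v⌉ ^ b)` in closed form. -/
noncomputable def youngGap (b x v : ℝ) : ℝ :=
  (|x| ^ (b + 1) - |v| ^ (b + 1)) / (b + 1) - spow v b * (x - v)

/-- The derivative in x is ⌊x⌉^b - ⌊v⌉^b, which has the sign of x - v. -/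
lemma youngGap_pos {b x v : ℝ} (hb : 0 < b) (h : x ≠ v) : 0 < youngGap b x v := by
  have hder : ∀ y, HasDerivAt (fun y => youngGap b y v) (spow y b - spow v b) y := by
    intro y
    have h1 := (((hasDerivAt_abs_rpow_spow hb y).sub_const (|v| ^ (b + 1))).div_const (b + 1)).sub
      (((hasDerivAt_id y).sub_const v).const_mul (spow v b))
    refine h1.congr_deriv ?_
    field_simp
  have hcont : Continuous fun y => youngGap b y v :=
    continuous_iff_continuousAt.2 fun y => (hder y).continuousAt
  have hv : youngGap b v v = 0 := by simp [youngGap]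
  rcases lt_or_gt_of_ne h with h | h
  · have := strictAntiOn_of_deriv_neg (convex_Iic v) hcont.continuousOn (fun y hy => by
      rw [interior_Iic] at hy
      rw [(hder y).deriv]
      exact sub_neg.2 (strictMono_spow hb hy))
    have h1 := this (Set.mem_Iic.2 h.le) (Set.mem_Iic.2 le_rfl) h
    simpa [hv] using h1
  · have := strictMonoOn_of_deriv_pos (convex_Ici v) hcont.continuousOn (fun y hy => by
      rw [interior_Ici] at hy
      rw [(hder y).deriv]
      exact sub_pos.2 (strictMono_spow hb hy))
    have h1 := this (Set.mem_Ici.2 le_rfl) (Set.mem_Ici.2 h.le) h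
    simpa [hv] using h1

lemma youngGap_nonneg {b : ℝ} (hb : 0 < b) (x v : ℝ) : 0 ≤ youngGap b x v := by
  by_cases h : x = v
  · simp [youngGap, h]
  · exact (youngGap_pos hb h).le

/-- The gap as a function of `x` and `φ = ⌊v⌉ ^ b`. -/
lemma youngGap_eq {b : ℝ} (hb : 0 < b) (x v : ℝ) :
    youngGap b x v = |x| ^ (b + 1) / (b + 1) + b / (b + 1) * |spow v b| ^ (1 / b + 1)
      - spow v b * x := by
  have h1 : |spow v b| ^ (1 / b + 1) = |v| ^ (b + 1) := by
    rw [abs_spow hb.ne', ← Real.rpow_mul (abs_nonneg v)]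
    congr 1; field_simp; ring
  rw [h1, youngGap, mul_sub, spow_mul_self hb.le]
  field_simp
  ring

lemma youngGap_mul {b r p : ℝ} (hr : 0 < r) (x v : ℝ) :
    youngGap b (r ^ p * x) (r ^ p * v) = r ^ (p * (b + 1)) * youngGap b x v := by
  have hp : 0 < r ^ p := Real.rpow_pos_of_pos hr p
  have h1 : r ^ (p * (b + 1)) = r ^ (p * b) * r ^ p := by
    rw [← Real.rpow_add hr]; ring_nf
  simp only [youngGap, abs_mul, abs_of_pos hp, spow_pos_mul hp,
    Real.mul_rpow hp.le (abs_nonneg _), ← Real.rpow_mul hr.le, h1]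
  ring

/-! ### Coordinates, truncations and weighted dilations -/

section Exponents

variable {n : ℕ}

lemma pExp_succ (hn : 2 ≤ n) (i : ℕ) : pExp n (i + 1) = ((n : ℝ) - i) / n := by
  have : (0 : ℝ) < n := by positivity
  rw [pExp]; push_cast; field_simp; ring

lemma cast_lt_of_lt {i : ℕ} (hi : i < n) : (i : ℝ) < n := by exact_mod_cast hi

lemma two_le_cast (hn : 2 ≤ n) : (2 : ℝ) ≤ n := by exact_mod_cast hn

lemma pExp_succ_pos (hn : 2 ≤ n) {i : ℕ} (hi : i < n) : 0 < pExp n (i + 1) := by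
  rw [pExp_succ hn]
  have := cast_lt_of_lt hi
  have := two_le_cast hn
  apply div_pos <;> linarith

lemma pExp_succ_le_one (hn : 2 ≤ n) (i : ℕ) : pExp n (i + 1) ≤ 1 := by
  rw [pExp_succ hn, div_le_one (by positivity)]
  have : (0 : ℝ) ≤ i := by positivity
  linarith

lemma beta_pos (hn : 2 ≤ n) {i : ℕ} (hi : i < n) : 0 < beta n i := by
  have := cast_lt_of_lt hi
  have := two_le_cast hn
  have : (0 : ℝ) ≤ i := by positivity
  rw [beta]
  apply div_pos <;> linarith

lemma one_lt_beta {i : ℕ} (hi : i + 1 < n) : 1 < beta n (i + 1) := by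
  have h1 := cast_lt_of_lt hi
  push_cast at h1
  have : (0 : ℝ) ≤ i := by positivity
  rw [beta]
  push_cast
  rw [one_lt_div (by linarith)]
  linarith

lemma pExp_mul_beta (hn : 2 ≤ n) {i : ℕ} (hi : i < n) :
    pExp n (i + 1) * beta n i = ((n : ℝ) - 1 + i) / n := by
  have h1 := cast_lt_of_lt hi
  have := two_le_cast hn
  have h2 : (n : ℝ) - i ≠ 0 := by linarith
  have h3 : (n : ℝ) ≠ 0 := by linarith
  rw [pExp_succ hn, beta]
  field_simp

lemma pExp_mul_beta_pos (hn : 2 ≤ n) {i : ℕ} (hi : i < n) : 0 < pExp n (i + 1) * beta n i :=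
  mul_pos (pExp_succ_pos hn hi) (beta_pos hn hi)

/-- The homogeneity degree of `Vₙ`. -/
lemma pExp_mul_beta_add_one (hn : 2 ≤ n) {i : ℕ} (hi : i < n) :
    pExp n (i + 1) * (beta n i + 1) = 2 - 1 / n := by
  have := two_le_cast hn
  have h3 : (n : ℝ) ≠ 0 := by linarith
  rw [mul_add, pExp_mul_beta hn hi, mul_one, pExp_succ hn]
  field_simp
  ring

/-- The exponent `pᵢ₊₂ / (pᵢ₊₁ βᵢ)` in the definition of `vᵢ₊₁`. -/
lemma ladderExp_nonneg (hn : 2 ≤ n) {i : ℕ} (hi : i < n) :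
    0 ≤ pExp n (i + 2) / (pExp n (i + 1) * beta n i) := by
  refine div_nonneg ?_ (pExp_mul_beta_pos hn hi).le
  have h1 : (i : ℝ) + 1 ≤ n := by exact_mod_cast hi
  rw [pExp_succ hn]
  push_cast
  apply div_nonneg <;> linarith [two_le_cast hn]

lemma ladderExp_mul_beta (hn : 2 ≤ n) {i : ℕ} (hi : i + 1 < n) :
    pExp n (i + 2) / (pExp n (i + 1) * beta n i) * beta n (i + 1)
      = ((n : ℝ) + i) / ((n : ℝ) - 1 + i) := by
  have h0 := two_le_cast hn
  have h1 := pExp_mul_beta hn hi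
  rw [pExp_mul_beta hn (show i < n by omega), div_mul_eq_mul_div, h1]
  have : (0 : ℝ) ≤ i := by positivity
  have h3 : (n : ℝ) ≠ 0 := by linarith
  have h4 : (n : ℝ) - 1 + i ≠ 0 := by linarith
  push_cast
  field_simp
  ring

/-- This is the exponent of ωᵢ₊₁ in φᵢ₊₁; being above 1 it preserves C¹ regularity. -/
lemma one_lt_ladderExp_mul_beta (hn : 2 ≤ n) {i : ℕ} (hi : i + 1 < n) :
    1 < pExp n (i + 2) / (pExp n (i + 1) * beta n i) * beta n (i + 1) := by
  have h0 := two_le_cast hn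
  have : (0 : ℝ) ≤ i := by positivity
  rw [ladderExp_mul_beta hn hi, one_lt_div (by linarith)]
  linarith

/-- The homogeneity degree of the derivative of `Vₙ` along the chain. -/
lemma pExp_mul_beta_mul_ladderExp (hn : 2 ≤ n) {i : ℕ} (hi : i < n) :
    pExp n (i + 1) * beta n i * (pExp n (i + 2) / (pExp n (i + 1) * beta n i) + 1) = 2 - 2 / n := by
  have h0 := two_le_cast hn
  have h3 : (n : ℝ) ≠ 0 := by linarith
  rw [mul_add, mul_div_cancel₀ _ (pExp_mul_beta_pos hn hi).ne', mul_one, pExp_mul_beta hn hi,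
    pExp_succ hn]
  push_cast
  field_simp
  ring

end Exponents

section Coordinates

variable {n : ℕ}

lemma coord_succ (x : Fin n → ℝ) {i : ℕ} (hi : i < n) : coord x (i + 1) = x ⟨i, hi⟩ := by
  rw [coord, dif_pos ⟨by omega, by omega⟩]; rfl

lemma coord_of_lt (x : Fin n → ℝ) {i : ℕ} (hi : n < i) : coord x i = 0 := by
  rw [coord, dif_neg (by omega)]

lemma coord_ext {x y : Fin n → ℝ} (h : ∀ i < n, coord x (i + 1) = coord y (i + 1)) : x = y := by
  ext j
  have := h j j.2
  rwa [coord_succ _ j.2, coord_succ _ j.2] at this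

/-- `coord · i` as a continuous linear map. -/
noncomputable def coordCLM (n i : ℕ) : (Fin n → ℝ) →L[ℝ] ℝ :=
  if h : 1 ≤ i ∧ i ≤ n then ContinuousLinearMap.proj ⟨i - 1, by omega⟩ else 0

lemma coordCLM_apply (i : ℕ) (x : Fin n → ℝ) : coordCLM n i x = coord x i := by
  rw [coordCLM, coord]
  split_ifs <;> rfl

lemma coord_eq_coordCLM (i : ℕ) : (fun x : Fin n → ℝ => coord x i) = coordCLM n i :=
  funext fun x => (coordCLM_apply i x).symm

lemma hasFDerivAt_coord (i : ℕ) (x : Fin n → ℝ) :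
    HasFDerivAt (fun x : Fin n → ℝ => coord x i) (coordCLM n i) x := by
  rw [coord_eq_coordCLM]; exact (coordCLM n i).hasFDerivAt

lemma contDiff_coord (i : ℕ) : ContDiff ℝ 1 (fun x : Fin n → ℝ => coord x i) := by
  rw [coord_eq_coordCLM]; exact (coordCLM n i).contDiff

lemma continuous_coord (i : ℕ) : Continuous (fun x : Fin n → ℝ => coord x i) :=
  (contDiff_coord i).continuous

lemma coord_zero (i : ℕ) : coord (0 : Fin n → ℝ) i = 0 := by
  rw [← coordCLM_apply, map_zero]

/-- The convention that coordinates beyond n vanish makes the last row fit the pattern. -/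
lemma coord_J_mulVec (x : Fin n → ℝ) (i : ℕ) : coord (J n *ᵥ x) (i + 1) = coord x (i + 2) := by
  by_cases hi : i < n
  · rw [coord_succ _ hi]
    simp only [Matrix.mulVec, dotProduct, J, Matrix.of_apply, ite_mul, one_mul, zero_mul]
    by_cases hi' : i + 1 < n
    · rw [coord_succ _ hi', Finset.sum_eq_single ⟨i + 1, hi'⟩]
      · simp
      · intro b _ hb
        rw [if_neg fun h => hb (Fin.ext h.symm)]
      · simp
    · rw [coord_of_lt _ (by omega)]
      refine Finset.sum_eq_zero fun b _ => ?_
      rw [if_neg]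
      have := b.2
      omega
  · rw [coord_of_lt _ (by omega), coord_of_lt _ (by omega)]

lemma coord_e (hn : 2 ≤ n) (i : ℕ) : coord (e n) i = if i = n then 1 else 0 := by
  simp only [coord, e]
  split_ifs <;> first | rfl | (exfalso; omega)

/-- Keep the first `i` coordinates. -/
noncomputable def trunc (n i : ℕ) : (Fin n → ℝ) →L[ℝ] (Fin n → ℝ) :=
  ContinuousLinearMap.pi fun j => if (j : ℕ) < i then ContinuousLinearMap.proj j else 0

lemma coord_trunc (i j : ℕ) (x : Fin n → ℝ) :
    coord (trunc n i x) j = if j ≤ i then coord x j else 0 := by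
  simp only [coord, trunc, ContinuousLinearMap.coe_pi']
  split_ifs <;> first | rfl | (exfalso; omega)

lemma trunc_self (x : Fin n → ℝ) : trunc n n x = x := by
  refine coord_ext fun i hi => ?_
  rw [coord_trunc, if_pos (by omega)]

lemma trunc_trunc_succ (i : ℕ) (x : Fin n → ℝ) : trunc n i (trunc n (i + 1) x) = trunc n i x := by
  refine coord_ext fun j hj => ?_
  simp only [coord_trunc]
  split_ifs <;> first | rfl | (exfalso; omega)

lemma trunc_J_mulVec_trunc_succ (i : ℕ) (x : Fin n → ℝ) :
    trunc n i (J n *ᵥ trunc n (i + 1) x) = trunc n i (J n *ᵥ x) := by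
  refine coord_ext fun j hj => ?_
  simp only [coord_trunc, coord_J_mulVec]
  split_ifs <;> first | rfl | (exfalso; omega)

/-- The dilation with weights `p₁, …, pₙ`. -/
noncomputable def dil (n : ℕ) (r : ℝ) : (Fin n → ℝ) →L[ℝ] (Fin n → ℝ) :=
  ContinuousLinearMap.pi fun j => (r ^ pExp n (j + 1)) • ContinuousLinearMap.proj j

lemma dil_apply (r : ℝ) (x : Fin n → ℝ) (j : Fin n) : dil n r x j = r ^ pExp n (j + 1) * x j := rfl

lemma coord_dil (r : ℝ) (x : Fin n → ℝ) (i : ℕ) :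
    coord (dil n r x) i = r ^ pExp n i * coord x i := by
  rw [coord, coord]
  split_ifs with h
  · rw [dil_apply]
    have : i - 1 + 1 = i := by omega
    simp only [this]
  · simp

lemma dil_one (x : Fin n → ℝ) : dil n 1 x = x := by
  ext j; simp [dil_apply]

lemma dil_dil {r s : ℝ} (hr : 0 < r) (hs : 0 < s) (x : Fin n → ℝ) :
    dil n r (dil n s x) = dil n (r * s) x := by
  ext j
  simp only [dil_apply, Real.mul_rpow hr.le hs.le]
  ring

lemma trunc_dil (i : ℕ) (r : ℝ) (x : Fin n → ℝ) : trunc n i (dil n r x) = dil n r (trunc n i x) := by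
  refine coord_ext fun j hj => ?_
  simp only [coord_trunc, coord_dil]
  split_ifs <;> simp

/-- Consecutive weights differ by 1/n, so the chain has degree -1/n. -/
lemma J_mulVec_dil (hn : 2 ≤ n) {r : ℝ} (hr : 0 < r) (x : Fin n → ℝ) :
    J n *ᵥ dil n r x = r ^ (-(1 / n : ℝ)) • dil n r (J n *ᵥ x) := by
  refine coord_ext fun i hi => ?_
  rw [coord_J_mulVec, coord_dil, ← coordCLM_apply (i + 1) (_ • _), map_smul, coordCLM_apply,
    coord_dil, coord_J_mulVec, smul_eq_mul, ← mul_assoc, ← Real.rpow_add hr]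
  congr 2
  have h0 := two_le_cast hn
  rw [pExp_succ hn, pExp_succ hn]
  push_cast
  have h3 : (n : ℝ) ≠ 0 := by linarith
  field_simp
  ring

/-- The homogeneous norm `∑ |xᵢ| ^ (1 / pᵢ)`. -/
noncomputable def homNorm (x : Fin n → ℝ) : ℝ := ∑ j : Fin n, |x j| ^ (1 / pExp n (j + 1))

lemma homNorm_nonneg (x : Fin n → ℝ) : 0 ≤ homNorm x :=
  Finset.sum_nonneg fun _ _ => by positivity

lemma continuous_homNorm (hn : 2 ≤ n) : Continuous (homNorm (n := n)) := by
  refine continuous_finsetSum _ fun j _ => ?_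
  exact (continuous_abs.comp (continuous_apply j)).rpow_const fun _ =>
    Or.inr (one_div_pos.2 (pExp_succ_pos hn j.2)).le

lemma abs_le_homNorm_rpow (hn : 2 ≤ n) (x : Fin n → ℝ) (j : Fin n) :
    |x j| ≤ homNorm x ^ pExp n (j + 1) := by
  have hp := pExp_succ_pos hn j.2
  have h1 : |x j| ^ (1 / pExp n (j + 1)) ≤ homNorm x :=
    Finset.single_le_sum (f := fun j : Fin n => |x j| ^ (1 / pExp n (j + 1)))
      (fun _ _ => by positivity) (Finset.mem_univ j)
  have h2 := Real.rpow_le_rpow (by positivity) h1 hp.le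
  rwa [← Real.rpow_mul (abs_nonneg _), one_div_mul_cancel hp.ne', Real.rpow_one] at h2

lemma homNorm_pos (hn : 2 ≤ n) {x : Fin n → ℝ} (hx : x ≠ 0) : 0 < homNorm x := by
  refine (homNorm_nonneg x).lt_of_ne' fun h => hx ?_
  ext j
  have := abs_le_homNorm_rpow hn x j
  rw [h, Real.zero_rpow (pExp_succ_pos hn j.2).ne'] at this
  simpa using this

lemma homNorm_dil (hn : 2 ≤ n) {r : ℝ} (hr : 0 < r) (x : Fin n → ℝ) :
    homNorm (dil n r x) = r * homNorm x := by
  simp only [homNorm, Finset.mul_sum]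
  refine Finset.sum_congr rfl fun j _ => ?_
  have hp := pExp_succ_pos hn j.2
  rw [dil_apply, abs_mul, abs_of_pos (Real.rpow_pos_of_pos hr _),
    Real.mul_rpow (Real.rpow_pos_of_pos hr _).le (abs_nonneg _), ← Real.rpow_mul hr.le,
    mul_one_div_cancel hp.ne', Real.rpow_one]

/-- `f` is homogeneous of degree `a` for the weights `p₁, …, pₙ`. -/
def IsHom (a : ℝ) (f : (Fin n → ℝ) → ℝ) : Prop :=
  ∀ r, 0 < r → ∀ x, f (dil n r x) = r ^ a * f x

lemma IsHom.add {a : ℝ} {f g : (Fin n → ℝ) → ℝ} (hf : IsHom a f) (hg : IsHom a g) :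
    IsHom a fun x => f x + g x := fun r hr x => by
  simp only [hf r hr x, hg r hr x]; ring

lemma IsHom.sub {a : ℝ} {f g : (Fin n → ℝ) → ℝ} (hf : IsHom a f) (hg : IsHom a g) :
    IsHom a fun x => f x - g x := fun r hr x => by
  simp only [hf r hr x, hg r hr x]; ring

lemma IsHom.const_mul {a : ℝ} {f : (Fin n → ℝ) → ℝ} (hf : IsHom a f) (c : ℝ) :
    IsHom a fun x => c * f x := fun r hr x => by
  simp only [hf r hr x]; ring

lemma IsHom.mul {a b : ℝ} {f g : (Fin n → ℝ) → ℝ} (hf : IsHom a f) (hg : IsHom b g) :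
    IsHom (a + b) fun x => f x * g x := fun r hr x => by
  simp only [hf r hr x, hg r hr x, Real.rpow_add hr]; ring

lemma IsHom.abs_rpow {a : ℝ} {f : (Fin n → ℝ) → ℝ} (hf : IsHom a f) (b : ℝ) :
    IsHom (a * b) fun x => |f x| ^ b := fun r hr x => by
  have h := Real.rpow_pos_of_pos hr a
  simp only [hf r hr x, abs_mul, abs_of_pos h, Real.mul_rpow h.le (abs_nonneg _),
    Real.rpow_mul hr.le]

lemma IsHom.zero (a : ℝ) : IsHom a fun _ : Fin n → ℝ => (0 : ℝ) := fun r hr x => by simp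

lemma isHom_coord (i : ℕ) : IsHom (pExp n i) fun x : Fin n → ℝ => coord x i :=
  fun r _ x => coord_dil r x i

lemma IsHom.dirDeriv (hn : 2 ≤ n) {a : ℝ} {f : (Fin n → ℝ) → ℝ} (hf : IsHom a f)
    (hd : Differentiable ℝ f) : IsHom (a - 1 / n) fun x => fderiv ℝ f x (J n *ᵥ x) := by
  intro r hr x
  have h1 : HasFDerivAt (fun x => f (dil n r x)) ((fderiv ℝ f (dil n r x)).comp (dil n r)) x :=
    (hd _).hasFDerivAt.comp x (dil n r).hasFDerivAt
  have h2 : HasFDerivAt (fun x => f (dil n r x)) (r ^ a • fderiv ℝ f x) x := by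
    have := (hd x).hasFDerivAt.const_mul (r ^ a)
    refine this.congr_of_eventuallyEq (Eventually.of_forall fun y => hf r hr y)
  have h3 := congrArg (fun L => L (J n *ᵥ x)) (h1.unique h2)
  simp only [ContinuousLinearMap.comp_apply, _root_.smul_apply, smul_eq_mul] at h3
  beta_reduce
  rw [J_mulVec_dil hn hr, map_smul, h3, smul_eq_mul, ← mul_assoc, ← Real.rpow_add hr]
  ring_nf

/-- Homogeneous domination: on a closed cone `E` for the dilations, if `f < 0` where `g = 0`, then
`f + c h < L g` with `c = 1 / L`, for some `L > 0`. -/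
lemma IsHom.exists_add_lt (hn : 2 ≤ n) {a : ℝ} {f g h : (Fin n → ℝ) → ℝ} (hf : IsHom a f)
    (hg : IsHom a g) (hh : IsHom a h) (hfc : Continuous f) (hgc : Continuous g)
    (hhc : Continuous h) (hg0 : ∀ x, 0 ≤ g x) (hh0 : ∀ x, 0 ≤ h x) {E : Set (Fin n → ℝ)}
    (hE : IsClosed E) (hEd : ∀ r, 0 < r → ∀ x ∈ E, dil n r x ∈ E)
    (hneg : ∀ x ∈ E, x ≠ 0 → g x = 0 → f x < 0) :
    ∃ L > 0, ∀ x ∈ E, x ≠ 0 → f x + 1 / L * h x < L * g x := by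
  set S := {x | homNorm x = 1} ∩ E with hS
  have hSc : IsCompact S := by
    refine Metric.isCompact_of_isClosed_isBounded
      ((isClosed_eq (continuous_homNorm hn) continuous_const).inter hE) ?_
    refine (Metric.isBounded_closedBall (x := (0 : Fin n → ℝ)) (r := 1)).subset fun x hx => ?_
    rw [mem_closedBall_zero_iff, pi_norm_le_iff_of_nonneg zero_le_one]
    intro j
    have := abs_le_homNorm_rpow hn x j
    rw [hx.1, Real.one_rpow] at this
    exact this
  have hne : ∀ x ∈ S, x ≠ 0 := by
    rintro x hx rfl
    have h1 : homNorm (0 : Fin n → ℝ) = 1 := hx.1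
    have h2 : homNorm (0 : Fin n → ℝ) = 0 := by
      refine Finset.sum_eq_zero fun j _ => ?_
      simp [Real.zero_rpow (inv_ne_zero (pExp_succ_pos hn j.2).ne')]
    linarith
  -- The open sets increase with m. They cover the sphere: where g = 0, f < 0 and the weight of h
  -- becomes small; where g > 0, the factor of g becomes large.
  obtain ⟨m, hm⟩ := hSc.elim_directed_cover
    (fun m : ℕ => {x | f x + 1 / ((m : ℝ) + 1) * h x < ((m : ℝ) + 1) * g x})
    (fun m => isOpen_lt (hfc.add (continuous_const.mul hhc)) (continuous_const.mul hgc))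
    (by
      intro x hx
      simp only [Set.mem_iUnion, Set.mem_ofPred_eq]
      rcases (hg0 x).eq_or_lt' with hgx | hgx
      · have hfx := hneg x hx.2 (hne x hx) hgx
        obtain ⟨m, hm⟩ := exists_nat_gt (h x / -f x)
        refine ⟨m, ?_⟩
        rw [hgx, mul_zero]
        rw [div_lt_iff₀ (by linarith)] at hm
        have : 1 / ((m : ℝ) + 1) * h x < -f x := by
          rw [one_div, inv_mul_lt_iff₀ (by positivity)]
          linarith
        linarith
      · obtain ⟨m, hm⟩ := exists_nat_gt ((f x + h x) / g x)
        refine ⟨m, ?_⟩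
        rw [div_lt_iff₀ hgx] at hm
        have : 1 / ((m : ℝ) + 1) * h x ≤ h x := by
          refine mul_le_of_le_one_left (hh0 x) ?_
          rw [div_le_one (by positivity)]
          have : (0 : ℝ) ≤ m := by positivity
          linarith
        linarith)
    (by
      refine directed_of_isDirected_le fun m k hmk x hx => ?_
      simp only [Set.mem_ofPred_eq] at hx ⊢
      have hmk' : (m : ℝ) ≤ k := by exact_mod_cast hmk
      have h1 : 1 / ((k : ℝ) + 1) * h x ≤ 1 / ((m : ℝ) + 1) * h x := by
        have := hh0 x
        gcongr
      have h2 : ((m : ℝ) + 1) * g x ≤ ((k : ℝ) + 1) * g x := by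
        have := hg0 x
        gcongr
      linarith)
  refine ⟨(m : ℝ) + 1, by positivity, fun x hxE hx => ?_⟩
  have hN := homNorm_pos hn hx
  -- Since f, g and h have the same degree, the inequality on the sphere spreads along the
  -- dilations.
  set y := dil n (homNorm x)⁻¹ x with hy
  have hyS : y ∈ S := by
    refine ⟨?_, hEd _ (inv_pos.2 hN) x hxE⟩
    change homNorm y = 1
    rw [hy, homNorm_dil hn (inv_pos.2 hN), inv_mul_cancel₀ hN.ne']
  have hxy : x = dil n (homNorm x) y := by
    rw [hy, dil_dil hN (inv_pos.2 hN), mul_inv_cancel₀ hN.ne', dil_one]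
  have h1 : f y + 1 / ((m : ℝ) + 1) * h y < ((m : ℝ) + 1) * g y := hm hyS
  rw [hxy, hf _ hN, hg _ hN, hh _ hN]
  have h2 := mul_lt_mul_of_pos_left h1 (Real.rpow_pos_of_pos hN a)
  linarith

end Coordinates

/-! ### The recursive construction and its Lyapunov function -/

section Ladder

variable {n : ℕ}

/-- `φᵢ = ⌊vᵢ⌉ ^ βᵢ`, which is continuously differentiable although `vᵢ` need not be. -/
noncomputable def phi (l : ℕ → ℝ) (i : ℕ) (x : Fin n → ℝ) : ℝ := spow (v l x i) (beta n i)

lemma v_succ (l : ℕ → ℝ) (i : ℕ) (x : Fin n → ℝ) :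
    v l x (i + 1) =
      -l (i + 1) * spow (omega l (i + 1) x) (pExp n (i + 2) / (pExp n (i + 1) * beta n i)) := rfl

lemma omega_succ (l : ℕ → ℝ) (i : ℕ) (x : Fin n → ℝ) :
    omega l (i + 1) x = spow (coord x (i + 1)) (beta n i) - phi l i x := rfl

lemma Wpart_succ (l : ℕ → ℝ) (i : ℕ) (x : Fin n → ℝ) :
    Wpart l (i + 1) x = youngGap (beta n i) (coord x (i + 1)) (v l x i) := rfl

lemma phi_zero (l : ℕ → ℝ) (x : Fin n → ℝ) : phi l 0 x = 0 := by simp [phi, v]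

lemma phi_succ (l : ℕ → ℝ) (i : ℕ) (x : Fin n → ℝ) :
    phi l (i + 1) x = spow (-l (i + 1)) (beta n (i + 1)) *
      spow (omega l (i + 1) x)
        (pExp n (i + 2) / (pExp n (i + 1) * beta n i) * beta n (i + 1)) := by
  rw [phi, v_succ, spow_mul, spow_spow]

lemma spow_phi (hn : 2 ≤ n) (l : ℕ → ℝ) {i : ℕ} (hi : i < n) (x : Fin n → ℝ) :
    spow (phi l i x) (1 / beta n i) = v l x i :=
  spow_inv_cancel (beta_pos hn hi).ne' _

/-- Beyond the first step φᵢ₊₁ is a constant times a signed power of ωᵢ₊₁ with exponent above 1, and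
ωᵢ₊₁ is C¹ because βᵢ > 1. -/
lemma contDiff_phi (hn : 2 ≤ n) (l : ℕ → ℝ) : ∀ i < n, ContDiff ℝ 1 (phi (n := n) l i) := by
  intro i
  induction i with
  | zero =>
    intro _
    rw [show phi (n := n) l 0 = fun _ => 0 from funext (phi_zero l)]
    exact contDiff_const
  | succ i ih =>
    intro hi
    rw [funext (phi_succ l i)]
    refine contDiff_const.mul ?_
    -- Here β₀ < 1, so ω₁ is not C¹ at the origin; but the two exponents multiply to 1 and φ₁ is
    -- linear in x₁.
    rcases Nat.eq_zero_or_pos i with rfl | hi0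
    · have h : ∀ x : Fin n → ℝ, spow (omega l (0 + 1) x)
          (pExp n (0 + 2) / (pExp n (0 + 1) * beta n 0) * beta n (0 + 1)) = coord x 1 := by
        intro x
        rw [omega_succ, phi_zero, sub_zero, spow_spow, ladderExp_mul_beta hn hi]
        have h0 := two_le_cast hn
        have h1 : (n : ℝ) - 1 ≠ 0 := by linarith
        have h2 : (n : ℝ) ≠ 0 := by linarith
        have h3 : beta n 0 * (((n : ℝ) + (0 : ℕ)) / ((n : ℝ) - 1 + (0 : ℕ))) = 1 := by
          rw [beta]
          simp only [Nat.cast_zero, add_zero, sub_zero]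
          field_simp
        rw [h3, spow_one]
      simp only [h]
      exact contDiff_coord 1
    · refine (contDiff_spow (one_lt_ladderExp_mul_beta hn hi)).comp ?_
      refine ContDiff.sub ?_ (ih (by omega))
      obtain ⟨j, rfl⟩ : ∃ j, i = j + 1 := ⟨i - 1, by omega⟩
      exact (contDiff_spow (one_lt_beta (n := n) (i := j) (by omega))).comp (contDiff_coord _)

lemma continuous_omega (hn : 2 ≤ n) (l : ℕ → ℝ) {i : ℕ} (hi : i < n) :
    Continuous (omega (n := n) l (i + 1)) := by
  rw [funext (omega_succ l i)]
  exact ((continuous_spow (beta_pos hn hi)).comp (continuous_coord _)).sub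
    (contDiff_phi hn l i hi).continuous

lemma continuous_v (hn : 2 ≤ n) (l : ℕ → ℝ) {i : ℕ} (hi : i < n) :
    Continuous (fun x : Fin n → ℝ => v l x i) := by
  rw [← funext (spow_phi hn l hi)]
  exact (continuous_spow (one_div_pos.2 (beta_pos hn hi))).comp (contDiff_phi hn l i hi).continuous

lemma Wpart_eq (hn : 2 ≤ n) (l : ℕ → ℝ) {i : ℕ} (hi : i < n) (x : Fin n → ℝ) :
    Wpart l (i + 1) x = |coord x (i + 1)| ^ (beta n i + 1) / (beta n i + 1)
      + beta n i / (beta n i + 1) * |phi l i x| ^ (1 / beta n i + 1)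
      - phi l i x * coord x (i + 1) := by
  rw [Wpart_succ, youngGap_eq (beta_pos hn hi)]; rfl

/-- Written in x and φ, the gap contains only powers of exponent above 1 and a product. -/
lemma contDiff_Wpart (hn : 2 ≤ n) (l : ℕ → ℝ) {i : ℕ} (hi : i < n) :
    ContDiff ℝ 1 (Wpart (n := n) l (i + 1)) := by
  rw [funext (Wpart_eq hn l hi)]
  have hb := beta_pos hn hi
  have hb' : 0 < 1 / beta n i := one_div_pos.2 hb
  have hφ := contDiff_phi hn l i hi
  exact ((((contDiff_abs_rpow (by linarith)).comp (contDiff_coord _)).div_const _).add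
    (contDiff_const.mul ((contDiff_abs_rpow (by linarith)).comp hφ))).sub
    (hφ.mul (contDiff_coord _))

/-- The gap has partial derivatives ω in x and v - x in φ, so only φ, never v, is differentiated. -/
lemma fderiv_Wpart (hn : 2 ≤ n) (l : ℕ → ℝ) {i : ℕ} (hi : i < n) (x h : Fin n → ℝ) :
    fderiv ℝ (Wpart l (i + 1)) x h = omega l (i + 1) x * coord h (i + 1)
      - (coord x (i + 1) - v l x i) * fderiv ℝ (phi l i) x h := by
  have hb := beta_pos hn hi
  have hb' : 0 < 1 / beta n i := one_div_pos.2 hb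
  have hφ : HasFDerivAt (phi l i) (fderiv ℝ (phi l i) x) x :=
    ((contDiff_phi hn l i hi).differentiable one_ne_zero x).hasFDerivAt
  have hc := hasFDerivAt_coord (i + 1) x
  have h1 := ((((hasDerivAt_abs_rpow_spow hb (coord x (i + 1))).div_const
    (beta n i + 1)).comp_hasFDerivAt x hc).add
    (((hasDerivAt_abs_rpow_spow hb' (phi l i x)).const_mul
      (beta n i / (beta n i + 1))).comp_hasFDerivAt x hφ)).sub (hφ.mul hc)
  have h2 : HasFDerivAt (Wpart l (i + 1)) _ x :=
    h1.congr_of_eventuallyEq (Eventually.of_forall fun y => Wpart_eq hn l hi y)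
  rw [h2.fderiv]
  simp only [_root_.sub_apply, _root_.add_apply, _root_.smul_apply, smul_eq_mul, coordCLM_apply,
    spow_phi hn l hi, omega_succ]
  field_simp
  ring

/-- The partial sums `W₁ + ⋯ + Wᵢ`. -/
noncomputable def Vpart (l : ℕ → ℝ) (i : ℕ) (x : Fin n → ℝ) : ℝ :=
  ∑ j ∈ Finset.range i, Wpart l (j + 1) x

lemma Vn_eq_Vpart (l : ℕ → ℝ) : Vn (n := n) l = Vpart l n := by
  funext x
  rw [Vn, Vpart, Finset.range_eq_Ico, Finset.sum_Ico_add' (fun j => Wpart l j x) 0 n 1]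
  rfl

lemma Vpart_succ (l : ℕ → ℝ) (i : ℕ) (x : Fin n → ℝ) :
    Vpart l (i + 1) x = Vpart l i x + Wpart l (i + 1) x := Finset.sum_range_succ _ _

lemma contDiff_Vpart (hn : 2 ≤ n) (l : ℕ → ℝ) {i : ℕ} (hi : i ≤ n) :
    ContDiff ℝ 1 (Vpart (n := n) l i) :=
  ContDiff.sum fun _ hj => contDiff_Wpart hn l (by have := Finset.mem_range.1 hj; omega)

lemma contDiff_Vn (hn : 2 ≤ n) (l : ℕ → ℝ) : ContDiff ℝ 1 (Vn (n := n) l) := by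
  rw [Vn_eq_Vpart]; exact contDiff_Vpart hn l le_rfl

lemma Wpart_nonneg (hn : 2 ≤ n) (l : ℕ → ℝ) {i : ℕ} (hi : i < n) (x : Fin n → ℝ) :
    0 ≤ Wpart l (i + 1) x := youngGap_nonneg (beta_pos hn hi) _ _

lemma Vn_nonneg (hn : 2 ≤ n) (l : ℕ → ℝ) (x : Fin n → ℝ) : 0 ≤ Vn l x := by
  rw [Vn_eq_Vpart]
  exact Finset.sum_nonneg fun j hj => Wpart_nonneg hn l (Finset.mem_range.1 hj) x

lemma v_zero_state (l : ℕ → ℝ) (i : ℕ) : v l (0 : Fin n → ℝ) i = 0 := by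
  induction i with
  | zero => rfl
  | succ i ih => simp [v, coord_zero, ih]

lemma Vn_zero (l : ℕ → ℝ) : Vn l (0 : Fin n → ℝ) = 0 := by
  rw [Vn_eq_Vpart]
  refine Finset.sum_eq_zero fun j hj => ?_
  rw [Wpart_succ, v_zero_state, coord_zero, youngGap]
  simp

lemma v_congr_coord (l : ℕ → ℝ) {x y : Fin n → ℝ} :
    ∀ i, (∀ j < i, coord x (j + 1) = coord y (j + 1)) → v l x i = v l y i := by
  intro i
  induction i with
  | zero => intro _; rfl
  | succ i ih =>
    intro h
    simp only [v, h i (by omega), ih fun j hj => h j (by omega)]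

/-- If all gaps vanish then each xᵢ equals vᵢ₋₁, and vᵢ₋₁ = 0 once the earlier coordinates are zero.
-/
lemma Vn_pos (hn : 2 ≤ n) (l : ℕ → ℝ) {x : Fin n → ℝ} (hx : x ≠ 0) : 0 < Vn l x := by
  refine (Vn_nonneg hn l x).lt_of_ne' fun h0 => hx ?_
  rw [Vn_eq_Vpart, Vpart, Finset.sum_eq_zero_iff_of_nonneg fun j hj =>
    Wpart_nonneg hn l (Finset.mem_range.1 hj) x] at h0
  refine coord_ext fun i => ?_
  induction i using Nat.strong_induction_on with
  | _ i ih =>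
    intro hi
    have h1 : v l x i = 0 := by
      rw [v_congr_coord l (y := 0) i fun j hj => ih j hj (by omega), v_zero_state]
    have h2 := h0 i (Finset.mem_range.2 hi)
    rw [Wpart_succ, h1] at h2
    rw [coord_zero]
    by_contra hne
    exact (youngGap_pos (beta_pos hn hi) hne).ne' h2

lemma isHom_v (hn : 2 ≤ n) (l : ℕ → ℝ) :
    ∀ i, i ≤ n → IsHom (pExp n (i + 1)) fun x : Fin n → ℝ => v l x i := by
  intro i
  induction i with
  | zero => intro _ r _ x; simp [v]
  | succ i ih =>
    intro hi r hr x
    have hne := (pExp_mul_beta_pos hn (show i < n by omega)).ne'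
    have hp : ∀ a : ℝ, 0 < r ^ a := Real.rpow_pos_of_pos hr
    simp only [v, coord_dil, ih (by omega) r hr x, spow_pos_mul (hp _), ← Real.rpow_mul hr.le,
      ← mul_sub, mul_div_cancel₀ _ hne]
    ring

lemma isHom_phi (hn : 2 ≤ n) (l : ℕ → ℝ) {i : ℕ} (hi : i ≤ n) :
    IsHom (pExp n (i + 1) * beta n i) (phi (n := n) l i) := fun r hr x => by
  rw [phi, phi, show v l (dil n r x) i = _ from isHom_v hn l i hi r hr x,
    spow_pos_mul (Real.rpow_pos_of_pos hr _),
    ← Real.rpow_mul hr.le]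

lemma isHom_omega (hn : 2 ≤ n) (l : ℕ → ℝ) {i : ℕ} (hi : i < n) :
    IsHom (pExp n (i + 1) * beta n i) (omega (n := n) l (i + 1)) := fun r hr x => by
  rw [omega_succ, omega_succ, isHom_phi hn l hi.le r hr x, coord_dil,
    spow_pos_mul (Real.rpow_pos_of_pos hr _), ← Real.rpow_mul hr.le]
  ring

lemma isHom_Vpart (hn : 2 ≤ n) (l : ℕ → ℝ) {i : ℕ} (hi : i ≤ n) :
    IsHom (2 - 1 / n) (Vpart (n := n) l i) := fun r hr x => by
  rw [Vpart, Vpart, Finset.mul_sum]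
  refine Finset.sum_congr rfl fun j hj => ?_
  have hj' : j < n := by have := Finset.mem_range.1 hj; omega
  rw [Wpart_succ, Wpart_succ, coord_dil, show v l (dil n r x) j = _ from
    isHom_v hn l j hj'.le r hr x, youngGap_mul hr,
    pExp_mul_beta_add_one hn hj']

lemma isHom_Vn (hn : 2 ≤ n) (l : ℕ → ℝ) : IsHom (2 - 1 / n) (Vn (n := n) l) := by
  rw [Vn_eq_Vpart]; exact isHom_Vpart hn l le_rfl

/-- The choice of α: it gives Vₙ^α the degree of the derivative of Vₙ along the chain. -/
lemma mul_alpha (hn : 2 ≤ n) : (2 - 1 / n) * alpha n = 2 - 2 / (n : ℝ) := by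
  have h0 := two_le_cast hn
  have h1 : 2 * (n : ℝ) - 1 ≠ 0 := by linarith
  have h2 : (n : ℝ) ≠ 0 := by linarith
  rw [alpha]
  field_simp

lemma alpha_pos (hn : 2 ≤ n) : 0 < alpha n := by
  have h0 := two_le_cast hn
  rw [alpha]; apply div_pos <;> linarith

lemma alpha_lt_one (hn : 2 ≤ n) : alpha n < 1 := by
  have h0 := two_le_cast hn
  rw [alpha, div_lt_one (by linarith)]; linarith

lemma isHom_Vn_rpow (hn : 2 ≤ n) (l : ℕ → ℝ) :
    IsHom (2 - 2 / n) fun x : Fin n → ℝ => Vn l x ^ alpha n := by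
  have h := (isHom_Vn hn l).abs_rpow (alpha n)
  rw [mul_alpha hn] at h
  simpa only [abs_of_nonneg (Vn_nonneg hn l _)] using h

lemma continuous_Vn_rpow (hn : 2 ≤ n) (l : ℕ → ℝ) :
    Continuous fun x : Fin n → ℝ => Vn l x ^ alpha n :=
  (contDiff_Vn hn l).continuous.rpow_const fun _ => Or.inr (alpha_pos hn).le

/-! ### Truncated systems and the choice of the gains -/

lemma fderiv_comp_trunc {f : (Fin n → ℝ) → ℝ} {i : ℕ} (hf : ∀ x, f (trunc n i x) = f x)
    (hd : Differentiable ℝ f) (x h : Fin n → ℝ) :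
    fderiv ℝ f (trunc n i x) (trunc n i h) = fderiv ℝ f x h := by
  have h1 : HasFDerivAt (fun x => f (trunc n i x))
      ((fderiv ℝ f (trunc n i x)).comp (trunc n i)) x :=
    (hd _).hasFDerivAt.comp x (trunc n i).hasFDerivAt
  simp only [hf] at h1
  rw [h1.fderiv]
  rfl

lemma v_trunc (l : ℕ → ℝ) {i j : ℕ} (hij : i ≤ j) (x : Fin n → ℝ) :
    v l (trunc n j x) i = v l x i :=
  v_congr_coord l i fun k hk => by rw [coord_trunc, if_pos (by omega)]

lemma phi_trunc (l : ℕ → ℝ) {i j : ℕ} (hij : i ≤ j) (x : Fin n → ℝ) :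
    phi l i (trunc n j x) = phi l i x := by
  rw [phi, v_trunc l hij]; rfl

lemma omega_trunc (l : ℕ → ℝ) (i : ℕ) (x : Fin n → ℝ) :
    omega l (i + 1) (trunc n (i + 1) x) = omega l (i + 1) x := by
  rw [omega_succ, omega_succ, phi_trunc l (by omega), coord_trunc, if_pos le_rfl]

lemma Vpart_trunc (l : ℕ → ℝ) (i : ℕ) (x : Fin n → ℝ) :
    Vpart l i (trunc n i x) = Vpart l i x := by
  refine Finset.sum_congr rfl fun j hj => ?_
  have := Finset.mem_range.1 hj
  rw [Wpart_succ, Wpart_succ, v_trunc l (by omega), coord_trunc, if_pos (by omega)]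

/-- The derivative of `W₁ + ⋯ + Wᵢ₊₁` along the chain, up to the term `ωᵢ₊₁ xᵢ₊₂`. -/
noncomputable def drift (l : ℕ → ℝ) (i : ℕ) (x : Fin n → ℝ) : ℝ :=
  fderiv ℝ (Vpart l i) x (J n *ᵥ x)
    - (coord x (i + 1) - v l x i) * fderiv ℝ (phi l i) x (J n *ᵥ x)

lemma fderiv_Vpart_succ (hn : 2 ≤ n) (l : ℕ → ℝ) {i : ℕ} (hi : i < n) (x h : Fin n → ℝ) :
    fderiv ℝ (Vpart l (i + 1)) x h = fderiv ℝ (Vpart l i) x h + omega l (i + 1) x * coord h (i + 1)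
      - (coord x (i + 1) - v l x i) * fderiv ℝ (phi l i) x h := by
  rw [show Vpart (n := n) l (i + 1) = fun x => Vpart l i x + Wpart l (i + 1) x from
    funext (Vpart_succ l i)]
  rw [fderiv_fun_add ((contDiff_Vpart hn l hi.le).differentiable one_ne_zero x)
    ((contDiff_Wpart hn l hi).differentiable one_ne_zero x)]
  simp only [_root_.add_apply, fderiv_Wpart hn l hi]
  ring

lemma fderiv_Vpart_J_mulVec (hn : 2 ≤ n) (l : ℕ → ℝ) {i : ℕ} (hi : i < n) (x : Fin n → ℝ) :
    fderiv ℝ (Vpart l (i + 1)) x (J n *ᵥ x) = drift l i x + omega l (i + 1) x * coord x (i + 2) := by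
  rw [fderiv_Vpart_succ hn l hi, drift, coord_J_mulVec]
  ring

lemma continuous_drift (hn : 2 ≤ n) (l : ℕ → ℝ) {i : ℕ} (hi : i < n) :
    Continuous (drift (n := n) l i) := by
  have hJ : Continuous fun x : Fin n → ℝ => J n *ᵥ x := by fun_prop
  have h1 : Continuous fun x : Fin n → ℝ => fderiv ℝ (Vpart l i) x (J n *ᵥ x) :=
    ((contDiff_Vpart hn l hi.le).continuous_fderiv one_ne_zero).clm_apply hJ
  have h2 : Continuous fun x : Fin n → ℝ => fderiv ℝ (phi l i) x (J n *ᵥ x) :=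
    ((contDiff_phi hn l i hi).continuous_fderiv one_ne_zero).clm_apply hJ
  exact h1.sub (((continuous_coord _).sub (continuous_v hn l hi)).mul h2)

lemma isHom_drift (hn : 2 ≤ n) (l : ℕ → ℝ) {i : ℕ} (hi : i < n) :
    IsHom (2 - 2 / n) (drift (n := n) l i) := by
  have h1 := (isHom_Vpart (n := n) hn l hi.le).dirDeriv hn
    ((contDiff_Vpart hn l hi.le).differentiable one_ne_zero)
  have h2 := (isHom_phi (n := n) hn l hi.le).dirDeriv hn
    ((contDiff_phi hn l i hi).differentiable one_ne_zero)
  have h3 := ((isHom_coord (n := n) (i + 1)).sub (isHom_v hn l i hi.le)).mul h2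
  have e1 : (2 : ℝ) - 1 / n - 1 / n = 2 - 2 / n := by ring
  have e2 : pExp n (i + 1) + (pExp n (i + 1) * beta n i - 1 / n) = 2 - 2 / n := by
    have := pExp_mul_beta_add_one hn hi
    rw [← e1, ← this]; ring
  rw [e1] at h1
  rw [e2] at h3
  exact h1.sub h3

/-- `Vpart l i` and φᵢ see only the first i coordinates, whose velocities involve only the first i +
1. -/
lemma drift_trunc (hn : 2 ≤ n) (l : ℕ → ℝ) {i : ℕ} (hi : i < n) (x : Fin n → ℝ) :
    drift l i (trunc n (i + 1) x) = drift l i x := by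
  have key : ∀ f : (Fin n → ℝ) → ℝ, (∀ x, f (trunc n i x) = f x) → Differentiable ℝ f →
      fderiv ℝ f (trunc n (i + 1) x) (J n *ᵥ trunc n (i + 1) x) = fderiv ℝ f x (J n *ᵥ x) := by
    intro f hf hd
    rw [← fderiv_comp_trunc hf hd, trunc_trunc_succ, trunc_J_mulVec_trunc_succ,
      fderiv_comp_trunc hf hd]
  rw [drift, drift, key _ (Vpart_trunc l i) ((contDiff_Vpart hn l hi.le).differentiable one_ne_zero),
    key _ (phi_trunc l le_rfl) ((contDiff_phi hn l i hi).differentiable one_ne_zero),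
    v_trunc l (by omega), coord_trunc, if_pos le_rfl]

lemma omega_mul_v (hn : 2 ≤ n) (l : ℕ → ℝ) {i : ℕ} (hi : i < n) (x : Fin n → ℝ) :
    omega l (i + 1) x * v l x (i + 1) = -l (i + 1) *
      |omega l (i + 1) x| ^ (pExp n (i + 2) / (pExp n (i + 1) * beta n i) + 1) := by
  rw [v_succ, ← spow_mul_self (ladderExp_nonneg hn hi)]
  ring

/-- With its consequences below, this allows lᵢ₊₁ to be chosen last: neither `drift l i` nor ωᵢ₊₁
depends on it. -/
lemma v_congr_gains {l l' : ℕ → ℝ} (x : Fin n → ℝ) :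
    ∀ i, (∀ j, j ≤ i → l j = l' j) → v l x i = v l' x i := by
  intro i
  induction i with
  | zero => intro _; rfl
  | succ i ih =>
    intro h
    simp only [v, h (i + 1) le_rfl, ih fun j hj => h j (by omega)]

lemma phi_congr_gains {l l' : ℕ → ℝ} {i : ℕ} (h : ∀ j, j ≤ i → l j = l' j) :
    phi (n := n) l i = phi l' i := by
  funext x; rw [phi, phi, v_congr_gains x i h]

lemma omega_congr_gains {l l' : ℕ → ℝ} {i : ℕ} (h : ∀ j, j ≤ i → l j = l' j) :
    omega (n := n) l (i + 1) = omega l' (i + 1) := by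
  funext x; rw [omega_succ, omega_succ, phi_congr_gains h]

lemma Vpart_congr_gains {l l' : ℕ → ℝ} {i : ℕ} (h : ∀ j, j ≤ i → l j = l' j) :
    Vpart (n := n) l i = Vpart l' i := by
  funext x
  refine Finset.sum_congr rfl fun k hk => ?_
  rw [Wpart_succ, Wpart_succ, v_congr_gains x k fun j hj => h j (by
    have := Finset.mem_range.1 hk; omega)]

lemma drift_congr_gains {l l' : ℕ → ℝ} {i : ℕ} (h : ∀ j, j ≤ i → l j = l' j) :
    drift (n := n) l i = drift l' i := by
  funext x
  rw [drift, drift, Vpart_congr_gains h, phi_congr_gains h, v_congr_gains x i h]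

lemma isClosed_range_trunc (i : ℕ) : IsClosed {x : Fin n → ℝ | trunc n i x = x} :=
  isClosed_eq (trunc n i).continuous continuous_id

/-- On ωᵢ₊₁ = 0 one has xᵢ₊₁ = vᵢ. The φᵢ term of the drift drops out, and what remains is the
derivative of W₁ + ⋯ + Wᵢ under the virtual control vᵢ, negative by the previous step. -/
lemma drift_neg_of_omega_eq_zero (hn : 2 ≤ n) {l : ℕ → ℝ} {i : ℕ} (hi : i < n)
    (hprev : ∀ j, j + 1 = i → ∀ x : Fin n → ℝ, trunc n i x ≠ 0 →
      drift l j x + omega l i x * v l x i < 0)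
    {x : Fin n → ℝ} (hxt : trunc n (i + 1) x = x) (hx : x ≠ 0) (hω : omega l (i + 1) x = 0) :
    drift l i x < 0 := by
  have hcoord : coord x (i + 1) = v l x i := by
    rw [omega_succ, phi, sub_eq_zero] at hω
    exact spow_injective (beta_pos hn hi).ne' hω
  have hne : trunc n i x ≠ 0 := by
    intro h0
    refine hx (coord_ext fun k hk => ?_)
    rw [coord_zero]
    have hk' : ∀ k < i, coord x (k + 1) = 0 := fun k hk => by
      have := congrArg (fun y => coord y (k + 1)) h0
      simpa [coord_trunc, show k + 1 ≤ i by omega, coord_zero] using this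
    rcases lt_trichotomy k i with h | rfl | h
    · exact hk' k h
    · rw [hcoord, v_congr_coord l (y := 0) k fun j hj => by rw [hk' j hj, coord_zero],
        v_zero_state]
    · rw [← hxt, coord_trunc, if_neg (by omega)]
  rcases Nat.eq_zero_or_pos i with rfl | hi0
  · exfalso
    refine hne (coord_ext fun k hk => ?_)
    rw [coord_trunc, if_neg (by omega), coord_zero]
  · obtain ⟨j, rfl⟩ : ∃ j, i = j + 1 := ⟨i - 1, by omega⟩
    have h1 := hprev j rfl x hne
    rw [drift, hcoord, sub_self, zero_mul, sub_zero, fderiv_Vpart_J_mulVec hn l (by omega), hcoord]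
    exact h1

/-- With the virtual control xᵢ₊₁ = vᵢ, the derivative of W₁ + ⋯ + Wᵢ is negative. The new gain
multiplies a power of |ωᵢ₊₁|, so it has to dominate the drift only where ωᵢ₊₁ ≠ 0. -/
lemma exists_gains (hn : 2 ≤ n) : ∀ i, i ≤ n → ∃ l : ℕ → ℝ, (∀ j, 0 < l j) ∧
    ∀ j, j + 1 = i → ∀ x : Fin n → ℝ, trunc n i x ≠ 0 → drift l j x + omega l i x * v l x i < 0 := by
  intro i
  induction i with
  | zero => exact fun _ => ⟨fun _ => 1, fun _ => one_pos, fun j hj => by omega⟩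
  | succ i ih =>
    intro hi
    have hi' : i < n := hi
    obtain ⟨l, hl, hprev⟩ := ih hi'.le
    have hE : 0 < pExp n (i + 2) / (pExp n (i + 1) * beta n i) + 1 := by
      have := ladderExp_nonneg hn hi'; linarith
    have hgh := (isHom_omega hn l hi').abs_rpow (pExp n (i + 2) / (pExp n (i + 1) * beta n i) + 1)
    rw [pExp_mul_beta_mul_ladderExp hn hi'] at hgh
    -- Domination with h = 0, on the closed cone of states supported in the first i + 1 coordinates;
    -- `L` becomes the new gain.
    obtain ⟨L, hL, hlt⟩ := (isHom_drift hn l hi').exists_add_lt hn hgh (IsHom.zero _)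
      (continuous_drift hn l hi')
      ((continuous_omega hn l hi').abs.rpow_const fun _ => Or.inr hE.le) continuous_const
      (fun x => by positivity) (fun _ => le_rfl) (isClosed_range_trunc (i + 1))
      (fun r hr x (hx : _ = _) => show _ = _ by rw [trunc_dil, hx])
      (fun x hxt hx hg => drift_neg_of_omega_eq_zero hn hi' hprev hxt hx (by
        rwa [Real.rpow_eq_zero (abs_nonneg _) hE.ne', abs_eq_zero] at hg))
    have hagree : ∀ j, j ≤ i → l j = Function.update l (i + 1) L j := fun j hj => by
      rw [Function.update_of_ne (by omega)]
    refine ⟨Function.update l (i + 1) L, fun j => ?_, fun j hj x hx => ?_⟩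
    · by_cases h : j = i + 1
      · subst h; simpa using hL
      · rw [Function.update_of_ne h]; exact hl j
    · obtain rfl : j = i := by omega
      rw [omega_mul_v hn _ hi', ← drift_congr_gains hagree, ← omega_congr_gains hagree,
        Function.update_self]
      have h1 := hlt (trunc n (j + 1) x) (coord_ext fun k hk => by
        simp only [coord_trunc]; split_ifs <;> rfl) hx
      rw [drift_trunc hn l hi', omega_trunc] at h1
      linarith

/-- Among the quantities entering Vₙ, only Wₙ sees xₙ, and φₙ₋₁ does not. -/
lemma fderiv_Vn_e (hn : 2 ≤ n) (l : ℕ → ℝ) (x : Fin n → ℝ) :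
    fderiv ℝ (Vn l) x (e n) = omega l n x := by
  obtain ⟨m, rfl⟩ : ∃ m, n = m + 1 := ⟨n - 1, by omega⟩
  have hm : m < m + 1 := by omega
  have htr : trunc (m + 1) m (e (m + 1)) = 0 := coord_ext fun k hk => by
    rw [coord_trunc, coord_e hn, coord_zero]
    split_ifs <;> first | rfl | (exfalso; omega)
  rw [Vn_eq_Vpart, fderiv_Vpart_succ hn l hm,
    ← fderiv_comp_trunc (Vpart_trunc l m) ((contDiff_Vpart hn l hm.le).differentiable one_ne_zero),
    ← fderiv_comp_trunc (phi_trunc l le_rfl)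
      ((contDiff_phi hn l m hm).differentiable one_ne_zero), htr, coord_e hn, if_pos rfl]
  simp

lemma omega_mul_sign (n : ℕ) (l : ℕ → ℝ) (x : Fin n → ℝ) :
    omega l n x * Real.sign (omega l n x) = |omega l n x| := by
  rcases lt_trichotomy (omega l n x) 0 with h | h | h
  · rw [Real.sign_of_neg h, abs_of_neg h]; ring
  · simp [h]
  · rw [Real.sign_of_pos h, abs_of_pos h]; ring

lemma continuous_omega_last (hn : 2 ≤ n) (l : ℕ → ℝ) : Continuous (omega (n := n) l n) := by
  obtain ⟨m, hm⟩ : ∃ m, n = m + 1 := ⟨n - 1, by omega⟩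
  have := continuous_omega hn l (show m < n by omega)
  rwa [← hm] at this

lemma isHom_abs_omega_last (hn : 2 ≤ n) (l : ℕ → ℝ) :
    IsHom (2 - 2 / n) fun x : Fin n → ℝ => |omega l n x| := by
  obtain ⟨m, hm⟩ : ∃ m, n = m + 1 := ⟨n - 1, by omega⟩
  have hmn : m < n := by omega
  have h1 := (isHom_omega hn l hmn).abs_rpow 1
  have h2 : pExp n (m + 1) * beta n m * 1 = 2 - 2 / n := by
    have h0 := two_le_cast hn
    have h3 : (m : ℝ) = n - 1 := by rw [hm]; push_cast; ring
    rw [mul_one, pExp_mul_beta hn hmn, h3]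
    field_simp
    ring
  rw [h2, ← hm] at h1
  simpa using h1

theorem exists_admissibleGains (hn : 2 ≤ n) : ∃ l : ℕ → ℝ, AdmissibleGains n l := by
  obtain ⟨l, hl, hneg⟩ := exists_gains hn n le_rfl
  refine ⟨l, fun i _ _ => hl i, ?_⟩
  obtain ⟨m, hm⟩ : ∃ m, n = m + 1 := ⟨n - 1, by omega⟩
  have hmn : m < n := by omega
  have hlast : ∀ x : Fin n → ℝ, omega l n x * v l x n = -l n * |omega l n x| := by
    intro x
    have h1 := omega_mul_v hn l hmn x
    -- The last exponent is 0, so vₙ = -lₙ sign ωₙ: the final virtual control is the discontinuous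
    -- feedback of the admissibility condition.
    have h2 : pExp n (m + 2) = 0 := by
      have h0 := two_le_cast hn
      rw [pExp_succ hn, hm]; push_cast; simp
    rw [h2, zero_div, zero_add, Real.rpow_one, ← hm] at h1
    exact h1
  have homω := isHom_abs_omega_last hn l
  have hωc := (continuous_omega_last hn l).abs
  -- Domination with g = 0 and h = Vₙ^α upgrades strict negativity to decay with constant c = 1/L.
  obtain ⟨L, hL, hlt⟩ := ((isHom_drift hn l hmn).sub (homω.const_mul (l n))).exists_add_lt hn
    (IsHom.zero _) (isHom_Vn_rpow hn l)
    ((continuous_drift hn l hmn).sub (continuous_const.mul hωc)) continuous_const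
    (continuous_Vn_rpow hn l) (fun _ => le_rfl)
    (fun x => Real.rpow_nonneg (Vn_nonneg hn l x) _) isClosed_univ (fun _ _ _ _ => trivial)
    (fun x _ hx _ => by
      have h1 := hneg m hm.symm x (by rwa [trunc_self])
      rw [hlast] at h1
      linarith)
  refine ⟨1 / L, by positivity, fun x hx u => ?_⟩
  have h1 := hlt x trivial hx
  have h2 : fderiv ℝ (Vn l) x (J n *ᵥ x) = drift l m x := by
    have := fderiv_Vpart_J_mulVec hn l hmn x
    rw [coord_of_lt _ (by omega), mul_zero, add_zero, ← hm, ← Vn_eq_Vpart] at this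
    exact this
  rw [map_add, map_smul, fderiv_Vn_e hn, h2, mul_add, mul_left_comm, omega_mul_sign, smul_eq_mul]
  linarith

end Ladder

/-! ### Quadratic forms and the robust pair -/

section Quadratic

variable {n : ℕ}

lemma quadForm_smul (P : Matrix (Fin n) (Fin n) ℝ) (a : ℝ) (x : Fin n → ℝ) :
    (a • x) ⬝ᵥ P *ᵥ (a • x) = a ^ 2 * (x ⬝ᵥ P *ᵥ x) := by
  rw [Matrix.mulVec_smul, smul_dotProduct, dotProduct_smul, smul_eq_mul, smul_eq_mul]; ring

lemma quadForm_pos {P : Matrix (Fin n) (Fin n) ℝ} (hP : P.PosDef) {x : Fin n → ℝ} (hx : x ≠ 0) :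
    0 < x ⬝ᵥ P *ᵥ x := by
  simpa using hP.dotProduct_mulVec_pos hx

lemma quadForm_nonneg {P : Matrix (Fin n) (Fin n) ℝ} (hP : P.PosDef) (x : Fin n → ℝ) :
    0 ≤ x ⬝ᵥ P *ᵥ x := by
  simpa using hP.posSemidef.dotProduct_mulVec_nonneg x

lemma continuous_quadForm (P : Matrix (Fin n) (Fin n) ℝ) :
    Continuous fun x : Fin n → ℝ => x ⬝ᵥ P *ᵥ x := by fun_prop

lemma exists_quadForm_bounds (hn : 2 ≤ n) {P : Matrix (Fin n) (Fin n) ℝ} (hP : P.PosDef) :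
    ∃ m > 0, ∃ M > 0, ∀ x : Fin n → ℝ,
      m * ‖x‖ ^ 2 ≤ x ⬝ᵥ P *ᵥ x ∧ x ⬝ᵥ P *ᵥ x ≤ M * ‖x‖ ^ 2 := by
  have : Nonempty (Fin n) := ⟨⟨0, by omega⟩⟩
  have hS : IsCompact (Metric.sphere (0 : Fin n → ℝ) 1) := isCompact_sphere 0 1
  have hSne : (Metric.sphere (0 : Fin n → ℝ) 1).Nonempty :=
    NormedSpace.sphere_nonempty.2 zero_le_one
  obtain ⟨y, hy, hmin⟩ := hS.exists_isMinOn hSne (continuous_quadForm P).continuousOn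
  obtain ⟨z, hz, hmax⟩ := hS.exists_isMaxOn hSne (continuous_quadForm P).continuousOn
  have hne : ∀ w ∈ Metric.sphere (0 : Fin n → ℝ) 1, w ≠ 0 := by
    rintro w hw rfl; simp at hw
  refine ⟨_, quadForm_pos hP (hne y hy), _, quadForm_pos hP (hne z hz), fun x => ?_⟩
  by_cases hx : x = 0
  · simp [hx]
  have hnx : 0 < ‖x‖ := norm_pos_iff.2 hx
  have hmem : ‖x‖⁻¹ • x ∈ Metric.sphere (0 : Fin n → ℝ) 1 := by
    simp [norm_smul, hnx.ne']
  have h1 : y ⬝ᵥ P *ᵥ y ≤ (‖x‖⁻¹ • x) ⬝ᵥ P *ᵥ (‖x‖⁻¹ • x) := hmin hmem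
  have h2 : (‖x‖⁻¹ • x) ⬝ᵥ P *ᵥ (‖x‖⁻¹ • x) ≤ z ⬝ᵥ P *ᵥ z := hmax hmem
  rw [quadForm_smul, inv_pow] at h1 h2
  rw [inv_mul_eq_div] at h1 h2
  rw [le_div_iff₀ (by positivity)] at h1
  rw [div_le_iff₀ (by positivity)] at h2
  exact ⟨h1, h2⟩

lemma dotProduct_self_le (x : Fin n → ℝ) : x ⬝ᵥ x ≤ n * ‖x‖ ^ 2 := by
  rw [dotProduct]
  calc ∑ i, x i * x i ≤ ∑ _i : Fin n, ‖x‖ ^ 2 := Finset.sum_le_sum fun i _ => by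
        have := norm_le_pi_norm x i
        rw [← sq, ← sq_abs]
        exact pow_le_pow_left₀ (abs_nonneg _) this 2
    _ = n * ‖x‖ ^ 2 := by simp

lemma norm_sq_le_dotProduct_self (x : Fin n → ℝ) : ‖x‖ ^ 2 ≤ x ⬝ᵥ x := by
  have h : ‖x‖ ≤ √(x ⬝ᵥ x) := by
    rw [pi_norm_le_iff_of_nonneg (Real.sqrt_nonneg _)]
    intro i
    refine Real.le_sqrt_of_sq_le ?_
    rw [Real.norm_eq_abs, sq_abs, sq]
    exact Finset.single_le_sum (f := fun i => x i * x i) (fun i _ => mul_self_nonneg _)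
      (Finset.mem_univ i)
  have h0 : 0 ≤ x ⬝ᵥ x := Finset.sum_nonneg fun i _ => mul_self_nonneg _
  calc ‖x‖ ^ 2 ≤ √(x ⬝ᵥ x) ^ 2 := by gcongr
    _ = x ⬝ᵥ x := Real.sq_sqrt h0

/-- The signed Pascal entries. -/
noncomputable def pascalEntry (a b : ℕ) : ℝ := (-1) ^ (a + b) * ((a + b).choose a : ℝ)

/-- Pascal's rule with signs; this is the Lyapunov equation of `gramian` entry by entry. -/
lemma pascalEntry_rec (a b : ℕ) :
    (if a = 0 then 0 else pascalEntry (a - 1) b) + (if b = 0 then 0 else pascalEntry a (b - 1))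
      = (if a = 0 then 1 else 0) * (if b = 0 then 1 else 0) - pascalEntry a b := by
  rcases a with _ | a <;> rcases b with _ | b
  · simp [pascalEntry]
  · simp [pascalEntry, pow_succ]
  · simp [pascalEntry, pow_succ]
  · have h : ((a + 1 + (b + 1)).choose (a + 1) : ℝ)
        = ((a + (b + 1)).choose a : ℝ) + ((a + 1 + b).choose (a + 1) : ℝ) := by
      have := Nat.choose_succ_succ (a + b + 1) a
      rw [show a + 1 + (b + 1) = (a + b + 1) + 1 by ring, show a + (b + 1) = a + b + 1 by ring,
        show a + 1 + b = a + b + 1 by ring]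
      exact_mod_cast this
    simp only [Nat.add_eq_zero_iff, one_ne_zero, and_false, if_false, Nat.add_sub_cancel,
      pascalEntry, h]
    rw [show a + 1 + (b + 1) = a + b + 2 by ring, show a + (b + 1) = a + b + 1 by ring,
      show a + 1 + b = a + b + 1 by ring]
    ring

/-- The signed lower triangular Pascal matrix. -/
noncomputable def pascalLower (n : ℕ) : Matrix (Fin n) (Fin n) ℝ :=
  Matrix.of fun a k => (-1) ^ (a : ℕ) * ((a : ℕ).choose k : ℝ)

lemma isUnit_pascalLower (n : ℕ) : IsUnit (pascalLower n) := by
  rw [Matrix.isUnit_iff_isUnit_det, Matrix.det_of_isLowerTriangular]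
  · rw [isUnit_iff_ne_zero, Finset.prod_ne_zero_iff]
    intro a _
    simp [pascalLower]
  · intro i j hij
    have : (i : ℕ) < j := hij
    simp [pascalLower, Nat.choose_eq_zero_of_lt this]

/-- Vandermonde's identity: the symmetric Pascal matrix factors through its triangular version,
hence is positive definite. -/
lemma pascalLower_mul_transpose (n : ℕ) (a b : Fin n) :
    (pascalLower n * (pascalLower n)ᴴ) a b = pascalEntry a b := by
  have h : ((a : ℕ) + b).choose a = ∑ k : Fin n, (a : ℕ).choose k * (b : ℕ).choose k := by
    rw [Nat.add_choose_eq, Finset.Nat.sum_antidiagonal_eq_sum_range_succ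
      (fun i j => (a : ℕ).choose i * (b : ℕ).choose j),
      ← Finset.sum_range_reflect, Fin.sum_univ_eq_sum_range
      (fun k => (a : ℕ).choose k * (b : ℕ).choose k) n]
    have hsub : Finset.range ((a : ℕ) + 1) ⊆ Finset.range n :=
      Finset.range_subset_range.2 a.2
    rw [← Finset.sum_subset hsub fun k _ hk => by
      rw [Nat.choose_eq_zero_of_lt (by simpa using hk), zero_mul]]
    refine Finset.sum_congr rfl fun k hk => ?_
    have hk' : k ≤ a := by have := Finset.mem_range.1 hk; omega
    rw [show (a : ℕ) + 1 - 1 - k = a - k by omega, Nat.choose_symm hk',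
      show (a : ℕ) - (a - k) = k by omega]
  rw [Matrix.mul_apply, pascalEntry, h]
  push_cast
  rw [Finset.mul_sum]
  refine Finset.sum_congr rfl fun k _ => ?_
  simp only [pascalLower, Matrix.conjTranspose_apply, Matrix.of_apply, star_trivial, pow_add]
  ring

/-- A positive definite solution of `J S + S Jᵀ = e eᵀ - S`. -/
noncomputable def gramian (n : ℕ) : Matrix (Fin n) (Fin n) ℝ :=
  (pascalLower n * (pascalLower n)ᴴ).submatrix Fin.rev Fin.rev

lemma gramian_apply (i j : Fin n) : gramian n i j = pascalEntry i.rev j.rev := by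
  rw [gramian, Matrix.submatrix_apply, pascalLower_mul_transpose]

lemma posDef_gramian (n : ℕ) : (gramian n).PosDef :=
  (Matrix.PosDef.mul_conjTranspose_self _
    (Matrix.vecMul_injective_iff_isUnit.2 (isUnit_pascalLower n))).submatrix Fin.rev_injective

lemma J_mul_apply (M : Matrix (Fin n) (Fin n) ℝ) (i j : Fin n) :
    (J n * M) i j = if h : (i : ℕ) + 1 < n then M ⟨i + 1, h⟩ j else 0 := by
  rw [Matrix.mul_apply]
  simp only [J, Matrix.of_apply, ite_mul, one_mul, zero_mul]
  split_ifs with h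
  · rw [Finset.sum_eq_single ⟨i + 1, h⟩]
    · simp
    · intro b _ hb
      rw [if_neg fun h => hb (Fin.ext h.symm)]
    · simp
  · refine Finset.sum_eq_zero fun b _ => if_neg ?_
    have := b.2
    omega

/-- The matrix is the integral over t ≥ 0 of e⁻ᵗ z zᵀ with z = exp(-tJ) e, whose entries counted
from the bottom are (-t)^a / a!. The verification is algebraic: multiplying by J lowers the reversed
row index by one. -/
lemma gramian_equation (n : ℕ) :
    J n * gramian n + gramian n * (J n)ᵀ = Matrix.vecMulVec (e n) (e n) - gramian n := by
  have hsymm : (gramian n)ᵀ = gramian n := by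
    simpa using (posDef_gramian n).isHermitian.eq
  have h2 : gramian n * (J n)ᵀ = (J n * gramian n)ᵀ := by
    rw [Matrix.transpose_mul, hsymm]
  have hJ : ∀ i j : Fin n, (J n * gramian n) i j =
      if (i.rev : ℕ) = 0 then 0 else pascalEntry (i.rev - 1) j.rev := by
    intro i j
    rw [J_mul_apply]
    have hi := i.2
    have hr : (i.rev : ℕ) = n - (i + 1) := Fin.val_rev i
    split_ifs with h h' h'
    · omega
    · rw [gramian_apply]
      congr 1
    · rfl
    · omega
  have he : ∀ i : Fin n, e n i = if (i.rev : ℕ) = 0 then 1 else 0 := by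
    intro i
    have hi := i.2
    have hr : (i.rev : ℕ) = n - (i + 1) := Fin.val_rev i
    rw [e]
    split_ifs <;> first | rfl | (exfalso; omega)
  have hcomm : ∀ a b : ℕ, pascalEntry a b = pascalEntry b a := fun a b => by
    rw [pascalEntry, pascalEntry, add_comm b a, Nat.choose_symm_add]
  ext i j
  rw [h2, Matrix.add_apply, Matrix.transpose_apply, hJ, hJ, Matrix.sub_apply,
    Matrix.vecMulVec_apply, he, he, gramian_apply, ← pascalEntry_rec, hcomm (j.rev - 1)]

/-- With Q = S⁻¹ and w = Qe one has JᵀQ + QJ = wwᵀ - Q. The feedback along w subtracts at least wwᵀ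
as soon as ρ ≥ r₁, which leaves at most -Q; the upper end of the interval plays no role. -/
theorem exists_isRobustPair (hn : 2 ≤ n) {g r₁ r₂ : ℝ} (hg : 0 < g) (hr : 0 < r₁) :
    ∃ (K : Fin n → ℝ) (P : Matrix (Fin n) (Fin n) ℝ), IsRobustPair g r₁ r₂ K P := by
  set S := gramian n with hS
  have hSpd := posDef_gramian n
  set Q := S⁻¹ with hQ
  have hQpd : Q.PosDef := hSpd.inv
  have hQt : Qᵀ = Q := by simpa using hQpd.isHermitian.eq
  have hQS : Q * S = 1 := Matrix.nonsing_inv_mul _ ((Matrix.isUnit_iff_isUnit_det _).1 hSpd.isUnit)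
  have hSQ : S * Q = 1 := Matrix.mul_nonsing_inv _ ((Matrix.isUnit_iff_isUnit_det _).1 hSpd.isUnit)
  set w := Q *ᵥ e n with hw
  have hvw : w = e n ᵥ* Q := by rw [hw, ← Matrix.vecMul_transpose, hQt]
  have heq : (J n)ᵀ * Q + Q * J n = Matrix.vecMulVec w w - Q := by
    have h1 : Q * (J n * S + S * (J n)ᵀ) * Q = Q * (Matrix.vecMulVec (e n) (e n) - S) * Q := by
      rw [gramian_equation]
    rw [mul_add, add_mul, mul_sub, sub_mul] at h1
    rw [mul_assoc Q (J n * S), mul_assoc (J n) S, hSQ, mul_one, ← mul_assoc Q S, hQS, one_mul,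
      one_mul, Matrix.mul_vecMulVec, Matrix.vecMulVec_mul, ← hw, ← hvw] at h1
    rw [add_comm, h1]
  obtain ⟨m, hm, _, _, hbd⟩ := exists_quadForm_bounds hn hQpd
  -- Scaling that makes τQ ≥ Id: Q is bounded below by m times the squared sup norm, and x ⬝ᵥ x ≤ n
  -- ‖x‖².
  set τ := (n : ℝ) / m with hτ
  have hn0 : (0 : ℝ) < n := by have := two_le_cast hn; linarith
  have hτ0 : 0 < τ := by positivity
  refine ⟨(1 / (2 * r₁ * g)) • w, τ • Q, hQpd.smul hτ0, fun ρ hρ => ?_⟩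
  have hform : -1 - ((J n - (ρ * g) • Matrix.vecMulVec (e n) ((1 / (2 * r₁ * g)) • w))ᵀ * (τ • Q)
      + (τ • Q) * (J n - (ρ * g) • Matrix.vecMulVec (e n) ((1 / (2 * r₁ * g)) • w)))
      = (τ • Q - 1) + (τ * (ρ / r₁ - 1)) • Matrix.vecMulVec w w := by
    have e1 : Q * Matrix.vecMulVec (e n) w = Matrix.vecMulVec w w := by
      rw [Matrix.mul_vecMulVec]
    have e2 : Matrix.vecMulVec w (e n) * Q = Matrix.vecMulVec w w := by
      rw [Matrix.vecMulVec_mul, ← hvw]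
    have e3 : Q * J n = Matrix.vecMulVec w w - Q - (J n)ᵀ * Q := by rw [← heq]; abel
    simp only [Matrix.transpose_sub, Matrix.transpose_smul, Matrix.vecMulVec_smul,
      Matrix.transpose_vecMulVec, sub_mul, mul_sub, Matrix.smul_mul, Matrix.mul_smul, e1, e2, e3,
      smul_smul, smul_sub]
    have hc : ρ * g * (1 / (2 * r₁ * g)) = ρ / r₁ / 2 := by field_simp
    simp only [hc]
    module
  rw [hform]
  refine Matrix.PosSemidef.add ?_ (Matrix.PosSemidef.smul ?_ ?_)
  · refine Matrix.PosSemidef.of_dotProduct_mulVec_nonneg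
      ((hQpd.smul hτ0).isHermitian.sub Matrix.isHermitian_one) fun x => ?_
    rw [star_trivial, Matrix.sub_mulVec, dotProduct_sub, Matrix.one_mulVec, Matrix.smul_mulVec,
      dotProduct_smul, smul_eq_mul]
    have h1 := mul_le_mul_of_nonneg_left (hbd x).1 hτ0.le
    have h2 := dotProduct_self_le x
    have h3 : τ * (m * ‖x‖ ^ 2) = n * ‖x‖ ^ 2 := by rw [hτ]; field_simp
    linarith
  · simpa using Matrix.posSemidef_vecMulVec_self_star w
  · have : 1 ≤ ρ / r₁ := (one_le_div hr).2 hρ.1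
    exact mul_nonneg hτ0.le (by linarith)

/-! ### The norm V₀ and its derivative along curves -/

lemma V0_nonneg (P : Matrix (Fin n) (Fin n) ℝ) (x : Fin n → ℝ) : 0 ≤ V0 P x := Real.sqrt_nonneg _

lemma V0_sq {P : Matrix (Fin n) (Fin n) ℝ} (hP : P.PosDef) (x : Fin n → ℝ) :
    V0 P x ^ 2 = x ⬝ᵥ P *ᵥ x := Real.sq_sqrt (quadForm_nonneg hP x)

lemma V0_pos {P : Matrix (Fin n) (Fin n) ℝ} (hP : P.PosDef) {x : Fin n → ℝ} (hx : x ≠ 0) :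
    0 < V0 P x := Real.sqrt_pos.2 (quadForm_pos hP hx)

lemma V0_zero (P : Matrix (Fin n) (Fin n) ℝ) : V0 P 0 = 0 := by simp [V0]

lemma V0_neg (P : Matrix (Fin n) (Fin n) ℝ) (x : Fin n → ℝ) : V0 P (-x) = V0 P x := by
  simp [V0, Matrix.mulVec_neg]

lemma exists_V0_bounds (hn : 2 ≤ n) {P : Matrix (Fin n) (Fin n) ℝ} (hP : P.PosDef) :
    ∃ m > 0, ∃ M > 0, ∀ x : Fin n → ℝ, m * ‖x‖ ≤ V0 P x ∧ V0 P x ≤ M * ‖x‖ := by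
  obtain ⟨m, hm, M, hM, h⟩ := exists_quadForm_bounds hn hP
  refine ⟨√m, Real.sqrt_pos.2 hm, √M, Real.sqrt_pos.2 hM, fun x => ⟨?_, ?_⟩⟩
  · rw [V0, ← Real.sqrt_sq (norm_nonneg x), ← Real.sqrt_mul hm.le]
    exact Real.sqrt_le_sqrt (h x).1
  · rw [V0, ← Real.sqrt_sq (norm_nonneg x), ← Real.sqrt_mul hM.le]
    exact Real.sqrt_le_sqrt (h x).2

lemma dotProduct_mulVec_comm {P : Matrix (Fin n) (Fin n) ℝ} (hP : P.PosDef) (x y : Fin n → ℝ) :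
    x ⬝ᵥ P *ᵥ y = y ⬝ᵥ P *ᵥ x := by
  have hPt : Pᵀ = P := by simpa using hP.isHermitian.eq
  rw [Matrix.dotProduct_mulVec, ← Matrix.mulVec_transpose, hPt, dotProduct_comm]

lemma quadForm_add {P : Matrix (Fin n) (Fin n) ℝ} (hP : P.PosDef) (x y : Fin n → ℝ) :
    (x + y) ⬝ᵥ P *ᵥ (x + y) = x ⬝ᵥ P *ᵥ x + 2 * (x ⬝ᵥ P *ᵥ y) + y ⬝ᵥ P *ᵥ y := by
  rw [Matrix.mulVec_add, add_dotProduct, dotProduct_add, dotProduct_add,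
    dotProduct_mulVec_comm hP y x]
  ring

/-- The Cauchy–Schwarz inequality for `P`. -/
lemma dotProduct_mulVec_le {P : Matrix (Fin n) (Fin n) ℝ} (hP : P.PosDef) (x y : Fin n → ℝ) :
    x ⬝ᵥ P *ᵥ y ≤ V0 P x * V0 P y := by
  by_cases hy : y = 0
  · simp [hy, V0_zero]
  have hq := quadForm_pos hP hy
  set b := x ⬝ᵥ P *ᵥ y with hb
  have h1 := quadForm_nonneg hP (x + (-(b / (y ⬝ᵥ P *ᵥ y))) • y)
  rw [quadForm_add hP, quadForm_smul, Matrix.mulVec_smul, dotProduct_smul, ← hb, smul_eq_mul] at h1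
  have h2 : b ^ 2 ≤ (x ⬝ᵥ P *ᵥ x) * (y ⬝ᵥ P *ᵥ y) := by
    have h3 := mul_le_mul_of_nonneg_right h1 hq.le
    field_simp at h3
    nlinarith
  rw [V0, V0, ← Real.sqrt_mul (quadForm_nonneg hP x)]
  exact Real.le_sqrt_of_sq_le h2

lemma V0_add_le {P : Matrix (Fin n) (Fin n) ℝ} (hP : P.PosDef) (x y : Fin n → ℝ) :
    V0 P (x + y) ≤ V0 P x + V0 P y := by
  refine (Real.sqrt_le_left (add_nonneg (V0_nonneg P x) (V0_nonneg P y))).2 ?_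
  rw [quadForm_add hP, add_sq, V0_sq hP, V0_sq hP]
  have := dotProduct_mulVec_le hP x y
  linarith

lemma exists_lipschitzWith_V0 (hn : 2 ≤ n) {P : Matrix (Fin n) (Fin n) ℝ} (hP : P.PosDef) :
    ∃ M : ℝ≥0, LipschitzWith M (V0 P) := by
  obtain ⟨m, hm, M, hM, h⟩ := exists_V0_bounds hn hP
  refine ⟨⟨M, hM.le⟩, LipschitzWith.of_le_add_mul _ fun x y => ?_⟩
  have h1 := V0_add_le hP y (x - y)
  rw [add_sub_cancel] at h1
  have h2 := (h (x - y)).2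
  rw [← dist_eq_norm] at h2
  exact h1.trans (add_le_add le_rfl h2)

lemma hasDerivAt_V0 {P : Matrix (Fin n) (Fin n) ℝ} (hP : P.PosDef) {x : ℝ → Fin n → ℝ}
    {x' : Fin n → ℝ} {t : ℝ} (hx : HasDerivAt x x' t) (h0 : x t ≠ 0) :
    HasDerivAt (fun s => V0 P (x s)) ((x t ⬝ᵥ P *ᵥ x') / V0 P (x t)) t := by
  have hPx : HasDerivAt (fun s => P *ᵥ x s) (P *ᵥ x') t :=
    (LinearMap.toContinuousLinearMap P.mulVecLin).hasFDerivAt.comp_hasDerivAt t hx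
  have hq : HasDerivAt (fun s => x s ⬝ᵥ P *ᵥ x s) (2 * (x t ⬝ᵥ P *ᵥ x')) t := by
    have h1 : HasDerivAt (fun s => ∑ i, x s i * (P *ᵥ x s) i)
        (∑ i, (x' i * (P *ᵥ x t) i + x t i * (P *ᵥ x') i)) t :=
      HasDerivAt.fun_sum fun i _ => (hasDerivAt_pi.1 hx i).mul (hasDerivAt_pi.1 hPx i)
    refine h1.congr_deriv ?_
    rw [Finset.sum_add_distrib]
    change x' ⬝ᵥ P *ᵥ x t + x t ⬝ᵥ P *ᵥ x' = _
    rw [dotProduct_mulVec_comm hP x']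
    ring
  have h2 := hq.sqrt (quadForm_pos hP h0).ne'
  refine h2.congr_deriv ?_
  rw [← V0, mul_div_mul_left _ _ two_ne_zero]

end Quadratic

/-! ### `S`-functions -/

section SFunction

lemma sat_of_abs_le {x : ℝ} (hx : |x| ≤ 1) : sat x = x := by
  rw [sat, max_eq_left hx, div_one]

lemma sat_of_one_le {x : ℝ} (hx : 1 ≤ x) : sat x = 1 := by
  rw [sat, abs_of_pos (by linarith), max_eq_right hx, div_self (by linarith)]

lemma mul_sat_div_nonneg {b : ℝ} (hb : 0 < b) (x : ℝ) : 0 ≤ x * sat (x / b) := by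
  rw [sat, show x * (x / b / max 1 |x / b|) = x ^ 2 / (b * max 1 |x / b|) by field_simp]
  have : 0 < max 1 |x / b| := lt_max_of_lt_left one_pos
  positivity

lemma abs_sat_le_one (x : ℝ) : |sat x| ≤ 1 := by
  rw [sat, abs_div, abs_of_pos (lt_max_of_lt_left one_pos : 0 < max 1 |x|)]
  exact (div_le_one (lt_max_of_lt_left one_pos)).2 (le_max_right _ _)

lemma abs_sat_le (x : ℝ) : |sat x| ≤ |x| := by
  rw [sat, abs_div, abs_of_pos (lt_max_of_lt_left one_pos : 0 < max 1 |x|)]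
  exact div_le_self (abs_nonneg x) (le_max_left _ _)

variable {σ : ℝ → ℝ} {a₁ a₂ b₁ b₂ σinf : ℝ}

lemma IsSFunction.abs_le_mul_sat (h : IsSFunction σ a₁ a₂ b₁ b₂ σinf) {x : ℝ} (hx : x ≠ 0) :
    |σ x| ≤ a₂ * |sat (x / b₂)| := by
  have h1 : 0 ≤ x * σ x := by
    refine le_trans ?_ (h.lower x)
    rw [mul_assoc]
    exact mul_nonneg h.a₁_pos.le (mul_sat_div_nonneg h.b₁_pos x)
  have h2 : |x| * |σ x| ≤ |x| * (a₂ * |sat (x / b₂)|) := by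
    rw [← abs_mul, abs_of_nonneg h1]
    refine (h.upper x).trans ((le_abs_self _).trans_eq ?_)
    rw [abs_mul, abs_mul, abs_of_pos h.a₂_pos]
    ring
  exact le_of_mul_le_mul_left h2 (abs_pos.2 hx)

/-- The sector condition says nothing at 0, so the bound is proved elsewhere and extended by
continuity; in particular σ vanishes at 0. -/
lemma IsSFunction.abs_le_mul_abs (h : IsSFunction σ a₁ a₂ b₁ b₂ σinf) (x : ℝ) :
    |σ x| ≤ a₂ / b₂ * |x| := by
  have hcl : IsClosed {x | |σ x| ≤ a₂ / b₂ * |x|} :=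
    isClosed_le h.locallyLipschitz.continuous.abs (continuous_const.mul continuous_abs)
  have hsub : ({0}ᶜ : Set ℝ) ⊆ {x | |σ x| ≤ a₂ / b₂ * |x|} := by
    intro y hy
    refine (h.abs_le_mul_sat hy).trans ?_
    rw [div_mul_eq_mul_div, mul_div_assoc]
    refine mul_le_mul_of_nonneg_left ((abs_sat_le _).trans_eq ?_) h.a₂_pos.le
    rw [abs_div, abs_of_pos h.b₂_pos]
  have := hcl.closure_subset_iff.2 hsub
  rw [(dense_compl_singleton (0 : ℝ)).closure_eq] at this
  exact this (Set.mem_univ x)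

lemma IsSFunction.map_zero (h : IsSFunction σ a₁ a₂ b₁ b₂ σinf) : σ 0 = 0 := by
  simpa using h.abs_le_mul_abs 0

lemma IsSFunction.abs_apply_le (h : IsSFunction σ a₁ a₂ b₁ b₂ σinf) (x : ℝ) : |σ x| ≤ a₂ := by
  by_cases hx : x = 0
  · simp [hx, h.map_zero, h.a₂_pos.le]
  · exact (h.abs_le_mul_sat hx).trans (mul_le_of_le_one_right h.a₂_pos.le (abs_sat_le_one _))

lemma IsSFunction.limit_pos (h : IsSFunction σ a₁ a₂ b₁ b₂ σinf) : 0 < σinf := by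
  refine h.a₁_pos.trans_le (ge_of_tendsto h.tendsto_atTop ?_)
  filter_upwards [eventually_ge_atTop b₁] with x hx
  have hx0 : 0 < x := h.b₁_pos.trans_le hx
  have h1 := h.lower x
  rw [sat_of_one_le ((one_le_div h.b₁_pos).2 hx), mul_one, mul_comm] at h1
  exact le_of_mul_le_mul_left h1 hx0

/-- In this range neither `sat` saturates, so ρ = σ(y)/y lies between the two slopes. -/
lemma IsSFunction.exists_sector (h : IsSFunction σ a₁ a₂ b₁ b₂ σinf) {y : ℝ} (h₁ : |y| ≤ b₁)
    (h₂ : |y| ≤ b₂) : ∃ ρ ∈ Set.Icc (a₁ / b₁) (a₂ / b₂), σ y = ρ * y := by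
  by_cases hy : y = 0
  · exact ⟨a₁ / b₁, ⟨le_rfl, h.ratio_le⟩, by simp [hy, h.map_zero]⟩
  have hy2 : 0 < y ^ 2 := by positivity
  have hs : ∀ b, 0 < b → |y| ≤ b → sat (y / b) = y / b := fun b hb hyb =>
    sat_of_abs_le (by rw [abs_div, abs_of_pos hb]; exact (div_le_one hb).2 hyb)
  have hl := h.lower y
  have hu := h.upper y
  rw [hs b₁ h.b₁_pos h₁] at hl
  rw [hs b₂ h.b₂_pos h₂] at hu
  have hy' : σ y / y = y * σ y / y ^ 2 := by field_simp
  refine ⟨σ y / y, ⟨?_, ?_⟩, by field_simp⟩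
  · rw [hy', le_div_iff₀ hy2]
    calc a₁ / b₁ * y ^ 2 = a₁ * y * (y / b₁) := by ring
      _ ≤ _ := hl
  · rw [hy', div_le_iff₀ hy2]
    calc _ ≤ _ := hu
      _ = a₂ / b₂ * y ^ 2 := by ring

/-- Local Lipschitz continuity on [-2, 2] handles |d| ≤ 1; for larger d boundedness of σ suffices.
The result is linear in |d| for every d. -/
lemma IsSFunction.exists_sub_le (h : IsSFunction σ a₁ a₂ b₁ b₂ σinf) :
    ∃ L > 0, ∀ y d : ℝ, |y| ≤ 1 → |σ y - σ (y + d)| ≤ L * |d| := by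
  obtain ⟨K, hK⟩ := LocallyLipschitzOn.exists_lipschitzOnWith_of_compact
    (isCompact_Icc (a := (-2 : ℝ)) (b := 2)) h.locallyLipschitz.locallyLipschitzOn
  refine ⟨K + 2 * a₂, by have := h.a₂_pos; positivity, fun y d hy => ?_⟩
  have hd := abs_nonneg d
  have hy' := abs_le.1 hy
  have ha := h.a₂_pos
  have hKn : (0 : ℝ) ≤ K := K.2
  by_cases hd1 : |d| ≤ 1
  · have hd' := abs_le.1 hd1
    have h1 := hK.dist_le_mul y ⟨by linarith, by linarith⟩ (y + d) ⟨by linarith, by linarith⟩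
    rw [Real.dist_eq, Real.dist_eq, sub_add_cancel_left, abs_neg] at h1
    nlinarith
  · push Not at hd1
    have h1 := abs_sub (σ y) (σ (y + d))
    have h2 := h.abs_apply_le y
    have h3 := h.abs_apply_le (y + d)
    nlinarith

lemma IsSFunction.exists_near_limit (h : IsSFunction σ a₁ a₂ b₁ b₂ σinf) {δ : ℝ} (hδ : 0 < δ) :
    ∃ M > 0, ∀ y, M ≤ y → σinf - δ ≤ σ y ∧ σ (-y) ≤ -σinf + δ := by
  have h1 := h.tendsto_atTop.eventually (lt_mem_nhds (show σinf - δ < σinf by linarith))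
  have h2 := (h.tendsto_atBot.comp tendsto_neg_atTop_atBot).eventually
    (gt_mem_nhds (show -σinf < -σinf + δ by linarith))
  obtain ⟨M, hM⟩ := (h1.and h2).exists_forall_of_atTop
  exact ⟨max M 1, by positivity, fun y hy =>
    ⟨(hM y (le_of_max_le_left hy)).1.le, (hM y (le_of_max_le_left hy)).2.le⟩⟩

end SFunction

/-! ### Comparison of the storage functions -/

section Comparison

variable {n : ℕ}

lemma le_rpow_mul_rpow {α u B : ℝ} (hα : α < 1) (hu : 0 ≤ u) (hB : u ≤ B) :
    u ≤ B ^ (1 - α) * u ^ α := by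
  rcases hu.eq_or_lt with rfl | hu
  · exact mul_nonneg (Real.rpow_nonneg hB _) (Real.rpow_nonneg le_rfl _)
  · calc u = u ^ (1 - α) * u ^ α := by rw [← Real.rpow_add hu]; simp
      _ ≤ B ^ (1 - α) * u ^ α := by gcongr

lemma rpow_mul_rpow_le {α u m : ℝ} (hα : α < 1) (hm : 0 < m) (hu : m ≤ u) :
    m ^ (1 - α) * u ^ α ≤ u := by
  have hu0 : 0 < u := hm.trans_le hu
  calc m ^ (1 - α) * u ^ α ≤ u ^ (1 - α) * u ^ α := by gcongr
    _ = u := by rw [← Real.rpow_add hu0]; simp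

lemma isRate_min_rpow {α : ℝ} (hα : 0 < α) : IsRate fun u : ℝ => min u (u ^ α) where
  continuous := continuous_id.min (continuous_id.rpow_const fun _ => Or.inr hα.le)
  mono a b ha hab := min_le_min hab (Real.rpow_le_rpow ha hab hα.le)
  zero := by simp [Real.zero_rpow hα.ne']
  pos a ha := lt_min ha (Real.rpow_pos_of_pos ha α)

/-- All weights are at least 1/n, so a small homogeneous norm N forces every |xⱼ| ≤ N^(1/n) and
hence V₀ ≤ A. -/
lemma exists_homNorm_lower_bound (hn : 2 ≤ n) {P : Matrix (Fin n) (Fin n) ℝ} (hP : P.PosDef)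
    {A : ℝ} (hA : 0 < A) : ∃ ν > 0, ∀ x : Fin n → ℝ, A < V0 P x → ν ≤ homNorm x := by
  obtain ⟨m, hm, M, hM, hb⟩ := exists_V0_bounds hn hP
  have h0 := two_le_cast hn
  refine ⟨min 1 ((A / M) ^ (n : ℝ)), lt_min one_pos (by positivity), fun x hx => ?_⟩
  by_contra! hlt
  have hN1 : homNorm x ≤ 1 := (hlt.trans_le (min_le_left _ _)).le
  have hN0 : 0 < homNorm x := homNorm_pos hn (by rintro rfl; rw [V0_zero] at hx; linarith)
  have hN2 : homNorm x ^ (1 / (n : ℝ)) ≤ A / M := by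
    have := Real.rpow_le_rpow hN0.le (hlt.trans_le (min_le_right _ _)).le
      (show (0 : ℝ) ≤ 1 / n by positivity)
    rwa [← Real.rpow_mul (by positivity), mul_one_div_cancel (by positivity), Real.rpow_one] at this
  have hx2 : ‖x‖ ≤ A / M := by
    rw [pi_norm_le_iff_of_nonneg (by positivity)]
    intro j
    refine (abs_le_homNorm_rpow hn x j).trans (le_trans ?_ hN2)
    refine Real.rpow_le_rpow_of_exponent_ge hN0 hN1 ?_
    have hj : ((j : ℕ) : ℝ) + 1 ≤ n := by exact_mod_cast j.2
    rw [pExp_succ hn]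
    gcongr
    linarith
  have h3 := (hb x).2
  have h4 : M * ‖x‖ ≤ M * (A / M) := by gcongr
  rw [mul_div_cancel₀ _ hM.ne'] at h4
  linarith

/-- Every continuous homogeneous function of degree `2 - 2 / n` is dominated by `Vₙ ^ α`. -/
lemma exists_le_mul_Vn_rpow (hn : 2 ≤ n) (l : ℕ → ℝ) {f : (Fin n → ℝ) → ℝ}
    (hf : IsHom (2 - 2 / n) f) (hfc : Continuous f) :
    ∃ L > 0, ∀ x, x ≠ 0 → f x ≤ L * Vn l x ^ alpha n := by
  obtain ⟨L, hL, h⟩ := hf.exists_add_lt hn (isHom_Vn_rpow hn l) (IsHom.zero _) hfc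
    (continuous_Vn_rpow hn l) continuous_const
    (fun x => Real.rpow_nonneg (Vn_nonneg hn l x) _) (fun _ => le_rfl) isClosed_univ
    (fun _ _ _ _ => trivial)
    (fun x _ hx hg => absurd hg (Real.rpow_pos_of_pos (Vn_pos hn l hx) _).ne')
  refine ⟨L, hL, fun x hx => ?_⟩
  have := h x trivial hx
  linarith

/-- Vₙ^α dominates N^(2-2/n), where N is the homogeneous norm. Since |xⱼ| ≤ N^pⱼ with pⱼ ≤ 1 ≤ 2 -
2/n and N is bounded below, both bounds follow. -/
lemma exists_norm_le_mul_Vn_rpow (hn : 2 ≤ n) (l : ℕ → ℝ) {P : Matrix (Fin n) (Fin n) ℝ}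
    (hP : P.PosDef) {A : ℝ} (hA : 0 < A) :
    ∃ C > 0, ∃ m > 0, ∀ x : Fin n → ℝ, A < V0 P x →
      ‖x‖ ≤ C * Vn l x ^ alpha n ∧ m ≤ Vn l x := by
  obtain ⟨ν, hν, hνle⟩ := exists_homNorm_lower_bound hn hP hA
  have h0 := two_le_cast hn
  set s : ℝ := 2 - 2 / n with hs
  have hs1 : 1 ≤ s := by
    have : 2 / (n : ℝ) ≤ 1 := (div_le_one (by linarith)).2 h0
    linarith
  have hhom : IsHom s fun x : Fin n → ℝ => homNorm x ^ s := fun r hr x => by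
    simp only [homNorm_dil hn hr, Real.mul_rpow hr.le (homNorm_nonneg x)]
  obtain ⟨L, hL, hle⟩ := exists_le_mul_Vn_rpow hn l hhom
    ((continuous_homNorm hn).rpow_const fun _ => Or.inr (by linarith))
  have hα := alpha_pos hn
  refine ⟨max 1 (1 / ν ^ s) * L, by positivity, (ν ^ s / L) ^ (1 / alpha n), by positivity,
    fun x hx => ?_⟩
  have hx0 : x ≠ 0 := by rintro rfl; rw [V0_zero] at hx; linarith
  have hN := hνle x hx
  have hN0 : 0 < homNorm x := hν.trans_le hN
  have hνs : ν ^ s ≤ homNorm x ^ s := Real.rpow_le_rpow hν.le hN (by linarith)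
  have hνs0 : 0 < ν ^ s := by positivity
  constructor
  · rw [mul_assoc]
    refine le_trans ?_ (mul_le_mul_of_nonneg_left (hle x hx0) (by positivity))
    rw [pi_norm_le_iff_of_nonneg (by positivity)]
    intro j
    refine (abs_le_homNorm_rpow hn x j).trans ?_
    rcases le_total 1 (homNorm x) with h1 | h1
    · calc homNorm x ^ pExp n (j + 1) ≤ homNorm x ^ s :=
            Real.rpow_le_rpow_of_exponent_le h1 ((pExp_succ_le_one hn j).trans hs1)
        _ ≤ max 1 (1 / ν ^ s) * homNorm x ^ s :=
            le_mul_of_one_le_left (by positivity) (le_max_left _ _)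
    · calc homNorm x ^ pExp n (j + 1) ≤ 1 :=
            Real.rpow_le_one hN0.le h1 (pExp_succ_pos hn j.2).le
        _ ≤ 1 / ν ^ s * homNorm x ^ s := by
            rw [one_div, ← div_eq_inv_mul]; exact (one_le_div hνs0).2 hνs
        _ ≤ max 1 (1 / ν ^ s) * homNorm x ^ s := by
            gcongr
            exact le_max_right _ _
  · have h1 : ν ^ s / L ≤ Vn l x ^ alpha n := by
      rw [div_le_iff₀ hL, mul_comm]
      exact hνs.trans (hle x hx0)
    have h2 := Real.rpow_le_rpow (by positivity) h1 (one_div_pos.2 hα).le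
    rwa [← Real.rpow_mul (Vn_nonneg hn l x), mul_one_div_cancel hα.ne', Real.rpow_one] at h2

lemma exists_fderiv_Vn_bound (hn : 2 ≤ n) (l : ℕ → ℝ) (R : ℝ) :
    ∃ M > 0, ∀ x : Fin n → ℝ, ‖x‖ ≤ R → ‖fderiv ℝ (Vn l) x‖ ≤ M ∧ Vn l x ≤ M * ‖x‖ := by
  have hc : Continuous fun x : Fin n → ℝ => fderiv ℝ (Vn l) x :=
    (contDiff_Vn hn l).continuous_fderiv one_ne_zero
  obtain ⟨M, hM⟩ := (isCompact_closedBall (0 : Fin n → ℝ) R).exists_bound_of_continuousOn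
    hc.continuousOn
  have hM' : ∀ x : Fin n → ℝ, ‖x‖ ≤ R → ‖fderiv ℝ (Vn l) x‖ ≤ max M 1 := fun x hx =>
    (hM x (mem_closedBall_zero_iff.2 hx)).trans (le_max_left _ _)
  refine ⟨max M 1, by positivity, fun x hx => ⟨hM' x hx, ?_⟩⟩
  have h1 := (convex_closedBall (0 : Fin n → ℝ) R).norm_image_sub_le_of_norm_fderiv_le (𝕜 := ℝ)
    (f := Vn l) (C := max M 1) (x := 0) (y := x)
    (fun y _ => (contDiff_Vn hn l).differentiable one_ne_zero y)
    (fun y hy => hM' y (mem_closedBall_zero_iff.1 hy))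
    (mem_closedBall_zero_iff.2 (by simpa using (norm_nonneg x).trans hx))
    (mem_closedBall_zero_iff.2 hx)
  rw [Vn_zero, sub_zero, sub_zero] at h1
  exact (le_abs_self _).trans h1

end Comparison

section ClosedLoop

variable {n : ℕ} {σ : ℝ → ℝ} {a₁ a₂ b₁ b₂ σinf : ℝ}

/-! ### The saturated regime `V₀ > A` -/

/-- Saturation almost cancels the gain, up to errors of order `1 / k` and `|d|`. -/
lemma IsSFunction.mul_sub_le (h : IsSFunction σ a₁ a₂ b₁ b₂ σinf) {δ M k w d : ℝ} (hk : 0 < k)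
    (hδ : 0 ≤ δ) (hM : 0 < M) (hMδ : ∀ y, M ≤ y → σinf - δ ≤ σ y ∧ σ (-y) ≤ -σinf + δ) :
    σinf * |w| - w * σ (k * w + d) ≤
      δ * |w| + 2 * M * (σinf + a₂) / k + 2 * (σinf + a₂) / k * |d| := by
  have hinf := h.limit_pos
  have ha := h.a₂_pos
  have hd := abs_nonneg d
  have hw := abs_nonneg w
  have hcrude : σinf * |w| - w * σ (k * w + d) ≤ (σinf + a₂) * |w| := by
    have h1 : -(w * σ (k * w + d)) ≤ |w| * a₂ := by
      refine (neg_le_abs _).trans ?_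
      rw [abs_mul]
      exact mul_le_mul_of_nonneg_left (h.abs_apply_le _) hw
    linarith
  have hT1 : 0 ≤ δ * |w| := by positivity
  have hT2 : 0 ≤ 2 * M * (σinf + a₂) / k := by positivity
  have hT3 : 0 ≤ 2 * (σinf + a₂) / k * |d| := by positivity
  -- Two crude cases: |w| is of order 1/k, or of order |d|/k. Otherwise |d| ≤ k|w|/2, so kw + d has
  -- the sign of w and modulus at least M.
  by_cases h1 : k * |w| < 2 * M
  · have h2 : (σinf + a₂) * |w| ≤ 2 * M * (σinf + a₂) / k := by
      rw [le_div_iff₀ hk]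
      nlinarith
    linarith
  by_cases h2 : k * |w| < 2 * |d|
  · have h3 : (σinf + a₂) * |w| ≤ 2 * (σinf + a₂) / k * |d| := by
      rw [div_mul_eq_mul_div, le_div_iff₀ hk]
      nlinarith
    linarith
  push Not at h1 h2
  have hdle := abs_le.1 (le_refl |d|)
  rcases le_total 0 w with hw0 | hw0
  · rw [abs_of_nonneg hw0] at *
    have h3 := (hMδ (k * w + d) (by linarith)).1
    nlinarith
  · rw [abs_of_nonpos hw0] at *
    have h3 := (hMδ (-(k * w + d)) (by linarith)).2
    rw [neg_neg] at h3
    nlinarith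

lemma exists_outer_decay (hn : 2 ≤ n) {l : ℕ → ℝ} (hl : AdmissibleGains n l)
    (h : IsSFunction σ a₁ a₂ b₁ b₂ σinf) {P : Matrix (Fin n) (Fin n) ℝ} (hP : P.PosDef) {A : ℝ}
    (hA : 0 < A) : ∃ k₀ > 0, ∃ c > 0, ∃ C > 0, ∀ k, k₀ ≤ k → ∀ (x : Fin n → ℝ) (d : ℝ), A < V0 P x →
      fderiv ℝ (Vn l) x (J n *ᵥ x + (-(l n / σinf) * σ (k * omega l n x + d)) • e n) ≤
        -c * Vn l x ^ alpha n + C * |d| := by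
  obtain ⟨hlpos, c, hc, hdec⟩ := hl
  have hln : 0 < l n := hlpos n (by omega) le_rfl
  have hinf := h.limit_pos
  have ha := h.a₂_pos
  have hα := alpha_pos hn
  set g := l n / σinf with hg
  have hg0 : 0 < g := by positivity
  obtain ⟨L, hL, hωle⟩ := exists_le_mul_Vn_rpow hn l (isHom_abs_omega_last hn l)
    (continuous_omega_last hn l).abs
  obtain ⟨_, _, m, hm, hbd⟩ := exists_norm_le_mul_Vn_rpow hn l hP hA
  -- This δ makes g δ |ωₙ| at most a quarter of the decay c Vₙ^α; the k₀ below makes the 1/k error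
  -- at most another quarter.
  obtain ⟨M, hM, hMδ⟩ := h.exists_near_limit (show 0 < c / (4 * g * L) by positivity)
  refine ⟨8 * g * M * (σinf + a₂) / (c * m ^ alpha n), by positivity, c / 2, by positivity,
    g * (2 * (σinf + a₂) / (8 * g * M * (σinf + a₂) / (c * m ^ alpha n))), by positivity,
    fun k hk x d hx => ?_⟩
  set k₀ := 8 * g * M * (σinf + a₂) / (c * m ^ alpha n) with hk₀
  have hk₀0 : 0 < k₀ := by positivity
  have hk0 : 0 < k := hk₀0.trans_le hk
  have hx0 : x ≠ 0 := by rintro rfl; rw [V0_zero] at hx; linarith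
  have hVm : m ^ alpha n ≤ Vn l x ^ alpha n := Real.rpow_le_rpow hm.le (hbd x hx).2 hα.le
  have h1 := hdec x hx0 (-g * σ (k * omega l n x + d))
  have h2 : omega l n x * (-g * σ (k * omega l n x + d) + l n * Real.sign (omega l n x))
      = g * (σinf * |omega l n x| - omega l n x * σ (k * omega l n x + d)) := by
    rw [← omega_mul_sign, hg]; field_simp; ring
  have h3 := mul_le_mul_of_nonneg_left (h.mul_sub_le (w := omega l n x) (d := d) hk0
    (show 0 ≤ c / (4 * g * L) by positivity) hM hMδ) hg0.le
  have h4 : g * (c / (4 * g * L) * |omega l n x|) ≤ c / 4 * Vn l x ^ alpha n := by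
    calc g * (c / (4 * g * L) * |omega l n x|)
        ≤ g * (c / (4 * g * L) * (L * Vn l x ^ alpha n)) := by
          gcongr
          exact hωle x hx0
      _ = c / 4 * Vn l x ^ alpha n := by field_simp
  have h5 : g * (2 * M * (σinf + a₂) / k) ≤ c / 4 * Vn l x ^ alpha n := by
    calc g * (2 * M * (σinf + a₂) / k) ≤ g * (2 * M * (σinf + a₂) / k₀) := by gcongr
      _ = c / 4 * m ^ alpha n := by rw [hk₀]; field_simp; ring
      _ ≤ c / 4 * Vn l x ^ alpha n := by gcongr
  have h6 : g * (2 * (σinf + a₂) / k * |d|) ≤ g * (2 * (σinf + a₂) / k₀) * |d| := by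
    rw [← mul_assoc]
    gcongr
  rw [h2] at h1
  linarith

/-! ### The linear regime `V₀ ≤ A` -/

lemma IsRobustPair.dotProduct_le {g r₁ r₂ ρ : ℝ} {K : Fin n → ℝ} {P : Matrix (Fin n) (Fin n) ℝ}
    (h : IsRobustPair g r₁ r₂ K P) (hρ : ρ ∈ Set.Icc r₁ r₂) (x : Fin n → ℝ) :
    2 * (x ⬝ᵥ P *ᵥ (J n *ᵥ x - (ρ * g * (K ⬝ᵥ x)) • e n)) ≤ -(x ⬝ᵥ x) := by
  have h1 := (h.2 ρ hρ).dotProduct_mulVec_nonneg x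
  set M := J n - (ρ * g) • Matrix.vecMulVec (e n) K with hM
  have hMx : M *ᵥ x = J n *ᵥ x - (ρ * g * (K ⬝ᵥ x)) • e n := by
    rw [hM, Matrix.sub_mulVec, Matrix.smul_mulVec, Matrix.vecMulVec_mulVec]
    congr 1
    ext i
    simp only [Pi.smul_apply, smul_eq_mul, MulOpposite.smul_eq_mul_unop, MulOpposite.unop_op]
    ring
  have h2 : x ⬝ᵥ (Mᵀ * P) *ᵥ x = x ⬝ᵥ (P * M) *ᵥ x := by
    rw [← Matrix.mulVec_mulVec, ← Matrix.mulVec_mulVec, Matrix.dotProduct_mulVec x Mᵀ,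
      Matrix.vecMul_transpose, dotProduct_mulVec_comm h.1]
  rw [star_trivial, Matrix.sub_mulVec, Matrix.add_mulVec, dotProduct_sub, dotProduct_add, h2,
    Matrix.neg_mulVec, Matrix.one_mulVec, dotProduct_neg, ← Matrix.mulVec_mulVec, hMx] at h1
  linarith

/-- For d = 0 the saturated system coincides at x with the linear one for some ρ in the sector,
where (1) applies; the rest is the Lipschitz effect of d, estimated by Cauchy–Schwarz for P. -/
lemma exists_inner_decay (hn : 2 ≤ n) (h : IsSFunction σ a₁ a₂ b₁ b₂ σinf) {g : ℝ} (hg : 0 < g)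
    {K : Fin n → ℝ} {P : Matrix (Fin n) (Fin n) ℝ}
    (hKP : IsRobustPair g (a₁ / b₁) (a₂ / b₂) K P) :
    ∃ c > 0, ∃ C > 0, ∀ (x : Fin n → ℝ) (d : ℝ), x ≠ 0 → |K ⬝ᵥ x| ≤ min 1 (min b₁ b₂) →
      (x ⬝ᵥ P *ᵥ (J n *ᵥ x + (-g * σ (K ⬝ᵥ x + d)) • e n)) / V0 P x ≤ -c * V0 P x + C * |d| := by
  obtain ⟨L, hL, hLip⟩ := h.exists_sub_le
  obtain ⟨m, hm, M, hM, hbd⟩ := exists_V0_bounds hn hKP.1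
  refine ⟨1 / (2 * M ^ 2), by positivity, g * L * (V0 P (e n) + 1),
    by have := V0_nonneg P (e n); positivity, fun x d hx hK => ?_⟩
  have hV := V0_pos hKP.1 hx
  rw [div_le_iff₀ hV]
  obtain ⟨ρ, hρ, hσ⟩ := h.exists_sector (y := K ⬝ᵥ x)
    (hK.trans ((min_le_right _ _).trans (min_le_left _ _)))
    (hK.trans ((min_le_right _ _).trans (min_le_right _ _)))
  have hdecomp : J n *ᵥ x + (-g * σ (K ⬝ᵥ x + d)) • e n
      = (J n *ᵥ x - (ρ * g * (K ⬝ᵥ x)) • e n)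
        + (g * (σ (K ⬝ᵥ x) - σ (K ⬝ᵥ x + d))) • e n := by
    rw [hσ]; module
  rw [hdecomp, Matrix.mulVec_add, dotProduct_add, Matrix.mulVec_smul P _ (e n), dotProduct_smul,
    smul_eq_mul]
  have h1 := hKP.dotProduct_le hρ x
  have h2 : V0 P x ^ 2 ≤ M ^ 2 * (x ⬝ᵥ x) := by
    calc V0 P x ^ 2 ≤ (M * ‖x‖) ^ 2 := by
          have := (hbd x).2
          gcongr
      _ = M ^ 2 * ‖x‖ ^ 2 := by ring
      _ ≤ M ^ 2 * (x ⬝ᵥ x) := by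
          have := norm_sq_le_dotProduct_self x
          gcongr
  have h3 : g * (σ (K ⬝ᵥ x) - σ (K ⬝ᵥ x + d)) * (x ⬝ᵥ P *ᵥ e n)
      ≤ g * (L * |d|) * (V0 P x * (V0 P (e n) + 1)) := by
    have h4 : |x ⬝ᵥ P *ᵥ e n| ≤ V0 P x * (V0 P (e n) + 1) := by
      have h5 := dotProduct_mulVec_le hKP.1 x (e n)
      have h6 := dotProduct_mulVec_le hKP.1 (-x) (e n)
      rw [neg_dotProduct, V0_neg] at h6
      rw [abs_le]
      constructor <;> nlinarith
    refine (le_abs_self _).trans ?_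
    rw [abs_mul, abs_mul, abs_of_pos hg]
    have h7 := hLip (K ⬝ᵥ x) d (hK.trans (min_le_left _ _))
    gcongr
  have h8 : 1 / (2 * M ^ 2) * V0 P x ^ 2 ≤ (x ⬝ᵥ x) / 2 := by
    rw [div_mul_eq_mul_div, div_le_iff₀ (by positivity)]
    linarith
  have h9 : (-(1 / (2 * M ^ 2)) * V0 P x + g * L * (V0 P (e n) + 1) * |d|) * V0 P x
      = -(1 / (2 * M ^ 2) * V0 P x ^ 2) + g * (L * |d|) * (V0 P x * (V0 P (e n) + 1)) := by ring
  rw [h9]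
  linarith

/-- There is no constant term, because |σ(y)| ≤ (a₂/b₂)|y|; this lets the growth of Vₙ be
compensated by the decay of V₀ down to the origin. -/
lemma exists_field_bound (h : IsSFunction σ a₁ a₂ b₁ b₂ σinf) {g : ℝ} (hg : 0 < g)
    (K : Fin n → ℝ) : ∃ C > 0, ∀ (x : Fin n → ℝ) (d : ℝ),
      ‖J n *ᵥ x + (-g * σ (K ⬝ᵥ x + d)) • e n‖ ≤ C * (‖x‖ + |d|) := by
  set Φ := LinearMap.toContinuousLinearMap (J n).mulVecLin with hΦ
  have hab : 0 < a₂ / b₂ := div_pos h.a₂_pos h.b₂_pos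
  set κ := ∑ i, |K i| with hκ
  have hκ0 : 0 ≤ κ := Finset.sum_nonneg fun _ _ => abs_nonneg _
  have hKx : ∀ x : Fin n → ℝ, |K ⬝ᵥ x| ≤ κ * ‖x‖ := fun x => by
    rw [dotProduct, hκ, Finset.sum_mul]
    refine (Finset.abs_sum_le_sum_abs _ _).trans (Finset.sum_le_sum fun i _ => ?_)
    rw [abs_mul]
    exact mul_le_mul_of_nonneg_left (norm_le_pi_norm x i) (abs_nonneg _)
  refine ⟨‖Φ‖ + g * (a₂ / b₂) * (κ + 1) * ‖e n‖ + 1, by positivity, fun x d => ?_⟩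
  have h1 : ‖J n *ᵥ x‖ ≤ ‖Φ‖ * ‖x‖ := Φ.le_opNorm x
  have h2 : ‖(-g * σ (K ⬝ᵥ x + d)) • e n‖ ≤ g * (a₂ / b₂) * (κ + 1) * ‖e n‖ * (‖x‖ + |d|) := by
    rw [norm_smul, Real.norm_eq_abs, abs_mul, abs_neg, abs_of_pos hg]
    have h3 : |σ (K ⬝ᵥ x + d)| ≤ a₂ / b₂ * ((κ + 1) * (‖x‖ + |d|)) := by
      refine (h.abs_le_mul_abs _).trans ?_
      gcongr
      refine (abs_add_le _ _).trans ?_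
      have := hKx x
      have := norm_nonneg x
      have := abs_nonneg d
      nlinarith
    calc g * |σ (K ⬝ᵥ x + d)| * ‖e n‖ ≤ g * (a₂ / b₂ * ((κ + 1) * (‖x‖ + |d|))) * ‖e n‖ := by
          gcongr
      _ = _ := by ring
  refine (norm_add_le _ _).trans ?_
  have := norm_nonneg x
  have := abs_nonneg d
  have : 0 ≤ ‖Φ‖ * |d| := by positivity
  nlinarith

end ClosedLoop

/-! ### The composite storage function and its dissipation -/

section Storage

variable {n : ℕ}

/-- The storage function `Vₙ + λ min(V₀, A)`. -/
noncomputable def storage (l : ℕ → ℝ) (P : Matrix (Fin n) (Fin n) ℝ) (A lam : ℝ)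
    (x : Fin n → ℝ) : ℝ := Vn l x + lam * min (V0 P x) A

lemma storage_zero {l : ℕ → ℝ} {P : Matrix (Fin n) (Fin n) ℝ} {A lam : ℝ} (hA : 0 < A) :
    storage l P A lam 0 = 0 := by
  rw [storage, Vn_zero, V0_zero, min_eq_left hA.le]; ring

lemma storage_nonneg (hn : 2 ≤ n) (l : ℕ → ℝ) (P : Matrix (Fin n) (Fin n) ℝ) {A lam : ℝ}
    (hA : 0 < A) (hlam : 0 < lam) (x : Fin n → ℝ) : 0 ≤ storage l P A lam x :=
  add_nonneg (Vn_nonneg hn l x) (mul_nonneg hlam.le (le_min (V0_nonneg P x) hA.le))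

/-- The state and `W` are controlled by the rate `min(U, U ^ α)` of the storage function `U`. -/
lemma exists_le_rate_storage (hn : 2 ≤ n) (l : ℕ → ℝ) {P : Matrix (Fin n) (Fin n) ℝ}
    (hP : P.PosDef) {A lam : ℝ} (hA : 0 < A) (hlam : 0 < lam) :
    ∃ C > 0, ∀ x : Fin n → ℝ,
      ‖x‖ ≤ C * min (storage l P A lam x) (storage l P A lam x ^ alpha n) ∧
      W l P x ≤ C * min (storage l P A lam x) (storage l P A lam x ^ alpha n) := by
  obtain ⟨m, hm, M, hM, hbd⟩ := exists_V0_bounds hn hP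
  obtain ⟨C₁, hC₁, m', hm', hout⟩ := exists_norm_le_mul_Vn_rpow hn l hP hA
  obtain ⟨M', hM', hin⟩ := exists_fderiv_Vn_bound hn l (A / m)
  have hα := alpha_pos hn
  have hα1 := alpha_lt_one hn
  set B := M' * (A / m) + lam * A with hB
  have hB0 : 0 < B := by positivity
  -- The first maximum serves V₀ ≤ A, where λV₀ ≤ U ≤ B and U ≤ B^(1-α) U^α; the second serves V₀ >
  -- A, where m' ≤ Vₙ ≤ U.
  set D := max (1 / lam) (B ^ (1 - alpha n) / lam) + max 1 (1 / m' ^ (1 - alpha n)) with hD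
  have hD0 : 0 < D := by positivity
  refine ⟨D * (1 + 1 / m + C₁), by positivity, fun x => ?_⟩
  set U := storage l P A lam x with hU
  have hU0 : 0 ≤ U := storage_nonneg hn l P hA hlam x
  have hV0 := Vn_nonneg hn l x
  have hmin0 : 0 ≤ min U (U ^ alpha n) := le_min hU0 (Real.rpow_nonneg hU0 _)
  -- `G` is V₀ in the inner region and Vₙ^α in the outer one; either bounds W from above.
  suffices hkey : ∃ G, 0 ≤ G ∧ G ≤ D * min U (U ^ alpha n) ∧ W l P x ≤ G ∧
      ‖x‖ ≤ (1 / m + C₁) * G by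
    obtain ⟨G, hG0, hG, hW, hx⟩ := hkey
    constructor
    · calc ‖x‖ ≤ (1 / m + C₁) * (D * min U (U ^ alpha n)) :=
            hx.trans (mul_le_mul_of_nonneg_left hG (by positivity))
        _ ≤ D * (1 + 1 / m + C₁) * min U (U ^ alpha n) := by
            have : 0 ≤ D * min U (U ^ alpha n) := by positivity
            nlinarith
    · calc W l P x ≤ D * min U (U ^ alpha n) := hW.trans hG
        _ ≤ D * (1 + 1 / m + C₁) * min U (U ^ alpha n) := by
            gcongr
            refine le_mul_of_one_le_right hD0.le ?_
            have : 0 < 1 / m := by positivity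
            linarith
  rcases le_or_gt (V0 P x) A with hx | hx
  · have hxn : ‖x‖ ≤ V0 P x / m := by rw [le_div_iff₀ hm, mul_comm]; exact (hbd x).1
    have hxA : ‖x‖ ≤ A / m := hxn.trans (by gcongr)
    have hUeq : U = Vn l x + lam * V0 P x := by rw [hU, storage, min_eq_left hx]
    have hUB : U ≤ B := by
      rw [hUeq, hB]
      have h1 := (hin x hxA).2
      have h2 : M' * ‖x‖ ≤ M' * (A / m) := by gcongr
      have h3 : lam * V0 P x ≤ lam * A := by gcongr
      linarith
    have hlamV : V0 P x ≤ U / lam := by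
      rw [le_div_iff₀ hlam, hUeq]; linarith
    refine ⟨V0 P x, V0_nonneg P x, ?_, min_le_left _ _, ?_⟩
    · rw [mul_min_of_nonneg _ _ hD0.le]
      refine le_min ?_ ?_
      · refine hlamV.trans ?_
        rw [div_eq_mul_one_div, mul_comm]
        gcongr
        exact (le_max_left _ _).trans (le_add_of_nonneg_right (by positivity))
      · have h1 := le_rpow_mul_rpow hα1 hU0 hUB
        calc V0 P x ≤ B ^ (1 - alpha n) * U ^ alpha n / lam := hlamV.trans (by gcongr)
          _ = B ^ (1 - alpha n) / lam * U ^ alpha n := by ring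
          _ ≤ D * U ^ alpha n := by
            gcongr
            exact (le_max_right _ _).trans (le_add_of_nonneg_right (by positivity))
    · calc ‖x‖ ≤ V0 P x / m := hxn
        _ = 1 / m * V0 P x := by ring
        _ ≤ (1 / m + C₁) * V0 P x := by
          have := V0_nonneg P x
          gcongr
          linarith
  · obtain ⟨h1, h2⟩ := hout x hx
    have hVU : Vn l x ≤ U := by
      rw [hU, storage, min_eq_right hx.le]
      have : 0 < lam * A := by positivity
      linarith
    have hVr : 0 ≤ Vn l x ^ alpha n := Real.rpow_nonneg hV0 _
    have hmr : 0 < m' ^ (1 - alpha n) := by positivity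
    have hmax : 0 ≤ max (1 / lam) (B ^ (1 - alpha n) / lam) := by positivity
    refine ⟨Vn l x ^ alpha n, hVr, ?_, min_le_right _ _, ?_⟩
    · rw [mul_min_of_nonneg _ _ hD0.le]
      refine le_min ?_ ?_
      · have h3 := rpow_mul_rpow_le hα1 hm' h2
        calc Vn l x ^ alpha n ≤ 1 / m' ^ (1 - alpha n) * U := by
              rw [div_mul_eq_mul_div, le_div_iff₀ hmr, mul_comm, one_mul]
              exact h3.trans hVU
          _ ≤ D * U := by
            gcongr
            exact (le_max_right _ _).trans (le_add_of_nonneg_left hmax)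
      · calc Vn l x ^ alpha n ≤ U ^ alpha n := by gcongr
          _ ≤ D * U ^ alpha n := by
            refine le_mul_of_one_le_left (by positivity) ?_
            exact (le_max_left _ _).trans (le_add_of_nonneg_left hmax)
    · refine h1.trans ?_
      have : 0 < 1 / m := by positivity
      gcongr
      linarith

/-- The rate of the storage function is bounded by the decay in each of the two regimes. -/
lemma exists_rate_storage_le (hn : 2 ≤ n) (l : ℕ → ℝ) {P : Matrix (Fin n) (Fin n) ℝ}
    (hP : P.PosDef) {A lam : ℝ} (hA : 0 < A) (hlam : 0 < lam) :
    ∃ B > 0, ∀ x : Fin n → ℝ,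
      (V0 P x ≤ A →
        min (storage l P A lam x) (storage l P A lam x ^ alpha n) ≤ B * V0 P x) ∧
      (A < V0 P x →
        min (storage l P A lam x) (storage l P A lam x ^ alpha n) ≤ B * Vn l x ^ alpha n) := by
  obtain ⟨m, hm, M, hM, hbd⟩ := exists_V0_bounds hn hP
  obtain ⟨C₁, hC₁, m', hm', hout⟩ := exists_norm_le_mul_Vn_rpow hn l hP hA
  obtain ⟨M', hM', hin⟩ := exists_fderiv_Vn_bound hn l (A / m)
  have hα := alpha_pos hn
  refine ⟨(M' / m + lam) + (1 + lam * A / m') ^ alpha n, by positivity, fun x => ⟨fun hx => ?_,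
    fun hx => ?_⟩⟩
  · refine (min_le_left _ _).trans ?_
    have hxn : ‖x‖ ≤ V0 P x / m := by rw [le_div_iff₀ hm, mul_comm]; exact (hbd x).1
    have hxA : ‖x‖ ≤ A / m := hxn.trans (by gcongr)
    have hV := V0_nonneg P x
    rw [storage, min_eq_left hx]
    calc Vn l x + lam * V0 P x ≤ M' * (V0 P x / m) + lam * V0 P x := by
          have h1 := (hin x hxA).2
          have h2 : M' * ‖x‖ ≤ M' * (V0 P x / m) := by gcongr
          linarith
      _ = (M' / m + lam) * V0 P x := by ring
      _ ≤ _ := mul_le_mul_of_nonneg_right (le_add_of_nonneg_right (by positivity)) hV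
  · refine (min_le_right _ _).trans ?_
    have hV := (hout x hx).2
    have hV0 : 0 < Vn l x := hm'.trans_le hV
    rw [storage, min_eq_right hx.le]
    calc (Vn l x + lam * A) ^ alpha n ≤ ((1 + lam * A / m') * Vn l x) ^ alpha n := by
          refine Real.rpow_le_rpow (by positivity) ?_ hα.le
          -- The lower bound m' on Vₙ absorbs the constant λA.
          have : lam * A ≤ lam * A / m' * Vn l x := by
            rw [div_mul_eq_mul_div, le_div_iff₀ hm']
            gcongr
          linarith
      _ = (1 + lam * A / m') ^ alpha n * Vn l x ^ alpha n :=
          Real.mul_rpow (by positivity) hV0.le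
      _ ≤ _ := by
          gcongr
          exact le_add_of_nonneg_left (by positivity)

lemma locallyLipschitz_min_V0 (hn : 2 ≤ n) {P : Matrix (Fin n) (Fin n) ℝ} (hP : P.PosDef)
    (A : ℝ) : LocallyLipschitz fun x : Fin n → ℝ => min (V0 P x) A := by
  obtain ⟨M, hM⟩ := exists_lipschitzWith_V0 hn hP
  exact (hM.min_const A).locallyLipschitz

/-- At a time where `min(V₀, A)` is differentiable, its derivative is that of `V₀` if `V₀ ≤ A` (and
`0` at the origin), and `0` if `V₀ > A`. -/
lemma deriv_min_V0 {P : Matrix (Fin n) (Fin n) ℝ} (hP : P.PosDef) {A : ℝ} (hA : 0 < A)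
    {x : ℝ → Fin n → ℝ} {x' : Fin n → ℝ} {t : ℝ} (hx : HasDerivAt x x' t)
    (hd : DifferentiableAt ℝ (fun s => min (V0 P (x s)) A) t) :
    (x t ≠ 0 → V0 P (x t) ≤ A →
      deriv (fun s => min (V0 P (x s)) A) t = (x t ⬝ᵥ P *ᵥ x') / V0 P (x t)) ∧
    (x t = 0 → deriv (fun s => min (V0 P (x s)) A) t = 0) ∧
    (A < V0 P (x t) → deriv (fun s => min (V0 P (x s)) A) t = 0) := by
  refine ⟨fun h0 hle => ?_, fun h0 => ?_, fun hlt => ?_⟩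
  · have h1 := (hasDerivAt_V0 hP hx h0).sub hd.hasDerivAt
    -- V₀ - min(V₀, A) is nonnegative and vanishes at t, so the two derivatives agree, even on the
    -- switching surface V₀ = A.
    have h2 : IsLocalMin ((fun s => V0 P (x s)) - fun s => min (V0 P (x s)) A) t := by
      refine Eventually.of_forall fun s => ?_
      simp only [Pi.sub_apply, min_eq_left hle, sub_self]
      exact sub_nonneg.2 (min_le_left _ _)
    have h3 := h2.hasDerivAt_eq_zero h1
    linarith
  · refine IsLocalMin.deriv_eq_zero (Eventually.of_forall fun s => ?_)
    simp only [h0, V0_zero, min_eq_left hA.le]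
    exact le_min (V0_nonneg _ _) hA.le
  · refine IsLocalMax.deriv_eq_zero (Eventually.of_forall fun s => ?_)
    simp only [min_eq_right hlt.le]
    exact min_le_right _ _

variable {σ : ℝ → ℝ} {a₁ a₂ b₁ b₂ σinf : ℝ}

/-- Along every trajectory, the storage function is dissipated at the rate `min(U, U ^ α)`. -/
theorem exists_isDissipative (hn : 2 ≤ n) {l : ℕ → ℝ} (hl : AdmissibleGains n l)
    (h : IsSFunction σ a₁ a₂ b₁ b₂ σinf) {K : Fin n → ℝ} {P : Matrix (Fin n) (Fin n) ℝ}
    (hKP : IsRobustPair (l n / σinf) (a₁ / b₁) (a₂ / b₂) K P) {A : ℝ} (hA : 0 < A)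
    (hAK : ∀ x : Fin n → ℝ, V0 P x ≤ A → |K ⬝ᵥ x| ≤ min 1 (min b₁ b₂)) :
    ∃ k₀ > 0, ∃ lam > 0, ∃ c > 0, ∃ C > 0, ∀ k, k₀ ≤ k → ∀ (d : ℝ → ℝ) (x : ℝ → Fin n → ℝ),
      IsTrajectory (-(l n / σinf)) σ (fun y => k * feedback l K P A k y) d x →
      IsDissipative (fun u => min u (u ^ alpha n)) c C d (fun t => storage l P A lam (x t)) := by
  have hP := hKP.1
  have hg : 0 < l n / σinf := div_pos (hl.1 n (by omega) le_rfl) h.limit_pos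
  obtain ⟨k₀, hk₀, c₁, hc₁, C₁, hC₁, hout⟩ := exists_outer_decay hn hl h hP hA
  obtain ⟨c₂, hc₂, C₂, hC₂, hin⟩ := exists_inner_decay hn h hg hKP
  obtain ⟨m, hm, M, hM, hbd⟩ := exists_V0_bounds hn hP
  obtain ⟨C₃, hC₃, hfield⟩ := exists_field_bound (n := n) h hg K
  obtain ⟨M', hM', hgrad⟩ := exists_fderiv_Vn_bound hn l (A / m)
  -- So λ c₂ exceeds by 1 the coefficient M'C₃/m of V₀ in the growth of Vₙ; the net inner decay is
  -- exactly V₀.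
  set lam := (M' * C₃ / m + 1) / c₂ with hlam
  have hlam0 : 0 < lam := by positivity
  obtain ⟨B, hB, hrate⟩ := exists_rate_storage_le hn l hP hA hlam0
  refine ⟨k₀, hk₀, lam, hlam0, min 1 c₁ / B, by positivity, C₁ + (M' * C₃ + lam * C₂),
    by positivity, fun k hk d x hx => ?_⟩
  have hk0 : 0 < k := hk₀.trans_le hk
  have hminAC : ∀ T > 0, AbsolutelyContinuousOnInterval (fun t => min (V0 P (x t)) A) 0 T :=
    fun T hT => comp_absolutelyContinuousOnInterval_of_locallyLipschitz
      (locallyLipschitz_min_V0 hn hP A) (hx.1 T hT)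
  have hVnAC : ∀ T > 0, AbsolutelyContinuousOnInterval (fun t => Vn l (x t)) 0 T :=
    fun T hT => comp_absolutelyContinuousOnInterval_of_locallyLipschitz
      (contDiff_Vn hn l).locallyLipschitz (hx.1 T hT)
  refine ⟨fun T hT => (hVnAC T hT).add ((hminAC T hT).const_mul lam),
    fun t _ => storage_nonneg hn l P hA hlam0 _, ?_⟩
  -- The exceptional null sets of the intervals [0, N + 1] are united over N.
  have hdiff : ∀ᵐ t, 0 ≤ t → DifferentiableAt ℝ (fun s => min (V0 P (x s)) A) t := by
    have : ∀ N : ℕ, ∀ᵐ t : ℝ, t ∈ Set.uIcc (0 : ℝ) (N + 1) →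
        DifferentiableAt ℝ (fun s => min (V0 P (x s)) A) t :=
      fun N => (hminAC (N + 1) (by positivity)).ae_differentiableAt
    filter_upwards [ae_all_iff.2 this] with t ht h0
    obtain ⟨N, hN⟩ := exists_nat_ge t
    refine ht N ?_
    rw [Set.uIcc_of_le (by positivity)]
    exact ⟨h0, by linarith⟩
  filter_upwards [ae_volPos_iff.1 hx.2, hdiff] with t htraj hmin ht
  have hder := htraj ht
  have hm' := hmin ht
  set F := J n *ᵥ x t + (-(l n / σinf) * σ (k * feedback l K P A k (x t) + d t)) • e n with hF
  have hVn : HasDerivAt (fun s => Vn l (x s)) (fderiv ℝ (Vn l) (x t) F) t :=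
    ((contDiff_Vn hn l).differentiable one_ne_zero (x t)).hasFDerivAt.comp_hasDerivAt t hder
  have hU : deriv (fun s => storage l P A lam (x s)) t
      = fderiv ℝ (Vn l) (x t) F + lam * deriv (fun s => min (V0 P (x s)) A) t :=
    (hVn.add (hm'.hasDerivAt.const_mul lam)).deriv
  rw [hU]
  obtain ⟨hd1, hd2, hd3⟩ := deriv_min_V0 hP hA hder hm'
  have hdt := abs_nonneg (d t)
  have hcB : ∀ q r : ℝ, 0 ≤ q → r ≤ B * q → -q ≤ -(1 / B) * r := fun q r _ hr => by
    have : 1 / B * r ≤ 1 / B * (B * q) := by gcongr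
    rw [← mul_assoc, one_div_mul_cancel hB.ne', one_mul] at this
    linarith
  set R := min (storage l P A lam (x t)) (storage l P A lam (x t) ^ alpha n) with hR
  have hU0 := storage_nonneg hn l P hA hlam0 (x t)
  have hR0 : 0 ≤ R := le_min hU0 (Real.rpow_nonneg hU0 _)
  rcases le_or_gt (V0 P (x t)) A with hle | hlt
  · have hfb : k * feedback l K P A k (x t) = K ⬝ᵥ x t := by
      rw [feedback, if_neg (not_lt.2 hle)]; field_simp
    rw [hfb] at hF
    have hV := V0_nonneg P (x t)
    have hxn : ‖x t‖ ≤ V0 P (x t) / m := by rw [le_div_iff₀ hm, mul_comm]; exact (hbd _).1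
    have hxA : ‖x t‖ ≤ A / m := hxn.trans (by gcongr)
    have h1 : fderiv ℝ (Vn l) (x t) F ≤ M' * (C₃ * (V0 P (x t) / m + |d t|)) := by
      refine (le_abs_self _).trans (((fderiv ℝ (Vn l) (x t)).le_opNorm F).trans ?_)
      have h2 := (hgrad _ hxA).1
      have h3 : ‖F‖ ≤ C₃ * (V0 P (x t) / m + |d t|) := by
        rw [hF]
        exact (hfield _ _).trans (by gcongr)
      gcongr
    have h4 : deriv (fun s => min (V0 P (x s)) A) t ≤ -c₂ * V0 P (x t) + C₂ * |d t| := by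
      by_cases h0 : x t = 0
      · rw [hd2 h0, h0, V0_zero]
        have : 0 ≤ C₂ * |d t| := by positivity
        linarith
      · rw [hd1 h0 hle, hF]
        exact hin _ _ h0 (hAK _ hle)
    have h5 := mul_le_mul_of_nonneg_left h4 hlam0.le
    have h6 : lam * c₂ = M' * C₃ / m + 1 := by rw [hlam]; field_simp
    have h7 : M' * (C₃ * (V0 P (x t) / m + |d t|))
        = M' * C₃ / m * V0 P (x t) + M' * C₃ * |d t| := by ring
    have h8 := hcB _ _ hV ((hrate (x t)).1 hle)
    have h9 : min 1 c₁ / B * R ≤ 1 / B * R := by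
      gcongr
      exact min_le_left _ _
    have h10 : lam * (-c₂ * V0 P (x t) + C₂ * |d t|)
        = -(M' * C₃ / m + 1) * V0 P (x t) + lam * C₂ * |d t| := by rw [← h6]; ring
    have h11 : 0 ≤ C₁ * |d t| := by positivity
    linarith
  · have hfb : feedback l K P A k (x t) = omega l n (x t) := by
      rw [feedback, if_pos hlt]
    rw [hfb] at hF
    have h1 := hout k hk (x t) (d t) hlt
    rw [← hF] at h1
    rw [hd3 hlt, mul_zero, add_zero]
    have hVr : 0 ≤ Vn l (x t) ^ alpha n := Real.rpow_nonneg (Vn_nonneg hn l _) _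
    have h8 := mul_le_mul_of_nonneg_left (hcB _ _ hVr ((hrate (x t)).2 hlt)) hc₁.le
    have h9 : min 1 c₁ / B * R ≤ c₁ * (1 / B * R) := by
      rw [← mul_assoc, mul_one_div]
      gcongr
      exact min_le_right _ _
    have h11 : 0 ≤ (M' * C₃ + lam * C₂) * |d t| := by positivity
    linarith

end Storage

/-! ### From dissipation to limsup and L_p bounds -/

section Estimates

variable {n : ℕ}

lemma euclNorm_nonneg (x : Fin n → ℝ) : 0 ≤ euclNorm x := norm_nonneg _

lemma euclNorm_le (x : Fin n → ℝ) : euclNorm x ≤ √n * ‖x‖ := by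
  rw [euclNorm, EuclideanSpace.norm_eq, ← Real.sqrt_sq (norm_nonneg x),
    ← Real.sqrt_mul (Nat.cast_nonneg n)]
  refine Real.sqrt_le_sqrt (le_trans (le_of_eq ?_) (dotProduct_self_le x))
  rw [dotProduct]
  refine Finset.sum_congr rfl fun i _ => ?_
  rw [Real.norm_eq_abs, sq_abs, sq]

lemma W_nonneg (hn : 2 ≤ n) (l : ℕ → ℝ) (P : Matrix (Fin n) (Fin n) ℝ) (x : Fin n → ℝ) :
    0 ≤ W l P x :=
  le_min (V0_nonneg P x) (Real.rpow_nonneg (Vn_nonneg hn l x) _)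

lemma IsDissipative.limsup_le {θ d y f : ℝ → ℝ} {c C B : ℝ} (h : IsDissipative θ c C d y)
    (hθ : IsRate θ) (hc : 0 < c) (hC : 0 < C) (hB : 0 < B) (hd : MemLp d ∞ volPos)
    (hf : ∀ t, 0 ≤ t → f t ≤ B * θ (y t)) :
    limsup (fun t => ENNReal.ofReal (f t)) atTop
      ≤ ENNReal.ofReal (B * (C / c)) * eLpNorm d ∞ volPos := by
  have hfin : eLpNorm d ∞ volPos ≠ ∞ := hd.eLpNorm_ne_top
  set D := (eLpNorm d ∞ volPos).toReal with hD
  have hD0 : 0 ≤ D := ENNReal.toReal_nonneg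
  have hdD : ∀ᵐ t, 0 ≤ t → |d t| ≤ D := by
    rw [← ae_volPos_iff]
    filter_upwards [ae_le_eLpNormEssSup (f := d) (μ := volPos)] with t ht
    rw [← eLpNorm_exponent_top] at ht
    have := (ENNReal.toReal_le_toReal (by simp) hfin).2 ht
    rwa [toReal_enorm] at this
  have hDe : eLpNorm d ∞ volPos = ENNReal.ofReal D := (ENNReal.ofReal_toReal hfin).symm
  rw [hDe, ← ENNReal.ofReal_mul (by positivity)]
  refine ENNReal.le_of_forall_pos_le_add fun ε hε _ => ?_
  have hev := h.eventually_le hθ hc hC (ε := ε / B) (by positivity) hdD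
  refine limsup_le_of_le (by isBoundedDefault) ?_
  filter_upwards [hev, eventually_ge_atTop 0] with t h1 h2
  rw [← ENNReal.ofReal_coe_nnreal, ← ENNReal.ofReal_add (by positivity) ε.coe_nonneg]
  refine ENNReal.ofReal_le_ofReal ((hf t h2).trans ?_)
  calc B * θ (y t) ≤ B * (C / c * D + ε / B) := by gcongr
    _ = B * (C / c) * D + ε := by field_simp

lemma integrableOn_abs_rpow {d : ℝ → ℝ} {p : ℝ≥0∞} (hp : 1 ≤ p) (hp' : p ≠ ∞)
    (hd : MemLp d p volPos) : IntegrableOn (fun t => |d t| ^ p.toReal) (Set.Ici 0) :=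
  hd.integrable_norm_rpow (one_pos.trans_le hp).ne' hp'

lemma IsDissipative.eLpNorm_le {θ d y : ℝ → ℝ} {c C : ℝ} (h : IsDissipative θ c C d y)
    (hθ : IsRate θ) (hc : 0 < c) (hC : 0 < C) {p : ℝ≥0∞} (hp : 1 ≤ p) (hp' : p ≠ ∞)
    (hd : MemLp d p volPos) (h0 : y 0 = 0) :
    eLpNorm (fun t => θ (y t)) p volPos ≤
      ENNReal.ofReal ((2 / c * (C * (2 * C / c) ^ (p.toReal - 1))) ^ p.toReal⁻¹)
        * eLpNorm d p volPos := by
  have hp0 : p ≠ 0 := (one_pos.trans_le hp).ne'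
  have hpr : 1 ≤ p.toReal := by
    have := (ENNReal.toReal_le_toReal ENNReal.one_ne_top hp').2 hp
    simpa using this
  obtain ⟨hInt, hle⟩ := h.integrableOn_and_integral_le hθ hc hC hpr
    (integrableOn_abs_rpow hp hp' hd) h0
  have hnorm : ∀ t ∈ Set.Ici (0 : ℝ), ‖θ (y t)‖ ^ p.toReal = θ (y t) ^ p.toReal := fun t ht => by
    rw [Real.norm_of_nonneg (hθ.nonneg (h.nonneg t ht))]
  have hmeas : AEStronglyMeasurable (fun t => θ (y t)) volPos :=
    (hθ.continuous.comp_continuousOn (continuousOn_Ici_of_forall h.ac)).aestronglyMeasurable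
      measurableSet_Ici
  have hmem : MemLp (fun t => θ (y t)) p volPos := by
    rw [← integrable_norm_rpow_iff hmeas hp0 hp']
    exact (integrableOn_congr_fun hnorm measurableSet_Ici).2 hInt
  rw [hmem.eLpNorm_eq_integral_rpow_norm hp0 hp', hd.eLpNorm_eq_integral_rpow_norm hp0 hp',
    ← ENNReal.ofReal_mul (by positivity), ← Real.mul_rpow (by positivity) (by positivity)]
  refine ENNReal.ofReal_le_ofReal (Real.rpow_le_rpow (by positivity) ?_ (by positivity))
  refine le_trans (le_of_eq ?_) hle
  exact setIntegral_congr_fun measurableSet_Ici hnorm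

lemma IsDissipative.eLpNorm_le_of_le {θ d y f : ℝ → ℝ} {c C B : ℝ} (h : IsDissipative θ c C d y)
    (hθ : IsRate θ) (hc : 0 < c) (hC : 0 < C) (hB : 0 < B) {p : ℝ≥0∞} (hp : 1 ≤ p) (hp' : p ≠ ∞)
    (hd : MemLp d p volPos) (h0 : y 0 = 0) (hf0 : ∀ t, 0 ≤ f t)
    (hf : ∀ t, 0 ≤ t → f t ≤ B * θ (y t)) :
    eLpNorm f p volPos ≤
      ENNReal.ofReal (B * (2 / c * (C * (2 * C / c) ^ (p.toReal - 1))) ^ p.toReal⁻¹)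
        * eLpNorm d p volPos := by
  rw [ENNReal.ofReal_mul hB.le, mul_assoc]
  refine (eLpNorm_le_mul_eLpNorm_of_ae_le_mul (g := fun t => θ (y t)) (c := B) ?_ p).trans ?_
  · refine ae_volPos_iff.2 (ae_of_all _ fun t ht => ?_)
    rw [Real.norm_of_nonneg (hf0 t), Real.norm_of_nonneg (hθ.nonneg (h.nonneg t ht))]
    exact hf t ht
  · gcongr
    exact h.eLpNorm_le hθ hc hC hp hp' hd h0

lemma isKInfty_const_mul {B : ℝ≥0} (hB : 0 < B) : IsKInfty fun s => B * s :=
  ⟨by fun_prop, fun _ _ hst => mul_lt_mul_of_pos_left hst hB, mul_zero B,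
    tendsto_id.const_mul_atTop hB⟩

/-- A linear gain suffices, since ‖x‖ is bounded by the rate θ(U) itself. -/
lemma isLpStabilizing_of_le {g B : ℝ} {σ : ℝ → ℝ} {κ : (Fin n → ℝ) → ℝ} {p : ℝ≥0∞} (hB : 0 < B)
    (h : ∀ d : ℝ → ℝ, MemLp d p volPos → ∀ x : ℝ → Fin n → ℝ, IsTrajectory g σ κ d x →
      (p ≠ ∞ → x 0 = 0 → eLpNorm (fun t => euclNorm (x t)) p volPos
        ≤ ENNReal.ofReal B * eLpNorm d p volPos) ∧
      (p = ∞ → limsup (fun t => ENNReal.ofReal (euclNorm (x t))) atTop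
        ≤ ENNReal.ofReal B * eLpNorm d p volPos)) : IsLpStabilizing g σ κ p := by
  refine ⟨fun s => B.toNNReal * s, isKInfty_const_mul (Real.toNNReal_pos.2 hB), fun d hd x hx => ?_⟩
  have heq : ((B.toNNReal * (eLpNorm d p volPos).toNNReal : ℝ≥0) : ℝ≥0∞)
      = ENNReal.ofReal B * eLpNorm d p volPos := by
    rw [ENNReal.coe_mul, ENNReal.coe_toNNReal hd.eLpNorm_ne_top]; rfl
  rw [heq]
  exact h d hd x hx

end Estimates

end IntegratorChain

theorem proposition2 (n : ℕ) (hn : 2 ≤ n) :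
    (∃ l : ℕ → ℝ, IntegratorChain.AdmissibleGains n l) ∧
    ∀ l : ℕ → ℝ, IntegratorChain.AdmissibleGains n l →
    ∀ (σ : ℝ → ℝ) (a₁ a₂ b₁ b₂ σinf : ℝ), IntegratorChain.IsSFunction σ a₁ a₂ b₁ b₂ σinf →
    (∃ (K : Fin n → ℝ) (P : Matrix (Fin n) (Fin n) ℝ),
      IntegratorChain.IsRobustPair (l n / σinf) (a₁ / b₁) (a₂ / b₂) K P) ∧
    ∀ (K : Fin n → ℝ) (P : Matrix (Fin n) (Fin n) ℝ),
      IntegratorChain.IsRobustPair (l n / σinf) (a₁ / b₁) (a₂ / b₂) K P →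
    ∀ A : ℝ, 0 < A →
      (∀ x : Fin n → ℝ, IntegratorChain.V0 P x ≤ A → |K ⬝ᵥ x| ≤ min 1 (min b₁ b₂)) →
    ∃ k₀ : ℝ, 0 < k₀ ∧ ∀ k : ℝ, k₀ ≤ k →
      -- `k ω` is an `L_p`-stabilizing feedback for every `p ∈ [1, ∞]`
      (∀ p : ℝ≥0∞, 1 ≤ p →
        IntegratorChain.IsLpStabilizing (-(l n / σinf)) σ
          (fun y => k * IntegratorChain.feedback l K P A k y) p) ∧
      -- the estimate for `p = ∞`
      (∃ C : ℝ, 0 < C ∧ ∀ d : ℝ → ℝ, MemLp d ∞ IntegratorChain.volPos →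
        ∀ x : ℝ → Fin n → ℝ,
          IntegratorChain.IsTrajectory (-(l n / σinf)) σ
            (fun y => k * IntegratorChain.feedback l K P A k y) d x →
          limsup (fun t => ENNReal.ofReal (IntegratorChain.W l P (x t))) atTop
            ≤ ENNReal.ofReal C * eLpNorm d ∞ IntegratorChain.volPos) ∧
      -- the estimate and the convergence for finite `p`
      (∀ p : ℝ≥0∞, 1 ≤ p → p ≠ ∞ →
        ∃ C : ℝ, 0 < C ∧ ∀ d : ℝ → ℝ, MemLp d p IntegratorChain.volPos →
          ∀ x : ℝ → Fin n → ℝ,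
            IntegratorChain.IsTrajectory (-(l n / σinf)) σ
              (fun y => k * IntegratorChain.feedback l K P A k y) d x →
            x 0 = 0 →
            eLpNorm (fun t => IntegratorChain.W l P (x t)) p IntegratorChain.volPos
                ≤ ENNReal.ofReal C * eLpNorm d p IntegratorChain.volPos ∧
              Tendsto x atTop (𝓝 0)) := by
  refine ⟨IntegratorChain.exists_admissibleGains hn, fun l hl σ a₁ a₂ b₁ b₂ σinf hσ => ⟨?_, ?_⟩⟩
  · exact IntegratorChain.exists_isRobustPair hn
      (div_pos (hl.1 n (by omega) le_rfl) hσ.limit_pos) (div_pos hσ.a₁_pos hσ.b₁_pos)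
  intro K P hKP A hA hAK
  obtain ⟨k₀, hk₀, lam, hlam, c, hc, C, hC, hdiss⟩ :=
    IntegratorChain.exists_isDissipative hn hl hσ hKP hA hAK
  obtain ⟨B, hB, hBle⟩ := IntegratorChain.exists_le_rate_storage hn l hKP.1 hA hlam
  have hθ := IntegratorChain.isRate_min_rpow (IntegratorChain.alpha_pos hn)
  have hn0 : (0 : ℝ) < √n := Real.sqrt_pos.2 (by positivity)
  have hEu : ∀ y : Fin n → ℝ, IntegratorChain.euclNorm y ≤ (√n * B) *
      min (IntegratorChain.storage l P A lam y)
        (IntegratorChain.storage l P A lam y ^ IntegratorChain.alpha n) := fun y => by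
    refine (IntegratorChain.euclNorm_le y).trans ?_
    rw [mul_assoc]
    exact mul_le_mul_of_nonneg_left (hBle y).1 hn0.le
  refine ⟨k₀, hk₀, fun k hk => ⟨fun p hp => ?_, ?_, fun p hp hp' => ?_⟩⟩
  · by_cases hp' : p = ∞
    · refine IntegratorChain.isLpStabilizing_of_le (B := √n * B * (C / c)) (by positivity)
        fun d hd x hx => ⟨fun h => absurd hp' h, fun _ => ?_⟩
      subst hp'
      exact (hdiss k hk d x hx).limsup_le hθ hc hC (by positivity) hd fun t _ => hEu (x t)
    · refine IntegratorChain.isLpStabilizing_of_le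
        (B := √n * B * (2 / c * (C * (2 * C / c) ^ (p.toReal - 1))) ^ p.toReal⁻¹) (by positivity)
        fun d hd x hx => ⟨fun _ h0 => ?_, fun h => absurd h hp'⟩
      exact (hdiss k hk d x hx).eLpNorm_le_of_le hθ hc hC (by positivity) hp hp' hd
        (by rw [h0, IntegratorChain.storage_zero hA])
        (fun t => IntegratorChain.euclNorm_nonneg _) fun t _ => hEu (x t)
  · exact ⟨B * (C / c), by positivity, fun d hd x hx =>
      (hdiss k hk d x hx).limsup_le hθ hc hC hB hd fun t _ => (hBle (x t)).2⟩
  · refine ⟨B * (2 / c * (C * (2 * C / c) ^ (p.toReal - 1))) ^ p.toReal⁻¹, by positivity,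
      fun d hd x hx h0 => ⟨?_, ?_⟩⟩
    · exact (hdiss k hk d x hx).eLpNorm_le_of_le hθ hc hC hB hp hp' hd
        (by rw [h0, IntegratorChain.storage_zero hA])
        (fun t => IntegratorChain.W_nonneg hn l P _) fun t _ => (hBle (x t)).2
    · have hpr : 1 ≤ p.toReal := by
        have := (ENNReal.toReal_le_toReal ENNReal.one_ne_top hp').2 hp
        simpa using this
      have h1 := (hdiss k hk d x hx).tendsto_zero hθ hc hC hpr
        (IntegratorChain.integrableOn_abs_rpow hp hp' hd)
        (by rw [h0, IntegratorChain.storage_zero hA])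
      -- Convergence of x follows from U → 0 through ‖x‖ ≤ B θ(U).
      have h2 := ((hθ.continuous.tendsto 0).comp h1).const_mul B
      rw [hθ.zero, mul_zero] at h2
      exact squeeze_zero_norm (fun t => (hBle (x t)).1) h2
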